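/- We work over $\mathbb{C}$. Let $2\le k\le m$ be integers, let $V$ be a vector space of dimension $2m+1$, and let $\omega$ be a skew bilinear form of rank $2m$ on $V$. Let $X=G_\omega(k,2m+1)$ be the odd symplectic Grassmannian, i.e. the variety of $k$-dimensional $\omega$-isotropic linear subspaces of $V$, regarded as a closed subvariety of $\mathbb{P}(\bigwedge^k V)$ by the Plücker embedding of $G(k,V)$. For $x\in X$ let $F(x,X)\subseteq \mathbb{P}(T_xX)$ be the variety (with its reduced structure) of lines contained in $X$ and passing through $x$. Then the automorphism group of the variety $X$ has exactly one closed orbit $Z$ on $X$, and for every $x\in X$ there is a surjective morphism $\pi:F(x,X)\to\mathbb{P}^{k-1}$ such that the following hold. (i) If $x\notin Z$, then $\pi$ is a (Zariski locally trivial) $\mathbb{P}^{2m-2k+1}$-bundle. (ii) If $x\in Z$, then there is a hyperplane $H\subseteq\mathbb{P}^{k-1}$ such that $\pi^{-1}(v)\cong\mathbb{P}^{2m-2k+2}$ for every $v\in H$, and $\pi^{-1}(v)\cong\mathbb{P}^{2m-2k+1}$ for every $v\in\mathbb{P}^{k-1}\setminus H$. Moreover, in this case $F(x,X)$ is not smooth.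 -/

import Mathlib

open scoped LinearAlgebra.Projectivization TensorProduct

namespace ProjVar

variable {E F : Type*} [AddCommGroup E] [Module ℂ E] [AddCommGroup F] [Module ℂ F]

/-! Classical (quasi-)projective varieties over `ℂ`: subsets of the set `ℙ ℂ E` of lines through the
origin of a finite-dimensional complex vector space `E`, with the Zariski topology and regular maps. -/

/-- The polynomial function on `E` given by a polynomial `P` in the linear forms of `E`.  If `P` is
homogeneous of degree `d`, this is a form of degree `d` on `E`. -/
noncomputable def formEval (P : MvPolynomial (Module.Dual ℂ E) ℂ) (v : E) : ℂ :=
  MvPolynomial.eval (fun φ : Module.Dual ℂ E => φ v) P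

/-- The form `P` vanishes at the point `p` of the projective space. -/
def VanishesAt (P : MvPolynomial (Module.Dual ℂ E) ℂ) (p : ℙ ℂ E) : Prop :=
  ∀ v ∈ p.submodule, formEval P v = 0

/-- The Zariski topology on the projective space of `E`, with the sets `{P ≠ 0}` for homogeneous `P`
as basic open sets. -/
instance zariskiTopology : TopologicalSpace (ℙ ℂ E) :=
  TopologicalSpace.generateFrom
    {U | ∃ (d : ℕ) (P : MvPolynomial (Module.Dual ℂ E) ℂ),
      P.IsHomogeneous d ∧ U = {p | ¬ VanishesAt P p}}

/-- `G : E → F` is a polynomial map all of whose coordinates are forms of degree `d`. -/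
def IsHomogeneousPolyMap (d : ℕ) (G : E → F) : Prop :=
  ∀ ψ : Module.Dual ℂ F, ∃ P : MvPolynomial (Module.Dual ℂ E) ℂ,
    P.IsHomogeneous d ∧ ∀ v, ψ (G v) = formEval P v

/-- A morphism from the variety `A` to projective space: locally in the Zariski topology it is of the
form `[v] ↦ [G₀(v) : ⋯ : G_N(v)]` for forms `G_i` of the same degree without common zero. -/
def IsRegularMap {A : Set (ℙ ℂ E)} (f : A → ℙ ℂ F) : Prop :=
  ∀ a : A, ∃ U : Set (ℙ ℂ E), IsOpen U ∧ (a : ℙ ℂ E) ∈ U ∧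
    ∃ (d : ℕ) (G : E → F), IsHomogeneousPolyMap d G ∧
      ∀ b : A, (b : ℙ ℂ E) ∈ U → ∀ v ∈ (b : ℙ ℂ E).submodule, v ≠ 0 →
        G v ≠ 0 ∧ G v ∈ (f b).submodule

/-- A bijection between varieties which is an isomorphism of varieties. -/
def IsBiregular {A : Set (ℙ ℂ E)} {B : Set (ℙ ℂ F)} (e : A ≃ B) : Prop :=
  IsRegularMap (fun a => (e a : ℙ ℂ F)) ∧ IsRegularMap (fun b => (e.symm b : ℙ ℂ E))

/-- The varieties `A` and `B` are isomorphic. -/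
def Isomorphic (A : Set (ℙ ℂ E)) (B : Set (ℙ ℂ F)) : Prop :=
  ∃ e : A ≃ B, IsBiregular e

/-- The orbit of `x` under the group of automorphisms of the variety `X`. -/
def autOrbit (X : Set (ℙ ℂ E)) (x : X) : Set (ℙ ℂ E) :=
  {y | ∃ g : X ≃ X, IsBiregular g ∧ (g x : ℙ ℂ E) = y}

/-- `Z` is a closed orbit of the automorphism group of the closed subvariety `X`. -/
def IsClosedAutOrbit (X Z : Set (ℙ ℂ E)) : Prop :=
  IsClosed Z ∧ ∃ x : X, Z = autOrbit X x

/-- The projective space `ℙⁿ`. -/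
abbrev PSpace (n : ℕ) : Type := ℙ ℂ (Fin (n + 1) → ℂ)

/-- A hyperplane of a projective space: the zero set of a nonzero linear form. -/
def IsHyperplane (H : Set (ℙ ℂ E)) : Prop :=
  ∃ l : Module.Dual ℂ E, l ≠ 0 ∧ H = {p | p.submodule ≤ LinearMap.ker l}

/-- The preimage of `S` under a map `π` defined on the variety `A`, as a subset of the projective
space containing `A`. -/
def preim {A : Set (ℙ ℂ E)} (π : A → ℙ ℂ F) (S : Set (ℙ ℂ F)) : Set (ℙ ℂ E) :=
  {p | ∃ h : p ∈ A, π ⟨p, h⟩ ∈ S}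

/-- `q` is the image `[v ⊗ w]` of the pair `([v], [w]) = (a, b)` under the Segre embedding. -/
def IsSegre (a : ℙ ℂ E) (b : ℙ ℂ F) (q : ℙ ℂ (E ⊗[ℂ] F)) : Prop :=
  q.submodule = Submodule.map₂ (TensorProduct.mk ℂ E F) a.submodule b.submodule

/-- The product variety `A × B`, embedded by the Segre embedding. -/
def segreProd (A : Set (ℙ ℂ E)) (B : Set (ℙ ℂ F)) : Set (ℙ ℂ (E ⊗[ℂ] F)) :=
  {q | ∃ a ∈ A, ∃ b ∈ B, IsSegre a b q}

/-- `π : A → ℙ(F)` is a (Zariski locally trivial) `ℙʳ`-bundle: it is a morphism, and every point of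
the base has an open neighbourhood `U` such that `π⁻¹(U)` is isomorphic over `U` to `U × ℙʳ`. -/
def IsProjectiveBundle (r : ℕ) {A : Set (ℙ ℂ E)} (π : A → ℙ ℂ F) : Prop :=
  IsRegularMap π ∧
  ∀ b : ℙ ℂ F, ∃ U : Set (ℙ ℂ F), IsOpen U ∧ b ∈ U ∧
    ∃ e : preim π U ≃ segreProd U (Set.univ : Set (PSpace r)), IsBiregular e ∧
      ∀ (a : A) (ha : (a : ℙ ℂ E) ∈ preim π U), ∃ t : PSpace r, IsSegre (π a) t (e ⟨a, ha⟩)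

/-- The linear subspace of `E` underlying the embedded projective tangent space at `p` of the closed
subvariety `A`: the common kernel of the differentials at `p` of all forms vanishing on `A`.  Its
dimension is one more than that of the Zariski tangent space of `A` at `p`.  (The differential
`w ↦ lineDeriv ℂ (formEval P) v w` of a form is linear in `w`, so this set is a linear subspace.) -/
def tangentVectors (A : Set (ℙ ℂ E)) (p : ℙ ℂ E) : Set E :=
  {w | ∀ (d : ℕ) (P : MvPolynomial (Module.Dual ℂ E) ℂ), P.IsHomogeneous d →
    (∀ a ∈ A, VanishesAt P a) → ∀ v ∈ p.submodule, lineDeriv ℂ (formEval P) v w = 0}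

/-- The dimension of `A` at `p`: the least Krull dimension of an open neighbourhood of `p` in `A`. -/
noncomputable def localDim (A : Set (ℙ ℂ E)) (p : ℙ ℂ E) : WithBot ℕ∞ :=
  ⨅ U : {U : Set (ℙ ℂ E) // IsOpen U ∧ p ∈ U}, topologicalKrullDim ↥(A ∩ U.1)

/-- The closed subvariety `A` is smooth: at each of its points the dimension of the Zariski tangent
space is the local dimension. -/
def IsSmoothVariety (A : Set (ℙ ℂ E)) : Prop :=
  ∀ p ∈ A, (Module.finrank ℂ (Submodule.span ℂ (tangentVectors A p)) : WithBot ℕ∞) = localDim A p + 1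

/-- The variety `F(x, X)` of lines contained in `X` and passing through `x`.  The lines of `ℙ(E)`
through `x` are the points of `ℙ(T_x ℙ(E)) = ℙ(E / x)`: the point `q` is the line of all `p`
contained in the plane of `E` which is the inverse image of `q`. -/
def vmrt (X : Set (ℙ ℂ E)) (x : ℙ ℂ E) : Set (ℙ ℂ (E ⧸ x.submodule)) :=
  {q | ∀ p : ℙ ℂ E, p.submodule ≤ q.submodule.comap x.submodule.mkQ → p ∈ X}

/-- The variety `G_ω(k, V)` of `k`-dimensional subspaces `U` of `V` which are isotropic for `ω`,
in the Plücker embedding `U ↦ [⋀ᵏ U]`. -/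
def isotropicGrassmannian (k : ℕ) (ω : LinearMap.BilinForm ℂ E) : Set (ℙ ℂ (⋀[ℂ]^k E)) :=
  {p | ∃ U : Submodule ℂ E, Module.finrank ℂ U = k ∧ (∀ u ∈ U, ∀ v ∈ U, ω u v = 0) ∧
    p.submodule = LinearMap.range (exteriorPower.map k U.subtype)}

end ProjVar

/-! Write k = n + 1 and let e span the radical of ω. The closed orbit Z consists of the isotropic
subspaces that contain e.

Lines through a point. At U the tangent space of the Grassmannian is U* ⊗ V/U, and the lines through
U correspond to the pure tensors v ⊗ b: such a line moves a basis u_i of U to u_i + t v_i b. These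
spaces are isotropic for all t exactly when β(b) is a multiple of v, where β : V/U → U* is induced
by ω. Hence F(x,X) is the set of all [v ⊗ b] with β(b) ∈ ⟨v⟩ (`vmrt_isotropicGrassmannian`), π is [v
⊗ b] ↦ [v], and the fibre over [v] is the projective space of β⁻¹⟨v⟩. If e ∉ U, then β is onto and a
linear section of it trivializes π wherever a given linear form does not vanish
(`isProjectiveBundle_rankOneProj`). If e ∈ U, then the image of β is the hyperplane H of functionals
that kill e, and the fibres jump over H. In this case F(x,X) is the union of the loci β(b) = 0 and v
∈ H, which have equal dimension; at a common point the tangent space contains directions of both and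
is too large (`not_isSmoothVariety_rankOneLocus`).

Orbits. The transvections v ↦ v + t ω(a,v) a act transitively on Z and on X \ Z
(`of_transvection_invariant`), and a closed set containing X \ Z meets Z
(`exists_mem_isotropicThrough_of_isClosed`). It remains to see that every automorphism g preserves
Z, without knowing that g is induced by a linear map. Let τ_t be a one-parameter group of
transvections. On a linear subspace of X, the maps g τ_t g⁻¹ form an algebraic family that starts
with the inclusion at t = 0. The degree of the defining forms does not depend on t, so it is always
1, and g τ_t g⁻¹ permutes the linear subspaces of X (`LinearFlow.preservesLinearSubspaces_conj`).

Z can be recognized from linear subspaces alone. If A has dimension n and is isotropic, the spaces A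
+ ⟨b⟩ with b ∈ A^⊥ form a linear subspace of X of vector dimension 2m - 2n + 2 if e ∈ A, and one
less otherwise. The special lines (those for which any two points collinear with the whole line are
collinear with each other) single out the linear subspaces of this type, so a point lies in Z if and
only if there is a special line through it inside a linear subspace of vector dimension 2m - 2n + 2
(`hasSpecialLine_of_mem`, `mem_of_hasSpecialLine`). Consequently g⁻¹(Z) is closed and invariant
under all transvections. If it were not contained in Z, it would be all of X, which is absurd since
g is bijective and Z ≠ X. Applied to g and to its inverse this gives g(Z) = Z
(`apply_mem_isotropicThrough_iff`). -/

namespace ProjVar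

/-! ### Forms, cones and the Zariski topology -/

section Forms

variable {E F : Type*} [AddCommGroup E] [Module ℂ E] [AddCommGroup F] [Module ℂ F]

theorem eval_smul_of_isHomogeneous {σ : Type*} {P : MvPolynomial σ ℂ} {d : ℕ}
    (hP : P.IsHomogeneous d) (c : ℂ) (f : σ → ℂ) :
    MvPolynomial.eval (fun i => c * f i) P = c ^ d * MvPolynomial.eval f P := by
  rw [MvPolynomial.eval_eq, MvPolynomial.eval_eq, Finset.mul_sum]
  refine Finset.sum_congr rfl fun m hm => ?_
  have h := hP.degree_eq_sum_deg_support hm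
  simp only [mul_pow, Finset.prod_mul_distrib]
  rw [Finset.prod_pow_eq_pow_sum, ← h]
  ring

theorem formEval_smul {P : MvPolynomial (Module.Dual ℂ E) ℂ} {d : ℕ} (hP : P.IsHomogeneous d)
    (c : ℂ) (v : E) : formEval P (c • v) = c ^ d * formEval P v := by
  simp only [formEval, map_smul, smul_eq_mul]
  exact eval_smul_of_isHomogeneous hP c _

theorem submodule_eq_span {p : ℙ ℂ E} {v : E} (hv : v ∈ p.submodule) (h0 : v ≠ 0) :
    p.submodule = Submodule.span ℂ {v} := by
  rw [Projectivization.submodule_eq, Submodule.mem_span_singleton] at hv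
  obtain ⟨a, rfl⟩ := hv
  have ha : a ≠ 0 := by rintro rfl; simp at h0
  rw [Projectivization.submodule_eq, Submodule.span_singleton_smul_eq ha.isUnit]

theorem rep_mem (p : ℙ ℂ E) : p.rep ∈ p.submodule := by
  rw [Projectivization.submodule_eq]; exact Submodule.mem_span_singleton_self _

theorem mem_mk {v : E} (hv : v ≠ 0) : v ∈ (Projectivization.mk ℂ v hv).submodule := by
  rw [Projectivization.submodule_mk]; exact Submodule.mem_span_singleton_self _

theorem eq_mk {p : ℙ ℂ E} {v : E} (hv : v ∈ p.submodule) (h0 : v ≠ 0) :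
    p = Projectivization.mk ℂ v h0 := by
  apply Projectivization.submodule_injective
  rw [submodule_eq_span hv h0, Projectivization.submodule_mk]

theorem eq_of_mem {p q : ℙ ℂ E} {v : E} (hp : v ∈ p.submodule) (hq : v ∈ q.submodule)
    (h0 : v ≠ 0) : p = q := by rw [eq_mk hp h0, eq_mk hq h0]

theorem exists_smul_of_mem {p : ℙ ℂ E} {v w : E} (hv : v ∈ p.submodule) (h0 : v ≠ 0)
    (hw : w ∈ p.submodule) : ∃ c : ℂ, w = c • v := by
  rw [submodule_eq_span hv h0, Submodule.mem_span_singleton] at hw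
  obtain ⟨c, rfl⟩ := hw
  exact ⟨c, rfl⟩

theorem vanishesAt_iff {P : MvPolynomial (Module.Dual ℂ E) ℂ} {d : ℕ} (hP : P.IsHomogeneous d)
    {p : ℙ ℂ E} {v : E} (hv : v ∈ p.submodule) (h0 : v ≠ 0) :
    VanishesAt P p ↔ formEval P v = 0 := by
  refine ⟨fun h => h v hv, fun h w hw => ?_⟩
  obtain ⟨c, rfl⟩ := exists_smul_of_mem hv h0 hw
  rw [formEval_smul hP, h, mul_zero]

theorem isOpen_not_vanishesAt {P : MvPolynomial (Module.Dual ℂ E) ℂ} {d : ℕ}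
    (hP : P.IsHomogeneous d) : IsOpen {p : ℙ ℂ E | ¬ VanishesAt P p} :=
  TopologicalSpace.isOpen_generateFrom_of_mem ⟨d, P, hP, rfl⟩

theorem isClosed_vanishesAt {P : MvPolynomial (Module.Dual ℂ E) ℂ} {d : ℕ}
    (hP : P.IsHomogeneous d) : IsClosed {p : ℙ ℂ E | VanishesAt P p} := by
  rw [← isOpen_compl_iff]; exact isOpen_not_vanishesAt hP

/-- Products of forms are forms, so the generating sets of the topology are already a basis. Open
conditions can thus be tested on one form. -/
theorem exists_form_of_isOpen {U : Set (ℙ ℂ E)} (hU : IsOpen U) {p : ℙ ℂ E} (hp : p ∈ U) :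
    ∃ (d : ℕ) (P : MvPolynomial (Module.Dual ℂ E) ℂ), P.IsHomogeneous d ∧ ¬ VanishesAt P p ∧
      ∀ q, ¬ VanishesAt P q → q ∈ U := by
  change TopologicalSpace.GenerateOpen _ U at hU
  induction hU with
  | basic s hs =>
    obtain ⟨d, P, hP, rfl⟩ := hs
    exact ⟨d, P, hP, hp, fun q hq => hq⟩
  | univ =>
    refine ⟨0, 1, MvPolynomial.isHomogeneous_one _ _, fun h => ?_, fun q _ => trivial⟩
    have := h _ (rep_mem p)
    simp [formEval] at this
  | inter s t _ _ ihs iht =>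
    obtain ⟨d, P, hP, h1, h2⟩ := ihs hp.1
    obtain ⟨d', P', hP', h1', h2'⟩ := iht hp.2
    have key : ∀ q : ℙ ℂ E, VanishesAt (P * P') q ↔ VanishesAt P q ∨ VanishesAt P' q := by
      intro q
      rw [vanishesAt_iff (hP.mul hP') (rep_mem q) q.rep_nonzero,
        vanishesAt_iff hP (rep_mem q) q.rep_nonzero, vanishesAt_iff hP' (rep_mem q) q.rep_nonzero]
      simp [formEval]
    refine ⟨d + d', P * P', hP.mul hP', ?_, fun q hq => ?_⟩
    · rw [key]; tauto
    · rw [key] at hq; push Not at hq; exact ⟨h2 q hq.1, h2' q hq.2⟩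
  | sUnion S _ ih =>
    obtain ⟨s, hs, hps⟩ := hp
    obtain ⟨d, P, hP, h1, h2⟩ := ih s hs hps
    exact ⟨d, P, hP, h1, fun q hq => ⟨s, hs, h2 q hq⟩⟩

theorem exists_form_of_isClosed {C : Set (ℙ ℂ E)} (hC : IsClosed C) {p : ℙ ℂ E} (hp : p ∉ C) :
    ∃ (d : ℕ) (P : MvPolynomial (Module.Dual ℂ E) ℂ), P.IsHomogeneous d ∧ ¬ VanishesAt P p ∧
      ∀ q ∈ C, VanishesAt P q := by
  obtain ⟨d, P, hP, h1, h2⟩ := exists_form_of_isOpen hC.isOpen_compl hp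
  exact ⟨d, P, hP, h1, fun q hq => by_contra fun h => h2 q h hq⟩

theorem IsHomogeneousPolyMap.of_linearMap (G : E →ₗ[ℂ] F) : IsHomogeneousPolyMap 1 G := fun ψ =>
  ⟨MvPolynomial.X (ψ ∘ₗ G), MvPolynomial.isHomogeneous_X _ _, fun v => by simp [formEval]⟩

theorem IsHomogeneousPolyMap.of_bilinear [FiniteDimensional ℂ E] (B : E →ₗ[ℂ] E →ₗ[ℂ] F) :
    IsHomogeneousPolyMap 2 (fun v => B v v) := fun ψ => by
  let b := Module.finBasis ℂ E
  refine ⟨∑ i, ∑ j, MvPolynomial.C (ψ (B (b i) (b j))) *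
    (MvPolynomial.X (b.coord i) * MvPolynomial.X (b.coord j)), ?_, fun v => ?_⟩
  · refine MvPolynomial.IsHomogeneous.sum _ _ _ fun i _ =>
      MvPolynomial.IsHomogeneous.sum _ _ _ fun j _ => MvPolynomial.IsHomogeneous.C_mul ?_ _
    exact (MvPolynomial.isHomogeneous_X _ _).mul (MvPolynomial.isHomogeneous_X _ _)
  · conv_lhs => rw [← b.sum_repr v]
    simp only [map_sum, map_smul, LinearMap.sum_apply, LinearMap.smul_apply, smul_eq_mul, formEval,
      map_mul, MvPolynomial.eval_C, MvPolynomial.eval_X, Module.Basis.coord_apply]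
    rw [Finset.sum_comm]
    simp only [Finset.mul_sum]
    refine Finset.sum_congr rfl fun i _ => Finset.sum_congr rfl fun j _ => ?_
    ring

theorem IsHomogeneousPolyMap.exists_comp {d e : ℕ} {G : E → F} (hG : IsHomogeneousPolyMap d G)
    {P : MvPolynomial (Module.Dual ℂ F) ℂ} (hP : P.IsHomogeneous e) :
    ∃ Q : MvPolynomial (Module.Dual ℂ E) ℂ, Q.IsHomogeneous (d * e) ∧
      ∀ v, formEval Q v = formEval P (G v) := by
  choose R hR hR' using hG
  refine ⟨MvPolynomial.aeval R P, hP.aeval R hR, fun v => ?_⟩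
  simp only [formEval, ← MvPolynomial.coe_aeval_eq_eval, RingHom.coe_coe]
  rw [← AlgHom.comp_apply, MvPolynomial.comp_aeval]
  simp only [hR', formEval, MvPolynomial.aeval_eq_eval]

theorem isClosed_zeros {d : ℕ} {G : E → F} (hG : IsHomogeneousPolyMap d G) :
    IsClosed {p : ℙ ℂ E | ∀ v ∈ p.submodule, G v = 0} := by
  choose R hR hR' using hG
  have : {p : ℙ ℂ E | ∀ v ∈ p.submodule, G v = 0} = ⋂ ψ, {p | VanishesAt (R ψ) p} := by
    ext p
    simp only [Set.mem_ofPred_eq, Set.mem_iInter, VanishesAt, ← hR']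
    constructor
    · intro h ψ v hv
      rw [h v hv, map_zero]
    · intro h v hv
      rw [← Module.forall_dual_apply_eq_zero_iff ℂ]
      exact fun ψ => h ψ v hv
  rw [this]
  exact isClosed_iInter fun ψ => isClosed_vanishesAt (hR ψ)

theorem isOpen_linear_ne (l : Module.Dual ℂ E) :
    IsOpen {p : ℙ ℂ E | ¬ p.submodule ≤ LinearMap.ker l} := by
  have : {p : ℙ ℂ E | ¬ p.submodule ≤ LinearMap.ker l} =
      {p : ℙ ℂ E | ∀ v ∈ p.submodule, l v = 0}ᶜ := by
    ext p
    rfl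
  rw [this, isOpen_compl_iff]
  exact isClosed_zeros (IsHomogeneousPolyMap.of_linearMap l)

theorem IsRegularMap.of_linearMap {A : Set (ℙ ℂ E)} {f : A → ℙ ℂ F} (G : E →ₗ[ℂ] F)
    (h : ∀ (a : A), ∀ v ∈ (a : ℙ ℂ E).submodule, v ≠ 0 → G v ≠ 0 ∧ G v ∈ (f a).submodule) :
    IsRegularMap f := fun _ =>
  ⟨Set.univ, isOpen_univ, trivial, 1, G, IsHomogeneousPolyMap.of_linearMap G, fun b _ => h b⟩

theorem IsRegularMap.continuous {A : Set (ℙ ℂ E)} {f : A → ℙ ℂ F} (hf : IsRegularMap f) :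
    Continuous f := by
  refine continuous_generateFrom_iff.mpr ?_
  rintro _ ⟨e, P, hP, rfl⟩
  rw [isOpen_iff_forall_mem_open]
  intro a ha
  obtain ⟨U, hU, haU, d, G, hG, hGU⟩ := hf a
  obtain ⟨Q, hQ, hQP⟩ := hG.exists_comp hP
  have key : ∀ b : A, (b : ℙ ℂ E) ∈ U → (VanishesAt Q b ↔ VanishesAt P (f b)) := by
    intro b hb
    obtain ⟨h1, h2⟩ := hGU b hb _ (rep_mem _) (Projectivization.rep_nonzero _)
    rw [vanishesAt_iff hQ (rep_mem (b : ℙ ℂ E)) (Projectivization.rep_nonzero _), hQP,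
      vanishesAt_iff hP h2 h1]
  refine ⟨Subtype.val ⁻¹' (U ∩ {p | ¬ VanishesAt Q p}), fun b hb => ?_,
    (hU.inter (isOpen_not_vanishesAt hQ)).preimage continuous_subtype_val, haU, ?_⟩
  · have := hb.2
    rw [Set.mem_ofPred_eq, key b hb.1] at this
    exact this
  · rw [Set.mem_ofPred_eq, key a haU]
    exact ha

/-- The nonzero vectors on the lines of a set of points of projective space. -/
def cone (C : Set (ℙ ℂ E)) : Set E := {v | ∃ h : v ≠ 0, Projectivization.mk ℂ v h ∈ C}

theorem mem_cone_iff {C : Set (ℙ ℂ E)} {p : ℙ ℂ E} {v : E} (hv : v ∈ p.submodule) (h0 : v ≠ 0) :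
    v ∈ cone C ↔ p ∈ C := by
  rw [eq_mk hv h0]
  exact ⟨fun ⟨_, h⟩ => h, fun h => ⟨h0, h⟩⟩

theorem smul_mem_cone_iff {C : Set (ℙ ℂ E)} {v : E} {c : ℂ} (hc : c ≠ 0) :
    c • v ∈ cone C ↔ v ∈ cone C := by
  by_cases h0 : v = 0
  · simp [h0]
  · rw [mem_cone_iff (mem_mk h0) h0, mem_cone_iff (p := Projectivization.mk ℂ v h0)
      (Submodule.smul_mem _ _ (mem_mk h0)) (smul_ne_zero hc h0)]

theorem exists_polynomial_line (P : MvPolynomial (Module.Dual ℂ E) ℂ) (a b : E) :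
    ∃ q : Polynomial ℂ, ∀ s, q.eval s = formEval P (a + s • b) := by
  refine ⟨MvPolynomial.aeval (fun φ : Module.Dual ℂ E =>
    Polynomial.C (φ a) + Polynomial.X * Polynomial.C (φ b)) P, fun s => ?_⟩
  have h := MvPolynomial.comp_aeval_apply (fun φ : Module.Dual ℂ E =>
    Polynomial.C (φ a) + Polynomial.X * Polynomial.C (φ b)) (Polynomial.aeval s : _ →ₐ[ℂ] ℂ) P
  rw [Polynomial.coe_aeval_eq_eval] at h
  rw [h, MvPolynomial.aeval_eq_eval, formEval]
  congr 2
  funext φ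
  simp only [Polynomial.eval_add, Polynomial.eval_mul, Polynomial.eval_C, Polynomial.eval_X, map_add,
    map_smul, smul_eq_mul]

theorem polynomial_eq_zero_of_forall_ne {q : Polynomial ℂ} (h : ∀ s, s ≠ 0 → q.eval s = 0) :
    q = 0 := by
  refine Polynomial.eq_zero_of_infinite_isRoot q (Set.Infinite.mono (s := {0}ᶜ) ?_ ?_)
  · intro s hs; exact h s hs
  · exact (Set.finite_singleton (0 : ℂ)).infinite_compl

/-- The point [w] is the limit of [v + t w] for t → ∞: for a form P vanishing on C, the polynomial s
↦ P(w + s v) vanishes at every s = 1/t ≠ 0, hence at s = 0. -/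
theorem mem_cone_of_isClosed {C : Set (ℙ ℂ E)} (hC : IsClosed C) {v w : E} (hw : w ≠ 0)
    (h : ∀ t : ℂ, v + t • w ∈ cone C) : w ∈ cone C := by
  refine ⟨hw, by_contra fun hn => ?_⟩
  obtain ⟨d, P, hP, h1, h2⟩ := exists_form_of_isClosed hC hn
  rw [vanishesAt_iff hP (mem_mk hw) hw] at h1
  obtain ⟨q, hq⟩ := exists_polynomial_line P w v
  have h0 : q = 0 := polynomial_eq_zero_of_forall_ne fun s hs => by
    obtain ⟨h3, h4⟩ := h s⁻¹
    have := h2 _ h4 _ (mem_mk h3)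
    rw [hq, show w + s • v = s • (v + s⁻¹ • w) by
      rw [smul_add, smul_smul, mul_inv_cancel₀ hs, one_smul, add_comm], formEval_smul hP, this,
      mul_zero]
  apply h1
  have := hq 0
  rw [h0] at this
  simpa using this.symm

theorem IsBiregular.symm {A : Set (ℙ ℂ E)} {B : Set (ℙ ℂ F)} {e : A ≃ B} (h : IsBiregular e) :
    IsBiregular e.symm := ⟨h.2, h.1⟩

end Forms

/-! ### Coprime tuples in a factorial ring -/

section CoprimeTuples

variable {R J : Type*} [CommRing R]

/-- The entries of the family `G` have no common factor. -/
def IsCoprimeFamily (G : J → R) : Prop := ∀ q, (∀ j, q ∣ G j) → IsUnit q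

theorem exists_eq_mul_isCoprimeFamily [IsDomain R] [UniqueFactorizationMonoid R] [Fintype J]
    (H : J → R) {j₀ : J} (h : H j₀ ≠ 0) :
    ∃ (D : R) (G : J → R), D ≠ 0 ∧ IsCoprimeFamily G ∧ ∀ j, H j = D * G j := by
  classical
  let _ := UniqueFactorizationMonoid.strongNormalizationMonoid (α := R)
  let _ := UniqueFactorizationMonoid.toNormalizedGCDMonoid R
  obtain ⟨G, hG, h1⟩ := Finset.extract_gcd (s := Finset.univ) H ⟨j₀, Finset.mem_univ _⟩
  refine ⟨_, G, ?_, fun q hq => ?_, fun j => hG j (Finset.mem_univ _)⟩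
  · rintro h0
    apply h
    rw [hG j₀ (Finset.mem_univ _), h0, zero_mul]
  · exact isUnit_of_dvd_one (h1 ▸ Finset.dvd_gcd fun j _ => hq j)

theorem IsCoprimeFamily.exists_ne_zero [Nontrivial R] {G : J → R} (hG : IsCoprimeFamily G) :
    ∃ j, G j ≠ 0 := by
  by_contra! h
  exact not_isUnit_zero (hG 0 fun j => by rw [h j])

/-- By proportionality G j divides every G' j * G i, hence their gcd, which is G' j up to a unit
because G is coprime. The quotient for one nonzero G j then serves for all indices. -/
theorem IsCoprimeFamily.exists_eq_mul [IsDomain R] [UniqueFactorizationMonoid R] [Fintype J]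
    {G G' : J → R} (hG : IsCoprimeFamily G)
    (h : ∀ i j, G' i * G j = G' j * G i) : ∃ u, ∀ j, G' j = u * G j := by
  classical
  let _ := UniqueFactorizationMonoid.strongNormalizationMonoid (α := R)
  let _ := UniqueFactorizationMonoid.toNormalizedGCDMonoid R
  obtain ⟨j, hj⟩ := hG.exists_ne_zero
  have h1 : Finset.univ.gcd G = 1 := by
    have := hG (Finset.univ.gcd G) fun j => Finset.gcd_dvd (Finset.mem_univ _)
    rw [← Finset.normalize_gcd]
    exact normalize_eq_one.mpr this
  have h2 : G j ∣ Finset.univ.gcd fun i => G' j * G i :=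
    Finset.dvd_gcd fun i _ => ⟨G' i, by rw [← h, mul_comm]⟩
  obtain ⟨u, hu⟩ := h2.trans (Finset.gcd_mul_left' ..).dvd
  rw [h1, mul_one] at hu
  refine ⟨u, fun i => mul_right_cancel₀ hj ?_⟩
  rw [h, hu]; ring

end CoprimeTuples

/-! ### Families of maps of projective spaces over the affine line -/

section LocallyPolynomial

variable {E F : Type*} [AddCommGroup E] [Module ℂ E] [AddCommGroup F] [Module ℂ F]
  {σ : Type*}

/-- A map from an affine space to a vector space with polynomial coordinates. -/
def IsPolynomialMap (H : (σ → ℂ) → F) : Prop :=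
  ∀ ψ : Module.Dual ℂ F, ∃ P : MvPolynomial σ ℂ, ∀ a, ψ (H a) = MvPolynomial.eval a P

/-- A map from a subset of an affine space to a projective space which is locally given by
polynomials without common zero. -/
def IsLocallyPolynomial {S : Set (σ → ℂ)} (f : S → ℙ ℂ F) : Prop :=
  ∀ a : S, ∃ (H : (σ → ℂ) → F) (h : MvPolynomial σ ℂ), IsPolynomialMap H ∧
    MvPolynomial.eval a.1 h ≠ 0 ∧ ∀ b : S, MvPolynomial.eval b.1 h ≠ 0 →
      H b.1 ≠ 0 ∧ H b.1 ∈ (f b).submodule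

theorem IsPolynomialMap.exists_comp {H : (σ → ℂ) → E} (hH : IsPolynomialMap H)
    (P : MvPolynomial (Module.Dual ℂ E) ℂ) :
    ∃ Q : MvPolynomial σ ℂ, ∀ a, MvPolynomial.eval a Q = formEval P (H a) := by
  choose R hR using hH
  refine ⟨MvPolynomial.aeval R P, fun a => ?_⟩
  simp only [formEval, ← MvPolynomial.coe_aeval_eq_eval, RingHom.coe_coe]
  rw [← AlgHom.comp_apply, MvPolynomial.comp_aeval]
  simp only [hR, MvPolynomial.aeval_eq_eval]

theorem IsPolynomialMap.comp {H : (σ → ℂ) → E} (hH : IsPolynomialMap H) {d : ℕ} {G : E → F}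
    (hG : IsHomogeneousPolyMap d G) : IsPolynomialMap (fun a => G (H a)) := fun ψ => by
  obtain ⟨P, -, hP⟩ := hG ψ
  obtain ⟨Q, hQ⟩ := hH.exists_comp P
  exact ⟨Q, fun a => by rw [hP, hQ]⟩

theorem IsLocallyPolynomial.comp {S : Set (σ → ℂ)} {f : S → ℙ ℂ E} (hf : IsLocallyPolynomial f)
    {A : Set (ℙ ℂ E)} (hA : ∀ a, f a ∈ A) {g : A → ℙ ℂ F} (hg : IsRegularMap g) :
    IsLocallyPolynomial (fun a => g ⟨f a, hA a⟩) := by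
  intro a
  obtain ⟨U, hU, haU, d, G, hG, hGU⟩ := hg ⟨f a, hA a⟩
  obtain ⟨e, P, hP, hPa, hPU⟩ := exists_form_of_isOpen hU haU
  obtain ⟨H, h, hH, ha, hHS⟩ := hf a
  obtain ⟨Q, hQ⟩ := hH.exists_comp P
  have key : ∀ b : S, MvPolynomial.eval b.1 h ≠ 0 →
      (VanishesAt P (f b) ↔ MvPolynomial.eval b.1 Q = 0) := fun b hb => by
    rw [vanishesAt_iff hP (hHS b hb).2 (hHS b hb).1, hQ]
  refine ⟨_, h * Q, hH.comp hG, ?_, fun b hb => ?_⟩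
  · rw [map_mul]
    exact mul_ne_zero ha fun h0 => hPa ((key a ha).mpr h0)
  · rw [map_mul] at hb
    have hb1 := left_ne_zero_of_mul hb
    exact hGU ⟨f b, hA b⟩ (hPU _ fun h0 => right_ne_zero_of_mul hb ((key b hb1).mp h0)) _
      (hHS b hb1).2 (hHS b hb1).1

theorem repr_mul_eq_of_mem {J : Type*} (c : Module.Basis J ℂ F) {p : ℙ ℂ F} {v w : F}
    (hv : v ∈ p.submodule) (hw : w ∈ p.submodule) (i j : J) :
    c.repr v i * c.repr w j = c.repr v j * c.repr w i := by
  obtain ⟨a, rfl⟩ := exists_smul_of_mem (rep_mem p) p.rep_nonzero hv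
  obtain ⟨b, rfl⟩ := exists_smul_of_mem (rep_mem p) p.rep_nonzero hw
  simp only [map_smul, Finsupp.smul_apply, smul_eq_mul]; ring

/-- A locally polynomial map on a Zariski dense set is globally given by coprime polynomials, which
have no common zero on the set. -/
theorem IsLocallyPolynomial.exists_isCoprimeFamily [Finite σ] {J : Type*} [Fintype J]
    (c : Module.Basis J ℂ F)
    {S : Set (σ → ℂ)} (hS : ∀ p : MvPolynomial σ ℂ, (∀ a ∈ S, MvPolynomial.eval a p = 0) → p = 0)
    {f : S → ℙ ℂ F} (hf : IsLocallyPolynomial f) :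
    ∃ G : J → MvPolynomial σ ℂ, IsCoprimeFamily G ∧ ∀ a : S,
      (∑ j, MvPolynomial.eval a.1 (G j) • c j) ≠ 0 ∧
      (∑ j, MvPolynomial.eval a.1 (G j) • c j) ∈ (f a).submodule := by
  have coords : ∀ H : (σ → ℂ) → F, IsPolynomialMap H → ∃ P : J → MvPolynomial σ ℂ,
      ∀ a j, c.repr (H a) j = MvPolynomial.eval a (P j) := fun H hH => by
    choose P hP using fun j => hH (c.coord j)
    exact ⟨P, fun a j => hP j a⟩
  obtain ⟨a₀, ha₀⟩ : S.Nonempty := by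
    by_contra! h
    exact one_ne_zero (hS 1 (by simp [h]))
  obtain ⟨H, h, hH, hh, hHS⟩ := hf ⟨a₀, ha₀⟩
  obtain ⟨P, hP⟩ := coords H hH
  obtain ⟨j₀, hj₀⟩ : ∃ j, P j ≠ 0 := by
    by_contra! h0
    refine (hHS _ hh).1 (c.ext_elem fun j => ?_)
    rw [hP, h0]; simp
  obtain ⟨D, G, hD, hG, hPG⟩ := exists_eq_mul_isCoprimeFamily P hj₀
  refine ⟨G, hG, fun a => ?_⟩
  obtain ⟨H', h', hH', hh', hHS'⟩ := hf a
  obtain ⟨P', hP'⟩ := coords H' hH'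
  -- Two local representations are proportional wherever h and h' do not vanish; multiplied by h *
  -- h' the relation holds on all of the dense set S.
  have key : ∀ i j, P' i * P j = P' j * P i := fun i j => by
    have h1 : h * h' * (P' i * P j - P' j * P i) = 0 := hS _ fun b hb => by
      rw [map_mul, map_mul]
      by_cases hb1 : MvPolynomial.eval b h = 0
      · rw [hb1]; ring
      by_cases hb2 : MvPolynomial.eval b h' = 0
      · rw [hb2]; ring
      have := repr_mul_eq_of_mem c (hHS' ⟨b, hb⟩ hb2).2 (hHS ⟨b, hb⟩ hb1).2 i j
      rw [hP, hP, hP', hP'] at this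
      rw [map_sub, map_mul, map_mul, this, sub_self, mul_zero]
    have h2 : h ≠ 0 := by rintro rfl; simp at hh
    have h3 : h' ≠ 0 := by rintro rfl; simp at hh'
    exact sub_eq_zero.mp ((mul_eq_zero.mp h1).resolve_left (mul_ne_zero h2 h3))
  -- The local representation at a is a polynomial multiple u of G. It does not vanish at a, so
  -- neither u nor the tuple G does.
  obtain ⟨u, hu⟩ := hG.exists_eq_mul (G' := P') fun i j => mul_left_cancel₀ hD <| by
    have := key i j
    rw [hPG i, hPG j] at this
    linear_combination this
  have h4 : H' a.1 = MvPolynomial.eval a.1 u • ∑ j, MvPolynomial.eval a.1 (G j) • c j := by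
    rw [← c.sum_repr (H' a.1), Finset.smul_sum]
    refine Finset.sum_congr rfl fun j _ => ?_
    rw [hP', hu, map_mul, smul_smul]
  obtain ⟨h5, h6⟩ := hHS' a hh'
  have h7 : MvPolynomial.eval a.1 u ≠ 0 := by
    intro h0; rw [h4, h0, zero_smul] at h5; exact h5 rfl
  rw [h4] at h5 h6
  exact ⟨right_ne_zero_of_smul h5, by rwa [Submodule.smul_mem_iff _ h7] at h6⟩

/-- Dilation by 2 multiplies the component of degree d by 2 ^ d, and 2 ^ d = 2 only for d = 1. -/
theorem isHomogeneous_one_of_eval_two_mul [Finite σ] {p : MvPolynomial σ ℂ}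
    (h : ∀ w, MvPolynomial.eval (fun i => 2 * w i) p = 2 * MvPolynomial.eval w p) :
    p.IsHomogeneous 1 := by
  set N := p.totalDegree + 1
  have h1 : ∑ d ∈ Finset.range N,
      MvPolynomial.C ((2 : ℂ) ^ d - 2) * MvPolynomial.homogeneousComponent d p = 0 := by
    refine MvPolynomial.funext fun w => ?_
    have h2 := h w
    rw [← MvPolynomial.sum_homogeneousComponent p] at h2
    simp only [map_sum] at h2
    simp only [map_sum, map_mul, MvPolynomial.eval_C, sub_mul, Finset.sum_sub_distrib, map_zero]
    rw [← Finset.mul_sum, ← h2, sub_eq_zero]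
    exact Finset.sum_congr rfl fun d _ => (eval_smul_of_isHomogeneous
      (MvPolynomial.homogeneousComponent_isHomogeneous d p) 2 w).symm
  have h3 : ∀ e, e ≠ 1 → MvPolynomial.homogeneousComponent e p = 0 := fun e he => by
    by_cases heN : e < N
    · have h4 := congrArg (MvPolynomial.homogeneousComponent e) h1
      rw [map_sum, map_zero, Finset.sum_eq_single e] at h4
      · rw [MvPolynomial.homogeneousComponent_C_mul, MvPolynomial.homogeneousComponent_of_mem
          (MvPolynomial.homogeneousComponent_mem e p), if_pos rfl] at h4
        refine (mul_eq_zero.mp h4).resolve_left fun h5 => he ?_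
        rw [map_eq_zero_iff _ (MvPolynomial.C_injective σ ℂ), sub_eq_zero] at h5
        have h6 : (2 : ℕ) ^ e = 2 ^ 1 := by exact_mod_cast h5
        exact Nat.pow_right_injective le_rfl h6
      · intro d _ hd
        rw [MvPolynomial.homogeneousComponent_C_mul, MvPolynomial.homogeneousComponent_of_mem
          (MvPolynomial.homogeneousComponent_mem d p), if_neg hd.symm, mul_zero]
      · intro hn; exact absurd (Finset.mem_range.mpr heN) hn
    · exact MvPolynomial.homogeneousComponent_eq_zero _ _ (by omega)
  have h7 : p = MvPolynomial.homogeneousComponent 1 p := by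
    conv_lhs => rw [← MvPolynomial.sum_homogeneousComponent p]
    by_cases h1N : 1 ∈ Finset.range (p.totalDegree + 1)
    · exact Finset.sum_eq_single_of_mem 1 h1N fun e _ he => h3 e he
    · rw [MvPolynomial.homogeneousComponent_eq_zero 1 p (by simpa using h1N)]
      exact Finset.sum_eq_zero fun e he => h3 e fun h0 => h1N (h0 ▸ he)
  rw [h7]
  exact MvPolynomial.homogeneousComponent_isHomogeneous 1 p

theorem exists_linearMap_of_isHomogeneous_one {p : MvPolynomial σ ℂ} (hp : p.IsHomogeneous 1) :
    ∃ l : (σ → ℂ) →ₗ[ℂ] ℂ, ∀ w, l w = MvPolynomial.eval w p := by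
  have h : p ∈ MvPolynomial.homogeneousSubmodule σ ℂ 1 := hp
  rw [MvPolynomial.homogeneousSubmodule_one_eq_span_X] at h
  clear hp
  induction h using Submodule.span_induction with
  | mem x hx =>
    obtain ⟨i, rfl⟩ := hx
    exact ⟨LinearMap.proj i, fun w => by simp⟩
  | zero => exact ⟨0, fun w => by simp⟩
  | add x y _ _ hx hy =>
    obtain ⟨l, hl⟩ := hx
    obtain ⟨l', hl'⟩ := hy
    exact ⟨l + l', fun w => by simp [hl, hl']⟩
  | smul a x _ hx =>
    obtain ⟨l, hl⟩ := hx
    exact ⟨a • l, fun w => by simp [hl, MvPolynomial.smul_eval]⟩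

theorem polynomial_eval_eq_of_forall_ne_zero {q : Polynomial ℂ} (h : ∀ x, q.eval x ≠ 0) (x y : ℂ) :
    q.eval x = q.eval y := by
  have hd : q.degree = 0 := by
    by_contra hd
    obtain ⟨z, hz⟩ := IsAlgClosed.exists_root q hd
    exact h z hz
  rw [Polynomial.eq_C_of_degree_eq_zero hd]; simp

theorem exists_polynomial_affine_line (P : MvPolynomial σ ℂ) (a b : σ → ℂ) :
    ∃ q : Polynomial ℂ, ∀ s, q.eval s = MvPolynomial.eval (a + s • b) P := by
  refine ⟨MvPolynomial.aeval (fun i =>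
    Polynomial.C (a i) + Polynomial.X * Polynomial.C (b i)) P, fun s => ?_⟩
  have h := MvPolynomial.comp_aeval_apply (fun i =>
    Polynomial.C (a i) + Polynomial.X * Polynomial.C (b i)) (Polynomial.aeval s : _ →ₐ[ℂ] ℂ) P
  rw [Polynomial.coe_aeval_eq_eval] at h
  rw [h, MvPolynomial.aeval_eq_eval]
  congr 2
  funext i
  simp only [Polynomial.eval_add, Polynomial.eval_mul, Polynomial.eval_C, Polynomial.eval_X,
    Pi.add_apply, Pi.smul_apply, smul_eq_mul]

/-- The domain of a family over the line is Zariski dense: p times one of the space coordinates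
vanishes everywhere. -/
theorem eq_zero_of_eval_eq_zero_of_ne {r : ℕ} (hr : 0 < r) (p : MvPolynomial (Option (Fin r)) ℂ)
    (h : ∀ a : Option (Fin r) → ℂ, a ∘ some ≠ 0 → MvPolynomial.eval a p = 0) : p = 0 := by
  have h1 : MvPolynomial.X (some ⟨0, hr⟩) * p = 0 := MvPolynomial.funext fun a => by
    rw [map_mul, MvPolynomial.eval_X, map_zero]
    by_cases h0 : a ∘ some = 0
    · have : a (some ⟨0, hr⟩) = 0 := congrFun h0 ⟨0, hr⟩
      rw [this, zero_mul]
    · rw [h a h0, mul_zero]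
  exact (mul_eq_zero.mp h1).resolve_left (MvPolynomial.X_ne_zero _)

/-- A point of the affine space with coordinates indexed by `Option`, given by the coordinate at
`none` and the other coordinates. -/
def consPoint {r : ℕ} (t : ℂ) (w : Fin r → ℂ) : Option (Fin r) → ℂ := fun o => o.elim t w

theorem consPoint_none_some {r : ℕ} (a : Option (Fin r) → ℂ) : consPoint (a none) (a ∘ some) = a := by
  funext o; cases o <;> rfl

/-- A family of maps from projective space to projective space, parametrized by the affine line,
consists of linear maps if it starts with a linear map. -/
theorem IsLocallyPolynomial.exists_linearMap [FiniteDimensional ℂ F] {r : ℕ} (hr : 2 ≤ r)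
    (j : (Fin r → ℂ) →ₗ[ℂ] F) (hj : Function.Injective j)
    {f : {a : Option (Fin r) → ℂ | a ∘ some ≠ 0} → ℙ ℂ F} (hf : IsLocallyPolynomial f)
    (hscale : ∀ (t : ℂ) (w : Fin r → ℂ) (hw : w ≠ 0) (hw' : (fun i => 2 * w i) ≠ 0),
      f ⟨consPoint t fun i => 2 * w i, hw'⟩ = f ⟨consPoint t w, hw⟩)
    (hzero : ∀ (w : Fin r → ℂ) (hw : w ≠ 0), j w ∈ (f ⟨consPoint 0 w, hw⟩).submodule) (t : ℂ) :
    ∃ T : (Fin r → ℂ) →ₗ[ℂ] F, ∀ w (hw : w ≠ 0),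
      T w ≠ 0 ∧ T w ∈ (f ⟨consPoint t w, hw⟩).submodule := by
  have two_ne : ∀ w : Fin r → ℂ, w ≠ 0 → (fun i => 2 * w i) ≠ 0 := fun w hw h0 => hw <| by
    funext i
    simpa using congrFun h0 i
  let c := Module.finBasis ℂ F
  obtain ⟨G, hG, hGf⟩ := hf.exists_isCoprimeFamily c
    (fun p h => eq_zero_of_eval_eq_zero_of_ne (by omega) p h)
  -- The dilation w ↦ z w at fixed t. The points of the family do not see it for z = 2, so it
  -- changes the coprime tuple G only by a unit, that is, by a constant γ. This γ is 2 to the power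
  -- of the degree of the maps, and it is independent of t.
  let s : ℂ → MvPolynomial (Option (Fin r)) ℂ →ₐ[ℂ] MvPolynomial (Option (Fin r)) ℂ := fun z =>
    MvPolynomial.aeval fun o => o.elim (MvPolynomial.X none)
      fun i => MvPolynomial.C z * MvPolynomial.X (some i)
  have hs : ∀ z p t w, MvPolynomial.eval (consPoint t w) (s z p) =
      MvPolynomial.eval (consPoint t fun i => z * w i) p := fun z p t w => by
    simp only [s, ← MvPolynomial.coe_aeval_eq_eval, RingHom.coe_coe]
    rw [← AlgHom.comp_apply, MvPolynomial.comp_aeval]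
    congr 2
    funext o
    cases o <;> simp [consPoint]
  have hss : ∀ z y, z * y = 1 → ∀ p, s z (s y p) = p := fun z y hzy p =>
    MvPolynomial.funext fun a => by
      rw [← consPoint_none_some a, hs, hs]
      congr 3
      funext i
      rw [← mul_assoc, mul_comm y, hzy, one_mul]
  have hprop : ∀ i j, s 2 (G i) * G j = s 2 (G j) * G i := fun i j => by
    rw [← sub_eq_zero]
    refine eq_zero_of_eval_eq_zero_of_ne (by omega) _ fun a ha => ?_
    rw [map_sub, map_mul, map_mul, sub_eq_zero]
    have h1 := (hGf ⟨a, ha⟩).2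
    have h2 := (hGf ⟨consPoint (a none) fun i => 2 * (a ∘ some) i, two_ne _ ha⟩).2
    rw [hscale _ _ ha (two_ne _ ha)] at h2
    simp only [consPoint_none_some] at h2
    have h3 := repr_mul_eq_of_mem c h2 h1 i j
    simp only [c.repr_sum_self] at h3
    simpa only [← hs, consPoint_none_some] using h3
  obtain ⟨u, hu⟩ := hG.exists_eq_mul hprop
  -- The dilation is invertible, so the dilated tuple is coprime too; divisibility in both
  -- directions makes u a unit.
  obtain ⟨u', hu'⟩ := IsCoprimeFamily.exists_eq_mul (G := fun j => s 2 (G j)) (G' := G)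
    (fun q hq => by
      have h1 : IsUnit (s 2⁻¹ q) := hG _ fun j => by
        have := map_dvd (s 2⁻¹) (hq j)
        rwa [hss _ _ (by norm_num)] at this
      have := h1.map (s 2)
      rwa [hss _ _ (by norm_num)] at this)
    fun i j => by rw [mul_comm, hprop j i, mul_comm]
  have hunit : IsUnit u := by
    obtain ⟨i, hi⟩ := hG.exists_ne_zero
    refine .of_mul_eq_one u' ?_
    have := hu' i
    rw [hu i, ← mul_assoc] at this
    rw [mul_comm]
    exact mul_right_cancel₀ hi (by rw [← this, one_mul])
  obtain ⟨γ, -, rfl⟩ := MvPolynomial.isUnit_iff_eq_C_of_isReduced.mp hunit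
  let g : ℂ → (Fin r → ℂ) → F := fun t w => ∑ j, MvPolynomial.eval (consPoint t w) (G j) • c j
  have hg2 : ∀ t w, g t (fun i => 2 * w i) = γ • g t w := fun t w => by
    simp only [g, Finset.smul_sum, ← hs, hu, map_mul, MvPolynomial.eval_C, smul_smul]
  -- At t = 0 the map is the linear map j, so G(0, w) is j w times a scalar x(w) ≠ 0. It suffices
  -- that x(a) = x(2a) for a single a ≠ 0.
  have hγ : γ = 2 := by
    obtain ⟨ξ, hξ⟩ := j.exists_leftInverse_of_injective (LinearMap.ker_eq_bot.mpr hj)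
    have hsc : ∀ w, w ≠ 0 → ∃ x : ℂ, x ≠ 0 ∧ ξ (g 0 w) = x • w := fun w hw => by
      obtain ⟨h1, h2⟩ := hGf ⟨consPoint 0 w, hw⟩
      have hjw : j w ≠ 0 := by rwa [Ne, map_eq_zero_iff _ hj]
      obtain ⟨x, hx⟩ := exists_smul_of_mem (hzero w hw) hjw h2
      refine ⟨x, ?_, ?_⟩
      · rintro rfl
        rw [zero_smul] at hx
        exact h1 hx
      · change ξ (∑ j, _) = _
        rw [hx, map_smul, ← LinearMap.comp_apply, hξ, LinearMap.id_apply]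
    choose! x hx0 hx using hsc
    -- On a line a + y b with constant nonzero i-th coordinate, x is a polynomial in y without
    -- zeros, hence constant.
    have hpoly : ∀ a b : Fin r → ℂ, ∀ i, a i ≠ 0 → b i = 0 → ∀ y z : ℂ, x (a + y • b) = x (a + z • b) := by
      intro a b i hai hbi y z
      have hi : ∀ y : ℂ, (a + y • b) i = a i := fun y => by simp [hbi]
      have hne : ∀ y : ℂ, a + y • b ≠ 0 := fun y h0 => hai <| by rw [← hi y, h0]; rfl
      have h1 : ∀ l : Fin (Module.finrank ℂ F), ∃ q : Polynomial ℂ, ∀ y,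
          q.eval y = MvPolynomial.eval (consPoint 0 (a + y • b)) (G l) := fun l => by
        obtain ⟨q, hq⟩ := exists_polynomial_affine_line (G l) (consPoint 0 a) (consPoint 0 b)
        refine ⟨q, fun y => ?_⟩
        rw [hq]
        congr 2
        funext o
        cases o <;> simp [consPoint]
      choose q hq using h1
      let Q : Polynomial ℂ := ∑ l, q l * Polynomial.C (ξ (c l) i)
      have hQ : ∀ y, Q.eval y = x (a + y • b) * a i := fun y => by
        have h2 := congrFun (hx _ (hne y)) i
        rw [Pi.smul_apply, hi, smul_eq_mul] at h2
        rw [← h2]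
        simp [Q, g, Polynomial.eval_finsetSum, hq]
      have := polynomial_eval_eq_of_forall_ne_zero (q := Q)
        (fun y => by rw [hQ]; exact mul_ne_zero (hx0 _ (hne y)) hai) y z
      rw [hQ, hQ] at this
      exact mul_right_cancel₀ hai this
    let i₀ : Fin r := ⟨0, by omega⟩
    let i₁ : Fin r := ⟨1, by omega⟩
    have hi : i₁ ≠ i₀ := by simp [i₀, i₁]
    let a : Fin r → ℂ := Pi.single i₀ 1
    let b : Fin r → ℂ := Pi.single i₁ 1
    have ha0 : a i₀ = 1 := by simp [a]
    have ha1 : a i₁ = 0 := by simp [a, hi]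
    have hb0 : b i₀ = 0 := by simp [b, hi.symm]
    have hb1 : b i₁ = 1 := by simp [b]
    have hane : a ≠ 0 := fun h0 => by rw [h0] at ha0; simp at ha0
    -- The broken line a, a + b, 2a + b, 2a avoids the origin and yields x(a) = x(2a). Its two
    -- independent directions are the reason for r ≥ 2.
    have e1 := hpoly a b i₀ (by simp [ha0]) hb0 0 1
    have e2 := hpoly b a i₁ (by simp [hb1]) ha1 1 2
    have e3 := hpoly ((2 : ℂ) • a) b i₀ (by simp [ha0]) hb0 1 0
    simp only [zero_smul, add_zero, one_smul] at e1 e2 e3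
    rw [add_comm a b] at e1
    rw [add_comm _ b] at e3
    have e4 : x a = x ((2 : ℂ) • a) := e1.trans (e2.trans e3)
    have e5 := hx ((2 : ℂ) • a) (smul_ne_zero two_ne_zero hane)
    have e6 : g 0 ((2 : ℂ) • a) = γ • g 0 a := hg2 0 a
    rw [e6, map_smul, hx a hane, ← e4, smul_smul, smul_smul] at e5
    have e7 := congrFun e5 i₀
    simp only [Pi.smul_apply, ha0, smul_eq_mul, mul_one] at e7
    exact mul_right_cancel₀ (hx0 a hane) (by rw [e7, mul_comm])
  -- With t frozen the entries still scale by γ = 2, so they are linear forms in w.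
  let G' : Fin (Module.finrank ℂ F) → MvPolynomial (Fin r) ℂ := fun l =>
    MvPolynomial.aeval (fun o => o.elim (MvPolynomial.C t) MvPolynomial.X) (G l)
  have hG' : ∀ l w, MvPolynomial.eval w (G' l) = MvPolynomial.eval (consPoint t w) (G l) := by
    intro l w
    simp only [G', ← MvPolynomial.coe_aeval_eq_eval, RingHom.coe_coe]
    rw [← AlgHom.comp_apply, MvPolynomial.comp_aeval]
    congr 2
    funext o
    cases o <;> simp [consPoint]
  have hlin : ∀ l, ∃ m : (Fin r → ℂ) →ₗ[ℂ] ℂ, ∀ w, m w = MvPolynomial.eval w (G' l) := fun l => by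
    refine exists_linearMap_of_isHomogeneous_one (isHomogeneous_one_of_eval_two_mul fun w => ?_)
    rw [hG', hG', ← hs, hu, map_mul, MvPolynomial.eval_C, hγ]
  choose m hm using hlin
  refine ⟨∑ l, (m l).smulRight (c l), fun w hw => ?_⟩
  have : (∑ l, (m l).smulRight (c l)) w = g t w := by
    simp [g, hm, hG']
  rw [this]
  exact hGf ⟨consPoint t w, hw⟩

end LocallyPolynomial

/-! ### The variety of pure tensors v ⊗ b with β b ∈ ⟨v⟩, and its projection to [v] -/

section RankOne

variable {E F L N : Type*} [AddCommGroup E] [Module ℂ E] [AddCommGroup F] [Module ℂ F]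
  [AddCommGroup L] [Module ℂ L] [AddCommGroup N] [Module ℂ N]

theorem Isomorphic.symm {A : Set (ℙ ℂ E)} {B : Set (ℙ ℂ F)} (h : Isomorphic A B) :
    Isomorphic B A := by
  obtain ⟨e, he⟩ := h
  exact ⟨e.symm, he.symm⟩

theorem isomorphic_univ_of_injective (G : F →ₗ[ℂ] E) (hG : Function.Injective G) {A : Set (ℙ ℂ E)}
    (hA : ∀ p, p ∈ A ↔ ∃ t, t ≠ 0 ∧ G t ∈ p.submodule) :
    Isomorphic A (Set.univ : Set (ℙ ℂ F)) := by
  have hne : ∀ {t}, t ≠ 0 → G t ≠ 0 := fun ht => by rwa [Ne, map_eq_zero_iff _ hG]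
  obtain ⟨G', hG'⟩ := G.exists_leftInverse_of_injective (LinearMap.ker_eq_bot.mpr hG)
  replace hG' : ∀ t, G' (G t) = t := fun t => LinearMap.congr_fun hG' t
  let f : ↥(Set.univ : Set (ℙ ℂ F)) → A := fun x =>
    ⟨Projectivization.mk ℂ (G (x : ℙ ℂ F).rep) (hne (Projectivization.rep_nonzero _)),
      (hA _).mpr ⟨_, Projectivization.rep_nonzero _, mem_mk _⟩⟩
  have hf : ∀ (x : (Set.univ : Set (ℙ ℂ F))), ∀ t ∈ (x : ℙ ℂ F).submodule,
      G t ∈ (f x : ℙ ℂ E).submodule := fun x t ht => by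
    obtain ⟨c, rfl⟩ := exists_smul_of_mem (rep_mem (x : ℙ ℂ F)) (Projectivization.rep_nonzero _) ht
    rw [map_smul]
    exact Submodule.smul_mem _ _ (mem_mk _)
  have hf' : ∀ (x : (Set.univ : Set (ℙ ℂ F))), ∀ v ∈ (f x : ℙ ℂ E).submodule, v ≠ 0 →
      G' v ≠ 0 ∧ G' v ∈ (x : ℙ ℂ F).submodule := fun x v hv h0 => by
    obtain ⟨c, rfl⟩ := exists_smul_of_mem (hf x _ (rep_mem _))
      (hne (Projectivization.rep_nonzero _)) hv
    rw [map_smul, hG']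
    exact ⟨smul_ne_zero (left_ne_zero_of_smul h0) (Projectivization.rep_nonzero _),
      Submodule.smul_mem _ _ (rep_mem _)⟩
  have hbij : Function.Bijective f := by
    constructor
    · intro x y hxy
      have h1 := hf' x _ (rep_mem _) (Projectivization.rep_nonzero _)
      have h2 := hf' y (f x : ℙ ℂ E).rep (by rw [← hxy]; exact rep_mem _)
        (Projectivization.rep_nonzero _)
      exact Subtype.ext (eq_of_mem h1.2 h2.2 h1.1)
    · rintro ⟨p, hp⟩
      obtain ⟨t, h0, ht⟩ := (hA p).mp hp
      exact ⟨⟨Projectivization.mk ℂ t h0, trivial⟩,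
        Subtype.ext (eq_of_mem (hf _ t (mem_mk h0)) ht (hne h0))⟩
  refine Isomorphic.symm ⟨Equiv.ofBijective f hbij, IsRegularMap.of_linearMap G fun x v hv h0 =>
    ⟨hne h0, hf x v hv⟩, IsRegularMap.of_linearMap G' fun p v hv h0 => hf' _ v ?_ h0⟩
  have : f ((Equiv.ofBijective f hbij).symm p) = p :=
    Equiv.apply_symm_apply (Equiv.ofBijective f hbij) p
  rwa [this]

/-- The contraction `v ⊗ b ↦ l v • b`. -/
noncomputable def contractFst (l : Module.Dual ℂ L) : L ⊗[ℂ] N →ₗ[ℂ] N :=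
  TensorProduct.lift ((LinearMap.lsmul ℂ N : ℂ →ₗ[ℂ] N →ₗ[ℂ] N) ∘ₗ l)

/-- The contraction `v ⊗ b ↦ μ b • v`. -/
noncomputable def contractSnd (μ : Module.Dual ℂ N) : L ⊗[ℂ] N →ₗ[ℂ] L :=
  TensorProduct.lift ((LinearMap.lsmul ℂ L : ℂ →ₗ[ℂ] L →ₗ[ℂ] L) ∘ₗ μ).flip

@[simp] theorem contractFst_tmul (l : Module.Dual ℂ L) (v : L) (b : N) :
    contractFst l (v ⊗ₜ[ℂ] b) = l v • b := rfl

@[simp] theorem contractSnd_tmul (μ : Module.Dual ℂ N) (v : L) (b : N) :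
    contractSnd μ (v ⊗ₜ[ℂ] b) = μ b • v := rfl

theorem exists_dual_ne_zero {b : N} (hb : b ≠ 0) : ∃ μ : Module.Dual ℂ N, μ b ≠ 0 := by
  by_contra! h
  exact hb ((Module.forall_dual_apply_eq_zero_iff ℂ b).mp h)

theorem tmul_ne_zero_of_ne {v : L} {b : N} (hv : v ≠ 0) (hb : b ≠ 0) : v ⊗ₜ[ℂ] b ≠ 0 := by
  obtain ⟨l, hl⟩ := exists_dual_ne_zero hv
  exact fun h0 => smul_ne_zero hl hb (by rw [← contractFst_tmul, h0, map_zero])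

theorem isSegre_iff {a : ℙ ℂ E} {b : ℙ ℂ F} {v : E} {w : F} (hv : v ∈ a.submodule) (hv0 : v ≠ 0)
    (hw : w ∈ b.submodule) (hw0 : w ≠ 0) {q : ℙ ℂ (E ⊗[ℂ] F)} :
    IsSegre a b q ↔ v ⊗ₜ w ∈ q.submodule := by
  have hvw : v ⊗ₜ[ℂ] w ≠ 0 := tmul_ne_zero_of_ne hv0 hw0
  rw [IsSegre, submodule_eq_span hv hv0, submodule_eq_span hw hw0, Submodule.map₂_span_span,
    Set.image2_singleton]
  constructor
  · intro h
    rw [h]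
    exact Submodule.mem_span_singleton_self _
  · intro h
    exact submodule_eq_span h hvw

/-- The points `[Θ (v ⊗ b)]` where `β b` is a multiple of `v`. -/
def rankOneLocus (Θ : L ⊗[ℂ] N →ₗ[ℂ] E) (β : N →ₗ[ℂ] L) : Set (ℙ ℂ E) :=
  {q | ∃ (v : L) (b : N), v ≠ 0 ∧ b ≠ 0 ∧ β b ∈ Submodule.span ℂ {v} ∧ Θ (v ⊗ₜ b) ∈ q.submodule}

/-- The projection `[Θ (v ⊗ b)] ↦ [v]`. -/
noncomputable def rankOneProj (Θ : L ⊗[ℂ] N →ₗ[ℂ] E) (β : N →ₗ[ℂ] L) (q : rankOneLocus Θ β) :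
    ℙ ℂ L :=
  Projectivization.mk ℂ q.2.choose q.2.choose_spec.choose_spec.1

variable {Θ : L ⊗[ℂ] N →ₗ[ℂ] E} {β : N →ₗ[ℂ] L}

theorem apply_tmul_ne_zero (hΘ : Function.Injective Θ) {v : L} {b : N} (hv : v ≠ 0) (hb : b ≠ 0) :
    Θ (v ⊗ₜ b) ≠ 0 := by
  rw [Ne, map_eq_zero_iff _ hΘ]
  exact tmul_ne_zero_of_ne hv hb

theorem mem_rankOneProj (hΘ : Function.Injective Θ) {q : rankOneLocus Θ β} {v : L} {b : N}
    (hb : b ≠ 0) (h : Θ (v ⊗ₜ b) ∈ (q : ℙ ℂ E).submodule) :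
    v ∈ (rankOneProj Θ β q).submodule := by
  obtain ⟨hv', hb', -, h'⟩ := q.2.choose_spec.choose_spec
  obtain ⟨c, hc⟩ := exists_smul_of_mem h' (apply_tmul_ne_zero hΘ hv' hb') h
  rw [← map_smul] at hc
  obtain ⟨μ, hμ⟩ := exists_dual_ne_zero hb
  have h2 := congrArg (contractSnd μ) (hΘ hc)
  rw [map_smul, contractSnd_tmul, contractSnd_tmul] at h2
  rw [← Submodule.smul_mem_iff _ hμ, h2]
  exact Submodule.smul_mem _ _ (Submodule.smul_mem _ _ (mem_mk _))

theorem exists_mem_rankOneLocus (q : rankOneLocus Θ β) (hΘ : Function.Injective Θ) :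
    ∃ (v : L) (b : N), v ≠ 0 ∧ b ≠ 0 ∧ β b ∈ Submodule.span ℂ {v} ∧
      Θ (v ⊗ₜ b) ∈ (q : ℙ ℂ E).submodule ∧ v ∈ (rankOneProj Θ β q).submodule := by
  obtain ⟨v, b, hv, hb, h1, h2⟩ := q.2
  exact ⟨v, b, hv, hb, h1, h2, mem_rankOneProj hΘ hb h2⟩

/-- Contracting v ⊗ b with a functional μ gives μ(b) v, a linear formula for the projection wherever
μ(b) ≠ 0. -/
theorem isRegularMap_rankOneProj (hΘ : Function.Injective Θ) : IsRegularMap (rankOneProj Θ β) := by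
  obtain ⟨Ψ, hΨ⟩ := Θ.exists_leftInverse_of_injective (LinearMap.ker_eq_bot.mpr hΘ)
  replace hΨ : ∀ t, Ψ (Θ t) = t := fun t => LinearMap.congr_fun hΨ t
  intro q
  obtain ⟨v, b, hv, hb, -, h2, -⟩ := exists_mem_rankOneLocus q hΘ
  obtain ⟨μ, hμ⟩ := exists_dual_ne_zero hb
  obtain ⟨l, hl⟩ := exists_dual_ne_zero hv
  refine ⟨{p | ¬ p.submodule ≤ LinearMap.ker (l ∘ₗ contractSnd μ ∘ₗ Ψ)}, isOpen_linear_ne _,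
    fun h => ?_, 1, contractSnd μ ∘ₗ Ψ, IsHomogeneousPolyMap.of_linearMap _, fun p hp w hw h0 => ?_⟩
  · have := h h2
    rw [LinearMap.mem_ker, LinearMap.comp_apply, LinearMap.comp_apply, hΨ, contractSnd_tmul,
      map_smul, smul_eq_mul] at this
    exact mul_ne_zero hμ hl this
  · constructor
    · intro h1
      apply hp
      rw [submodule_eq_span hw h0, Submodule.span_singleton_le_iff_mem, LinearMap.mem_ker,
        LinearMap.comp_apply, h1, map_zero]
    · obtain ⟨v', b', hv', hb', -, h2', h3'⟩ := exists_mem_rankOneLocus p hΘ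
      obtain ⟨c, rfl⟩ := exists_smul_of_mem h2' (apply_tmul_ne_zero hΘ hv' hb') hw
      rw [map_smul, LinearMap.comp_apply, hΨ, contractSnd_tmul]
      exact Submodule.smul_mem _ _ (Submodule.smul_mem _ _ h3')

/-- A vector b killed by β may be paired with every v. -/
theorem rankOneProj_surjective (hΘ : Function.Injective Θ) (hβ : LinearMap.ker β ≠ ⊥) :
    Function.Surjective (rankOneProj Θ β) := by
  intro p
  obtain ⟨b, hb, hb0⟩ := (Submodule.ne_bot_iff _).mp hβ
  have h0 := apply_tmul_ne_zero hΘ p.rep_nonzero hb0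
  refine ⟨⟨Projectivization.mk ℂ _ h0, p.rep, b, p.rep_nonzero, hb0, ?_, mem_mk h0⟩, ?_⟩
  · rw [LinearMap.mem_ker.mp hb]
    exact Submodule.zero_mem _
  · exact eq_of_mem (mem_rankOneProj hΘ hb0 (mem_mk h0)) (rep_mem p) p.rep_nonzero

/-- For fixed v spanning p, the map b ↦ Θ(v ⊗ b) is a linear embedding of β⁻¹(p), and its
projectivization is the fibre. -/
theorem isomorphic_preim_rankOneProj [FiniteDimensional ℂ N] (hΘ : Function.Injective Θ) {p : ℙ ℂ L}
    {r : ℕ} (hr : Module.finrank ℂ (p.submodule.comap β) = r + 1) :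
    Isomorphic (preim (rankOneProj Θ β) {p}) (Set.univ : Set (PSpace r)) := by
  obtain ⟨ε⟩ : Nonempty ((Fin (r + 1) → ℂ) ≃ₗ[ℂ] p.submodule.comap β) :=
    ⟨LinearEquiv.ofFinrankEq _ _ (by rw [hr]; simp)⟩
  refine isomorphic_univ_of_injective
    (Θ ∘ₗ TensorProduct.mk ℂ L N p.rep ∘ₗ Submodule.subtype _ ∘ₗ ε.toLinearMap) ?_ fun q => ?_
  · rw [injective_iff_map_eq_zero]
    intro t ht
    by_contra h0
    refine apply_tmul_ne_zero hΘ p.rep_nonzero (b := (ε t : N)) ?_ ht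
    simpa using h0
  · constructor
    · rintro ⟨hq, hqp⟩
      obtain ⟨v, b, hv, hb, h1, h2, h3⟩ := exists_mem_rankOneLocus ⟨q, hq⟩ hΘ
      rw [Set.mem_singleton_iff.mp hqp] at h3
      rw [← submodule_eq_span h3 hv] at h1
      obtain ⟨c, hc⟩ := exists_smul_of_mem h3 hv (rep_mem p)
      refine ⟨ε.symm ⟨b, h1⟩, fun h0 => hb ?_, ?_⟩
      · exact congrArg Subtype.val ((map_eq_zero_iff _ ε.symm.injective).mp h0)
      · simp only [LinearMap.comp_apply, LinearEquiv.coe_coe, LinearEquiv.apply_symm_apply,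
          Submodule.subtype_apply, TensorProduct.mk_apply]
        rw [hc, ← TensorProduct.smul_tmul', map_smul]
        exact Submodule.smul_mem _ _ h2
    · rintro ⟨t, h0, ht⟩
      have hb : (ε t : N) ≠ 0 := by simpa using h0
      have hq : q ∈ rankOneLocus Θ β := ⟨p.rep, ε t, p.rep_nonzero, hb,
        by rw [← Projectivization.submodule_eq]; exact (ε t).2, ht⟩
      exact ⟨hq, eq_of_mem (mem_rankOneProj hΘ hb ht) (rep_mem p) p.rep_nonzero⟩

/-- A chart of the projective bundle `[Θ (v ⊗ b)] ↦ [v]` over the open set where `l` does not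
vanish. -/
theorem exists_chart_rankOneProj [FiniteDimensional ℂ L] [FiniteDimensional ℂ F]
    (hΘ : Function.Injective Θ)
    (l : Module.Dual ℂ L) (J : N →ₗ[ℂ] F) (ρ : L →ₗ[ℂ] F →ₗ[ℂ] N)
    (hβρ : ∀ v t, β (ρ v t) ∈ Submodule.span ℂ {v}) (hJρ : ∀ v t, J (ρ v t) = l v • t)
    (hρJ : ∀ v b, β b ∈ Submodule.span ℂ {v} → ρ v (J b) = l v • b) :
    ∃ e : preim (rankOneProj Θ β) {p | ¬ p.submodule ≤ LinearMap.ker l} ≃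
        segreProd {p | ¬ p.submodule ≤ LinearMap.ker l} (Set.univ : Set (ℙ ℂ F)),
      IsBiregular e ∧ ∀ (a : rankOneLocus Θ β)
        (ha : (a : ℙ ℂ E) ∈ preim (rankOneProj Θ β) {p | ¬ p.submodule ≤ LinearMap.ker l}),
        ∃ t : ℙ ℂ F, IsSegre (rankOneProj Θ β a) t (e ⟨a, ha⟩) := by
  obtain ⟨Ψ, hΨ⟩ := Θ.exists_leftInverse_of_injective (LinearMap.ker_eq_bot.mpr hΘ)
  replace hΨ : ∀ t, Ψ (Θ t) = t := fun t => LinearMap.congr_fun hΨ t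
  set U : Set (ℙ ℂ L) := {p | ¬ p.submodule ≤ LinearMap.ker l} with hU
  have hUl : ∀ {p : ℙ ℂ L} {v}, v ∈ p.submodule → v ≠ 0 → (p ∈ U ↔ l v ≠ 0) := fun {p v} hv h0 => by
    rw [hU, Set.mem_ofPred_eq, submodule_eq_span hv h0, Submodule.span_singleton_le_iff_mem]
    rfl
  have hdata : ∀ q : preim (rankOneProj Θ β) U, ∃ (v : L) (b : N), v ≠ 0 ∧ b ≠ 0 ∧ l v ≠ 0 ∧
      β b ∈ Submodule.span ℂ {v} ∧ Θ (v ⊗ₜ b) ∈ (q : ℙ ℂ E).submodule ∧ J b ≠ 0 ∧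
      v ∈ (rankOneProj Θ β ⟨q, q.2.choose⟩).submodule := fun q => by
    obtain ⟨v, b, hv, hb, h1, h2, h3⟩ := exists_mem_rankOneLocus ⟨q, q.2.choose⟩ hΘ
    have hl := (hUl h3 hv).mp q.2.choose_spec
    refine ⟨v, b, hv, hb, hl, h1, h2, fun h0 => ?_, h3⟩
    have := hρJ v b h1
    rw [h0, map_zero] at this
    exact smul_ne_zero hl hb this.symm
  let M : E →ₗ[ℂ] L ⊗[ℂ] F := J.lTensor L ∘ₗ Ψ
  have hM : ∀ v b, M (Θ (v ⊗ₜ b)) = v ⊗ₜ J b := fun v b => by simp [M, hΨ]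
  have hM0 : ∀ q : preim (rankOneProj Θ β) U, ∀ w ∈ (q : ℙ ℂ E).submodule, w ≠ 0 → M w ≠ 0 := by
    intro q w hw h0
    obtain ⟨v, b, hv, hb, hl, h1, h2, h3, -⟩ := hdata q
    obtain ⟨c, rfl⟩ := exists_smul_of_mem h2 (apply_tmul_ne_zero hΘ hv hb) hw
    rw [map_smul, hM]
    exact smul_ne_zero (left_ne_zero_of_smul h0) (tmul_ne_zero_of_ne hv h3)
  -- The inverse chart (v, t) ↦ v ⊗ ρ(v, t) is quadratic in v. Multiplied by μ(t) it becomes a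
  -- quadratic map in the Segre vector v ⊗ t, valid where μ(t) ≠ 0.
  let B : Module.Dual ℂ F → (L ⊗[ℂ] F →ₗ[ℂ] L ⊗[ℂ] F →ₗ[ℂ] E) := fun μ =>
    ((TensorProduct.mk ℂ L N).compl₁₂ (contractSnd μ) (TensorProduct.lift ρ)).compr₂ Θ
  have hB : ∀ μ v t, B μ (v ⊗ₜ t) (v ⊗ₜ t) = μ t • Θ (v ⊗ₜ ρ v t) := fun μ v t => by
    simp [B]
  let f : preim (rankOneProj Θ β) U → segreProd U (Set.univ : Set (ℙ ℂ F)) := fun q =>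
    ⟨Projectivization.mk ℂ (M (q : ℙ ℂ E).rep) (hM0 q _ (rep_mem _) (Projectivization.rep_nonzero _)),
      by
        obtain ⟨v, b, hv, hb, hl, h1, h2, h3, h4⟩ := hdata q
        refine ⟨_, q.2.choose_spec, Projectivization.mk ℂ _ h3, trivial, ?_⟩
        rw [isSegre_iff h4 hv (mem_mk h3) h3, ← hM]
        obtain ⟨c, hc⟩ := exists_smul_of_mem (rep_mem (q : ℙ ℂ E)) (Projectivization.rep_nonzero _) h2
        rw [hc, map_smul]
        exact Submodule.smul_mem _ _ (mem_mk _)⟩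
  have hf : ∀ q : preim (rankOneProj Θ β) U, ∀ w ∈ (q : ℙ ℂ E).submodule, M w ∈ (f q : ℙ ℂ (L ⊗[ℂ] F)).submodule := by
    intro q w hw
    obtain ⟨c, rfl⟩ := exists_smul_of_mem (rep_mem (q : ℙ ℂ E)) (Projectivization.rep_nonzero _) hw
    rw [map_smul]
    exact Submodule.smul_mem _ _ (mem_mk _)
  have hfs : ∀ v t, v ≠ 0 → t ≠ 0 → l v ≠ 0 → ∀ τ : segreProd U (Set.univ : Set (ℙ ℂ F)),
      v ⊗ₜ t ∈ (τ : ℙ ℂ (L ⊗[ℂ] F)).submodule →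
      ∃ q, f q = τ ∧ Θ (v ⊗ₜ ρ v t) ∈ (q : ℙ ℂ E).submodule ∧ Θ (v ⊗ₜ ρ v t) ≠ 0 := by
    intro v t hv ht hl τ hτ
    have hρ : ρ v t ≠ 0 := fun h0 => by
      have := hJρ v t
      rw [h0, map_zero] at this
      exact smul_ne_zero hl ht this.symm
    have h0 := apply_tmul_ne_zero hΘ hv hρ
    have hq : Projectivization.mk ℂ _ h0 ∈ rankOneLocus Θ β :=
      ⟨v, ρ v t, hv, hρ, hβρ v t, mem_mk h0⟩
    have hq' : Projectivization.mk ℂ _ h0 ∈ preim (rankOneProj Θ β) U :=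
      ⟨hq, (hUl (mem_rankOneProj hΘ hρ (mem_mk h0)) hv).mpr hl⟩
    refine ⟨⟨_, hq'⟩, Subtype.ext (eq_of_mem (hf _ _ (mem_mk h0)) ?_ (hM0 ⟨_, hq'⟩ _ (mem_mk h0) h0)),
      mem_mk h0, h0⟩
    rw [hM, hJρ, TensorProduct.tmul_smul]
    exact Submodule.smul_mem _ _ hτ
  have hsegre : ∀ τ : segreProd U (Set.univ : Set (ℙ ℂ F)), ∃ v t, v ≠ 0 ∧ t ≠ 0 ∧ l v ≠ 0 ∧
      v ⊗ₜ t ∈ (τ : ℙ ℂ (L ⊗[ℂ] F)).submodule := by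
    rintro ⟨τ, a, ha, b, -, hτ⟩
    exact ⟨a.rep, b.rep, a.rep_nonzero, b.rep_nonzero, (hUl (rep_mem a) a.rep_nonzero).mp ha,
      (isSegre_iff (rep_mem a) a.rep_nonzero (rep_mem b) b.rep_nonzero).mp hτ⟩
  have hbij : Function.Bijective f := by
    constructor
    · intro q q' hqq
      obtain ⟨v, b, hv, hb, hl, h1, h2, h3, -⟩ := hdata q
      obtain ⟨v', b', hv', hb', hl', h1', h2', h3', -⟩ := hdata q'
      have h4 := hf q _ h2
      have h4' := hf q' _ h2'
      rw [← hqq, hM] at h4'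
      rw [hM] at h4
      obtain ⟨c, hc⟩ := exists_smul_of_mem h4' (tmul_ne_zero_of_ne hv' h3') h4
      obtain ⟨μ, hμ⟩ := exists_dual_ne_zero h3
      have h5 : B μ (v ⊗ₜ J b) (v ⊗ₜ J b) = B μ (c • v' ⊗ₜ J b') (c • v' ⊗ₜ J b') := by rw [hc]
      simp only [map_smul, LinearMap.smul_apply] at h5
      rw [hB, hB, hρJ v b h1, hρJ v' b' h1', TensorProduct.tmul_smul, TensorProduct.tmul_smul,
        map_smul, map_smul] at h5
      have h6 : μ (J b) • l v • Θ (v ⊗ₜ b) ∈ (q : ℙ ℂ E).submodule :=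
        Submodule.smul_mem _ _ (Submodule.smul_mem _ _ h2)
      have h7 : μ (J b) • l v • Θ (v ⊗ₜ b) ∈ (q' : ℙ ℂ E).submodule := by
        rw [h5]
        exact Submodule.smul_mem _ _ (Submodule.smul_mem _ _ (Submodule.smul_mem _ _
          (Submodule.smul_mem _ _ h2')))
      exact Subtype.ext (eq_of_mem h6 h7 (smul_ne_zero hμ (smul_ne_zero hl
        (apply_tmul_ne_zero hΘ hv hb))))
    · intro τ
      obtain ⟨v, t, hv, ht, hl, hτ⟩ := hsegre τ
      obtain ⟨q, hq, -⟩ := hfs v t hv ht hl τ hτ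
      exact ⟨q, hq⟩
  refine ⟨Equiv.ofBijective f hbij, ⟨IsRegularMap.of_linearMap M fun q w hw h0 =>
    ⟨hM0 q w hw h0, hf q w hw⟩, fun τ => ?_⟩, fun a ha => ?_⟩
  · obtain ⟨v, t, hv, ht, hl, hτ⟩ := hsegre τ
    obtain ⟨μ, hμ⟩ := exists_dual_ne_zero ht
    refine ⟨{p | ¬ p.submodule ≤ LinearMap.ker (l ∘ₗ contractSnd μ)}, isOpen_linear_ne _,
      fun h => ?_, 2, fun w => B μ w w, IsHomogeneousPolyMap.of_bilinear _, fun τ' hτ' w hw h0 => ?_⟩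
    · have := h hτ
      rw [LinearMap.mem_ker, LinearMap.comp_apply, contractSnd_tmul, map_smul, smul_eq_mul] at this
      exact mul_ne_zero hμ hl this
    · obtain ⟨v', t', hv', ht', hl', h2⟩ := hsegre τ'
      obtain ⟨q, hq, hq1, hq2⟩ := hfs v' t' hv' ht' hl' τ' h2
      have hq3 : (Equiv.ofBijective f hbij).symm τ' = q := by
        rw [Equiv.symm_apply_eq]; exact hq.symm
      obtain ⟨c, rfl⟩ := exists_smul_of_mem h2 (tmul_ne_zero_of_ne hv' ht') hw
      have hc := left_ne_zero_of_smul h0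
      have hμ' : μ t' ≠ 0 := fun h3 => hτ' <| by
        rw [submodule_eq_span h2 (tmul_ne_zero_of_ne hv' ht'),
          Submodule.span_singleton_le_iff_mem, LinearMap.mem_ker, LinearMap.comp_apply,
          contractSnd_tmul, h3, zero_smul, map_zero]
      simp only [map_smul, LinearMap.smul_apply, hB, hq3]
      exact ⟨smul_ne_zero hc (smul_ne_zero hc (smul_ne_zero hμ' hq2)),
        Submodule.smul_mem _ _ (Submodule.smul_mem _ _ (Submodule.smul_mem _ _ hq1))⟩
  · obtain ⟨v, b, hv, hb, hl, h1, h2, h3, h4⟩ := hdata ⟨a, ha⟩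
    refine ⟨Projectivization.mk ℂ _ h3, ?_⟩
    rw [isSegre_iff h4 hv (mem_mk h3) h3, ← hM]
    exact hf ⟨a, ha⟩ _ h2

/-- With a linear section s of β, the space β⁻¹⟨v⟩ is ker β ⊕ ⟨s v⟩. Over l ≠ 0 it is identified
with ker β × ℂ by (κ, c) ↦ l(v) κ + c s(v), with inverse b ↦ (b - s β b, l(β b)) up to the factor
l(v). -/
theorem isProjectiveBundle_rankOneProj [FiniteDimensional ℂ L] [FiniteDimensional ℂ N]
    (hΘ : Function.Injective Θ) (hβ : Function.Surjective β) {r : ℕ}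
    (hr : Module.finrank ℂ (LinearMap.ker β) = r) : IsProjectiveBundle r (rankOneProj Θ β) := by
  refine ⟨isRegularMap_rankOneProj hΘ, fun p => ?_⟩
  obtain ⟨l, hl⟩ := exists_dual_ne_zero p.rep_nonzero
  refine ⟨{p | ¬ p.submodule ≤ LinearMap.ker l}, isOpen_linear_ne l, fun h => hl (h (rep_mem p)), ?_⟩
  obtain ⟨s, hs⟩ := β.exists_rightInverse_of_surjective (LinearMap.range_eq_top.mpr hβ)
  replace hs : ∀ v, β (s v) = v := fun v => LinearMap.congr_fun hs v
  obtain ⟨ε⟩ : Nonempty ((LinearMap.ker β × ℂ) ≃ₗ[ℂ] (Fin (r + 1) → ℂ)) :=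
    ⟨LinearEquiv.ofFinrankEq _ _ (by simp [hr])⟩
  let κ : N →ₗ[ℂ] LinearMap.ker β :=
    (LinearMap.id - s ∘ₗ β).codRestrict (LinearMap.ker β) fun b => by simp [hs]
  have hκ : ∀ b, (κ b : N) = b - s (β b) := fun b => rfl
  let ρ₀ : L →ₗ[ℂ] (LinearMap.ker β × ℂ) →ₗ[ℂ] N :=
    LinearMap.mk₂ ℂ (fun v x => l v • (x.1 : N) + x.2 • s v)
      (fun v v' x => by simp only [map_add, add_smul, smul_add]; abel)
      (fun c v x => by simp only [map_smul, smul_add, smul_smul, smul_eq_mul, mul_comm c])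
      (fun v x x' => by
        simp only [Prod.fst_add, Prod.snd_add, Submodule.coe_add, smul_add, add_smul]; abel)
      (fun c v x => by
        simp only [Prod.smul_fst, Prod.smul_snd, Submodule.coe_smul, smul_add, smul_smul, smul_eq_mul,
          mul_comm c])
  have hρ₀ : ∀ v x, ρ₀ v x = l v • (x.1 : N) + x.2 • s v := fun v x => rfl
  have hβρ₀ : ∀ v x, β (ρ₀ v x) = x.2 • v := fun v x => by
    rw [hρ₀, map_add, map_smul, map_smul, hs, LinearMap.mem_ker.mp x.1.2, smul_zero, zero_add]
  refine exists_chart_rankOneProj hΘ l (ε.toLinearMap ∘ₗ κ.prod (l ∘ₗ β))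
    (ρ₀.compl₂ ε.symm.toLinearMap) (fun v t => ?_) (fun v t => ?_) (fun v b hb => ?_)
  · rw [LinearMap.compl₂_apply, hβρ₀]
    exact Submodule.smul_mem _ _ (Submodule.mem_span_singleton_self _)
  · have : (κ.prod (l ∘ₗ β)) (ρ₀ v (ε.symm t)) = l v • ε.symm t := by
      refine Prod.ext (Subtype.ext ?_) ?_
      · change ((κ (ρ₀ v (ε.symm t)) : LinearMap.ker β) : N) = _
        rw [hκ, hβρ₀, hρ₀, map_smul, add_sub_cancel_right]
        rfl
      · change l (β (ρ₀ v (ε.symm t))) = _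
        rw [hβρ₀, map_smul, smul_eq_mul,
          mul_comm]
        rfl
    rw [LinearMap.compl₂_apply, LinearMap.comp_apply, LinearEquiv.coe_coe, LinearEquiv.coe_coe, this,
      map_smul, LinearEquiv.apply_symm_apply]
  · obtain ⟨c, hc⟩ := Submodule.mem_span_singleton.mp hb
    rw [LinearMap.compl₂_apply, LinearMap.comp_apply, LinearEquiv.coe_coe, LinearEquiv.coe_coe,
      LinearEquiv.symm_apply_apply, hρ₀]
    change l v • (b - s (β b)) + l (β b) • s v = _
    rw [← hc, map_smul, map_smul, smul_sub, smul_eq_mul, smul_smul, mul_comm c, sub_add_cancel]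

end RankOne

/-! ### Bounding the Krull dimension by the number of parameters of a chart -/

section Dimension

variable {E F : Type*} [AddCommGroup E] [Module ℂ E] [AddCommGroup F] [Module ℂ F] {σ : Type*}

theorem IsPolynomialMap.const_add_linear [Finite σ] (c : F) (G : (σ → ℂ) →ₗ[ℂ] F) :
    IsPolynomialMap (fun a => c + G a) := fun ψ => by
  classical
  have := Fintype.ofFinite σ
  refine ⟨MvPolynomial.C (ψ c) + ∑ i, MvPolynomial.C (ψ (G (Pi.single i 1))) * MvPolynomial.X i,
    fun a => ?_⟩
  simp only [map_add, MvPolynomial.eval_C, map_sum, map_mul, MvPolynomial.eval_X]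
  congr 1
  have h := LinearMap.pi_apply_eq_sum_univ (ψ ∘ₗ G) a
  simp only [LinearMap.comp_apply, smul_eq_mul] at h
  rw [h]
  refine Finset.sum_congr rfl fun i _ => ?_
  rw [mul_comm]
  congr 3
  funext j
  simp [Pi.single_apply, eq_comm]

theorem IsPolynomialMap.add {H₁ H₂ : (σ → ℂ) → F} (h₁ : IsPolynomialMap H₁)
    (h₂ : IsPolynomialMap H₂) : IsPolynomialMap (fun a => H₁ a + H₂ a) := fun ψ => by
  obtain ⟨P, hP⟩ := h₁ ψ
  obtain ⟨Q, hQ⟩ := h₂ ψ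
  exact ⟨P + Q, fun a => by rw [map_add, hP, hQ, map_add]⟩

theorem IsPolynomialMap.bilinear {E₁ E₂ : Type*} [AddCommGroup E₁] [Module ℂ E₁] [AddCommGroup E₂]
    [Module ℂ E₂] [FiniteDimensional ℂ E₁] [FiniteDimensional ℂ E₂] (B : E₁ →ₗ[ℂ] E₂ →ₗ[ℂ] F)
    {H₁ : (σ → ℂ) → E₁} {H₂ : (σ → ℂ) → E₂} (h₁ : IsPolynomialMap H₁)
    (h₂ : IsPolynomialMap H₂) : IsPolynomialMap (fun a => B (H₁ a) (H₂ a)) := fun ψ => by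
  let b := Module.finBasis ℂ E₁
  let c := Module.finBasis ℂ E₂
  choose P hP using fun i => h₁ (b.coord i)
  choose Q hQ using fun i => h₂ (c.coord i)
  refine ⟨∑ i, ∑ j, MvPolynomial.C (ψ (B (b i) (c j))) * (P i * Q j), fun a => ?_⟩
  simp only [map_sum, map_mul, MvPolynomial.eval_C, ← hP, ← hQ, Module.Basis.coord_apply]
  conv_lhs => rw [← b.sum_repr (H₁ a), ← c.sum_repr (H₂ a)]
  simp only [map_sum, map_smul, LinearMap.sum_apply, LinearMap.smul_apply, smul_eq_mul]
  rw [Finset.sum_comm]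
  simp only [Finset.mul_sum]
  refine Finset.sum_congr rfl fun i _ => Finset.sum_congr rfl fun j _ => ?_
  ring

/-- The homogenization of a polynomial in the quotients `ν i / δ` of linear forms. -/
theorem exists_homogenization (f : MvPolynomial σ ℂ) (ν : σ → Module.Dual ℂ E)
    (δ : Module.Dual ℂ E) : ∃ (d : ℕ) (Q : MvPolynomial (Module.Dual ℂ E) ℂ), Q.IsHomogeneous d ∧
      ∀ v, δ v ≠ 0 → formEval Q v = δ v ^ d * MvPolynomial.eval (fun i => (δ v)⁻¹ * ν i v) f := by
  refine ⟨f.totalDegree, ∑ d ∈ Finset.range (f.totalDegree + 1),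
    MvPolynomial.X δ ^ (f.totalDegree - d) *
      MvPolynomial.rename ν (MvPolynomial.homogeneousComponent d f),
    MvPolynomial.IsHomogeneous.sum _ _ _ fun d hd => ?_, fun v hv => ?_⟩
  · have h1 := (MvPolynomial.isHomogeneous_X_pow (R := ℂ) δ (f.totalDegree - d)).mul
      ((MvPolynomial.homogeneousComponent_isHomogeneous d f).rename_isHomogeneous (f := ν))
    rwa [Nat.sub_add_cancel (Nat.lt_succ_iff.mp (Finset.mem_range.mp hd))] at h1
  · have h : MvPolynomial.eval (fun i => (δ v)⁻¹ * ν i v) f = ∑ d ∈ Finset.range (f.totalDegree + 1),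
        MvPolynomial.eval (fun i => (δ v)⁻¹ * ν i v) (MvPolynomial.homogeneousComponent d f) := by
      rw [← map_sum, MvPolynomial.sum_homogeneousComponent]
    rw [h, formEval, map_sum, Finset.mul_sum]
    refine Finset.sum_congr rfl fun d hd => ?_
    rw [eval_smul_of_isHomogeneous (MvPolynomial.homogeneousComponent_isHomogeneous d f),
      map_mul, map_pow, MvPolynomial.eval_X, MvPolynomial.eval_rename, ← mul_assoc, inv_pow,
      pow_sub₀ _ hv (Nat.lt_succ_iff.mp (Finset.mem_range.mp hd))]
    rfl

/-- A chain of irreducible closed sets inside a set with a polynomial parametrization whose inverse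
is given by quotients of linear forms is no longer than the number of parameters. -/
theorem length_le_of_chart [Finite σ] {T : Type*} [TopologicalSpace T] {ι : T → ℙ ℂ E}
    (hι : Topology.IsInducing ι) {A : Set T} (ν : σ → Module.Dual ℂ E) (δ : Module.Dual ℂ E)
    {s : (σ → ℂ) → E} (hs : IsPolynomialMap s)
    (hA : ∀ y ∈ A, ∀ v ∈ (ι y).submodule, v ≠ 0 → δ v ≠ 0 ∧
      s (fun i => (δ v)⁻¹ * ν i v) ≠ 0 ∧ s (fun i => (δ v)⁻¹ * ν i v) ∈ (ι y).submodule)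
    (p : LTSeries (TopologicalSpace.IrreducibleCloseds T)) (hp : (p.last : Set T) ⊆ A) :
    p.length ≤ Nat.card σ := by
  let j : T → σ → ℂ := fun y i => (δ (ι y).rep)⁻¹ * ν i (ι y).rep
  have hj : ∀ y ∈ A, s (j y) ≠ 0 ∧ s (j y) ∈ (ι y).submodule := fun y hy =>
    (hA y hy _ (rep_mem _) (Projectivization.rep_nonzero _)).2
  have hclosed : ∀ f : MvPolynomial σ ℂ, ∃ C : Set T, IsClosed C ∧
      ∀ y ∈ A, y ∈ C ↔ MvPolynomial.eval (j y) f = 0 := fun f => by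
    obtain ⟨d, Q, hQ, hQf⟩ := exists_homogenization f ν δ
    refine ⟨ι ⁻¹' {q | VanishesAt Q q}, (isClosed_vanishesAt hQ).preimage hι.continuous,
      fun y hy => ?_⟩
    have h0 := (hA y hy _ (rep_mem _) (Projectivization.rep_nonzero _)).1
    rw [Set.mem_preimage, Set.mem_ofPred_eq, vanishesAt_iff hQ (rep_mem _)
      (Projectivization.rep_nonzero _), hQf _ h0]
    exact ⟨fun h => (mul_eq_zero.mp h).resolve_left (pow_ne_zero _ h0), fun h => by
      rw [h, mul_zero]⟩
  have hpA : ∀ i, (p i : Set T) ⊆ A := fun i =>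
    (SetLike.coe_subset_coe.mpr (p.monotone (Fin.le_last i))).trans hp
  -- The polynomials in the chart coordinates that vanish on Z. Homogenization turns their zero sets
  -- into closed sets, so irreducibility of Z makes the ideal prime.
  let I : TopologicalSpace.IrreducibleCloseds T → Ideal (MvPolynomial σ ℂ) := fun Z =>
    { carrier := {f | ∀ y ∈ Z, MvPolynomial.eval (j y) f = 0}
      add_mem' := fun {f g} hf hg y hy => by rw [map_add, hf y hy, hg y hy, add_zero]
      zero_mem' := fun y _ => map_zero _
      smul_mem' := fun f g hg y hy => by rw [smul_eq_mul, map_mul, hg y hy, mul_zero] }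
  have hI : ∀ {Z f}, f ∈ I Z ↔ ∀ y ∈ Z, MvPolynomial.eval (j y) f = 0 := Iff.rfl
  have hprime : ∀ Z : TopologicalSpace.IrreducibleCloseds T, (Z : Set T) ⊆ A → (I Z).IsPrime := by
    intro Z hZ
    refine ⟨fun h => ?_, fun {f g} hfg => ?_⟩
    · obtain ⟨y, hy⟩ := Z.isIrreducible'.nonempty
      have := hI.mp ((Ideal.eq_top_iff_one _).mp h) y hy
      simp at this
    · obtain ⟨C, hC, hCf⟩ := hclosed f
      obtain ⟨D, hD, hDg⟩ := hclosed g
      have := isPreirreducible_iff_isClosed_union_isClosed.mp Z.isIrreducible'.isPreirreducible C D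
        hC hD fun y hy => ?_
      · refine this.imp (fun h => hI.mpr fun y hy => (hCf y (hZ hy)).mp (h hy))
          fun h => hI.mpr fun y hy => (hDg y (hZ hy)).mp (h hy)
      · have h1 := hI.mp hfg y hy
        rw [map_mul] at h1
        exact (mul_eq_zero.mp h1).imp (hCf y (hZ hy)).mpr (hDg y (hZ hy)).mpr
  -- The ideals stay distinct: a form that separates a point of the larger set from the smaller set
  -- pulls back along s to a polynomial in one ideal only.
  have hlt : ∀ i k, i < k → I (p k) < I (p i) := by
    intro i k hik
    have hlt := p.strictMono hik
    refine lt_of_le_of_ne (fun f hf => hI.mpr fun y hy => hI.mp hf y (hlt.le hy)) fun heq => ?_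
    obtain ⟨z, hz, hz'⟩ := SetLike.exists_of_lt hlt
    obtain ⟨C, hC, hCi⟩ := hι.isClosed_iff.mp (p i).isClosed'
    have hmem : ∀ y, y ∈ p i ↔ ι y ∈ C := fun y => by
      change y ∈ (p i).carrier ↔ _
      rw [← hCi]
      rfl
    obtain ⟨d, P, hP, h1, h2⟩ := exists_form_of_isClosed hC (fun h => hz' ((hmem z).mpr h))
    obtain ⟨f, hf⟩ := hs.exists_comp P
    have hfP : ∀ y ∈ A, MvPolynomial.eval (j y) f = 0 ↔ VanishesAt P (ι y) := fun y hy => by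
      rw [hf, vanishesAt_iff hP (hj y hy).2 (hj y hy).1]
    have h3 : f ∈ I (p i) := hI.mpr fun y hy =>
      (hfP y (hpA i hy)).mpr (h2 _ ((hmem y).mp hy))
    rw [← heq] at h3
    exact h1 ((hfP z (hpA k hz)).mp (hI.mp h3 z hz))
  -- Ideals decrease as closed sets grow, hence the dual order; Krull dimension does not change.
  let q : LTSeries (PrimeSpectrum (MvPolynomial σ ℂ))ᵒᵈ :=
    LTSeries.mk p.length (fun i => OrderDual.toDual ⟨I (p i), hprime _ (hpA i)⟩)
      fun i k hik => hlt i k hik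
  have h1 : ((p.length : ℕ) : WithBot ℕ∞) ≤ ringKrullDim (MvPolynomial σ ℂ) := by
    rw [ringKrullDim, ← Order.krullDim_orderDual]
    exact Order.LTSeries.length_le_krullDim q
  rw [MvPolynomial.ringKrullDim_of_isNoetherianRing, ringKrullDim_eq_zero_of_field, zero_add] at h1
  exact_mod_cast h1

end Dimension

/-! ### Singularity of the variety when the image of β is a hyperplane -/

section Singular

variable {E L N : Type*} [AddCommGroup E] [Module ℂ E]
  [AddCommGroup L] [Module ℂ L] [AddCommGroup N] [Module ℂ N]
  {Θ : L ⊗[ℂ] N →ₗ[ℂ] E} {β : N →ₗ[ℂ] L}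

theorem finrank_ker_add_one {V : Type*} [AddCommGroup V] [Module ℂ V] [FiniteDimensional ℂ V]
    {l : Module.Dual ℂ V} {v : V} (hv : l v ≠ 0) :
    Module.finrank ℂ (LinearMap.ker l) + 1 = Module.finrank ℂ V := by
  have h := LinearMap.finrank_range_add_finrank_ker l
  rw [LinearMap.range_eq_top.mpr (LinearMap.surjective fun h => hv (by rw [h]; rfl)), finrank_top,
    Module.finrank_self] at h
  omega

/-- A form vanishing on A is constant along a line contained in the cone over A. -/
theorem mem_tangentVectors_of_line {A : Set (ℙ ℂ E)} {p : ℙ ℂ E} {v w : E} (hv : v ∈ p.submodule)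
    (h0 : v ≠ 0) (hw : w ∈ cone A ∨ w = 0) (h : ∀ t : ℂ, v + t • w ∈ cone A) :
    w ∈ tangentVectors A p := by
  intro d P hP hA x hx
  have hcone : ∀ y ∈ cone A, formEval P y = 0 := fun y ⟨h1, h2⟩ => hA _ h2 _ (mem_mk h1)
  obtain ⟨c, rfl⟩ := exists_smul_of_mem hv h0 hx
  have hall : ∀ t : ℂ, formEval P (c • v + t • w) = 0 := fun t => by
    -- The definition of `tangentVectors` tests the derivative also at the zero vector of the line
    -- p. There it is w itself that must lie in the cone.
    by_cases hc : c = 0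
    · rw [hc, zero_smul, zero_add]
      obtain hw | rfl := hw
      · rw [formEval_smul hP, hcone w hw, mul_zero]
      · have h1 := hcone _ (h 0)
        rw [smul_zero, show (0 : E) = (0 : ℂ) • (v + (0 : ℂ) • (0 : E)) by simp, formEval_smul hP, h1,
          mul_zero]
    · rw [show c • v + t • w = c • (v + (c⁻¹ * t) • w) by
        rw [smul_add, smul_smul, mul_inv_cancel_left₀ hc], formEval_smul hP, hcone _ (h _), mul_zero]
  rw [lineDeriv]
  simp only [hall, deriv_const]

/-- The tangent space at `[Θ (v₀ ⊗ κ₀)]`, where `β κ₀ = 0`. -/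
theorem finrank_tangentVectors_ge [FiniteDimensional ℂ E] [FiniteDimensional ℂ L]
    [FiniteDimensional ℂ N]
    (hΘ : Function.Injective Θ) {v₀ : L} {κ₀ : N} (hv₀ : v₀ ≠ 0) (hκ₀ : κ₀ ≠ 0) (hβ : β κ₀ = 0)
    {p : ℙ ℂ E} (hp : Θ (v₀ ⊗ₜ κ₀) ∈ p.submodule) :
    Module.finrank ℂ L + Module.finrank ℂ ((Submodule.span ℂ {v₀}).comap β) ≤
      Module.finrank ℂ (Submodule.span ℂ (tangentVectors (rankOneLocus Θ β) p)) + 1 := by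
  set D := (Submodule.span ℂ {v₀}).comap β
  have hcone : ∀ v b, v ≠ 0 → b ≠ 0 → β b ∈ Submodule.span ℂ {v} →
      Θ (v ⊗ₜ b) ∈ cone (rankOneLocus Θ β) := fun v b hv hb h =>
    ⟨apply_tmul_ne_zero hΘ hv hb, v, b, hv, hb, h, mem_mk _⟩
  have h0 := apply_tmul_ne_zero hΘ hv₀ hκ₀
  have h1 : ∀ b ∈ D, Θ (v₀ ⊗ₜ b) ∈ Submodule.span ℂ (tangentVectors (rankOneLocus Θ β) p) := by
    intro b hb
    -- Multiples of κ₀ are treated apart, since for them the line v₀ ⊗ (κ₀ + t b) may pass through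
    -- 0.
    obtain ⟨c, hc⟩ | hbc := em (∃ c : ℂ, b = c • κ₀)
    · rw [hc, TensorProduct.tmul_smul, map_smul]
      refine Submodule.smul_mem _ _ (Submodule.subset_span ?_)
      intro d P hP hA x hx
      obtain ⟨c', rfl⟩ := exists_smul_of_mem hp h0 hx
      have hall : ∀ t : ℂ, formEval P (c' • Θ (v₀ ⊗ₜ κ₀) + t • Θ (v₀ ⊗ₜ κ₀)) = 0 := fun t => by
        rw [← add_smul, formEval_smul hP]
        have := hcone v₀ κ₀ hv₀ hκ₀ (by rw [hβ]; exact Submodule.zero_mem _)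
        obtain ⟨h2, h3⟩ := this
        rw [hA _ h3 _ (mem_mk h2), mul_zero]
      rw [lineDeriv]
      simp only [hall, deriv_const]
    · refine Submodule.subset_span (mem_tangentVectors_of_line hp h0 (Or.inl ?_) fun t => ?_)
      · exact hcone v₀ b hv₀ (fun h => hbc ⟨0, by rw [h, zero_smul]⟩) hb
      · rw [← map_smul, ← map_add, ← TensorProduct.tmul_smul, ← TensorProduct.tmul_add]
        refine hcone _ _ hv₀ (fun h => ?_) ?_
        · by_cases ht : t = 0
          · rw [ht, zero_smul, add_zero] at h
            exact hκ₀ h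
          · refine hbc ⟨-t⁻¹, ?_⟩
            rw [eq_neg_of_add_eq_zero_left h, smul_neg, neg_smul, neg_neg, smul_smul,
              inv_mul_cancel₀ ht, one_smul]
        · rw [map_add, hβ, zero_add, map_smul]
          exact Submodule.smul_mem _ _ hb
  have h2 : ∀ v, Θ (v ⊗ₜ κ₀) ∈ Submodule.span ℂ (tangentVectors (rankOneLocus Θ β) p) := by
    intro v
    obtain ⟨c, hc⟩ | hvc := em (∃ c : ℂ, v = c • v₀)
    · rw [hc, ← TensorProduct.smul_tmul', map_smul]
      exact Submodule.smul_mem _ _ (h1 κ₀ (by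
        rw [Submodule.mem_comap, hβ]
        exact Submodule.zero_mem _))
    · refine Submodule.subset_span (mem_tangentVectors_of_line hp h0 (Or.inl ?_) fun t => ?_)
      · exact hcone _ _ (fun h => hvc ⟨0, by rw [h, zero_smul]⟩) hκ₀ (by
          rw [hβ]
          exact Submodule.zero_mem _)
      · rw [← map_smul, ← map_add, TensorProduct.smul_tmul', ← TensorProduct.add_tmul]
        refine hcone _ _ (fun h => ?_) hκ₀ (by rw [hβ]; exact Submodule.zero_mem _)
        by_cases ht : t = 0
        · rw [ht, zero_smul, add_zero] at h
          exact hv₀ h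
        · refine hvc ⟨-t⁻¹, ?_⟩
          rw [eq_neg_of_add_eq_zero_left h, smul_neg, neg_smul, neg_neg, smul_smul,
            inv_mul_cancel₀ ht, one_smul]
  -- The tangent vectors v ⊗ κ₀ and v₀ ⊗ b overlap only in the multiples of v₀ ⊗ κ₀, so together
  -- they span dimension dim L + dim D - 1.
  let G : L × D →ₗ[ℂ] E := Θ ∘ₗ LinearMap.coprod ((TensorProduct.mk ℂ L N).flip κ₀)
    (TensorProduct.mk ℂ L N v₀ ∘ₗ D.subtype)
  have hG : ∀ x, G x = Θ (x.1 ⊗ₜ κ₀ + v₀ ⊗ₜ (x.2 : N)) := fun x => rfl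
  have hrange : LinearMap.range G ≤ Submodule.span ℂ (tangentVectors (rankOneLocus Θ β) p) := by
    rintro _ ⟨x, rfl⟩
    rw [hG, map_add]
    exact Submodule.add_mem _ (h2 _) (h1 _ x.2.2)
  have hκD : κ₀ ∈ D := by
    rw [Submodule.mem_comap, hβ]
    exact Submodule.zero_mem _
  have hker : LinearMap.ker G ≤ Submodule.span ℂ {((v₀, -⟨κ₀, hκD⟩) : L × D)} := by
    intro x hx
    rw [LinearMap.mem_ker, hG, map_eq_zero_iff _ hΘ] at hx
    obtain ⟨μ, hμ⟩ := exists_dual_ne_zero hκ₀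
    obtain ⟨l, hl⟩ := exists_dual_ne_zero hv₀
    have h3 := congrArg (contractSnd μ) hx
    rw [map_add, contractSnd_tmul, contractSnd_tmul, map_zero] at h3
    have h4 : x.1 = (-(μ κ₀)⁻¹ * μ (x.2 : N)) • v₀ := by
      rw [mul_smul, ← neg_eq_of_add_eq_zero_right h3, neg_smul, smul_neg, neg_neg, smul_smul,
        inv_mul_cancel₀ hμ, one_smul]
    set c := -(μ κ₀)⁻¹ * μ (x.2 : N)
    have h5 := congrArg (contractFst l) hx
    rw [h4, map_add, contractFst_tmul, contractFst_tmul, map_smul, map_zero, smul_eq_mul, mul_comm,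
      mul_smul, ← smul_add] at h5
    have h6 := (smul_eq_zero.mp h5).resolve_left hl
    rw [Submodule.mem_span_singleton]
    refine ⟨c, Prod.ext h4.symm (Subtype.ext ?_)⟩
    change c • (-κ₀) = _
    rw [smul_neg]
    exact neg_eq_of_add_eq_zero_right h6
  have h3 := LinearMap.finrank_range_add_finrank_ker G
  have h4 := Submodule.finrank_mono hrange
  have h5 := (Submodule.finrank_mono hker).trans
    (finrank_span_singleton (fun h => hv₀ (congrArg Prod.fst h))).le
  rw [Module.finrank_prod] at h3
  omega

/-- The length of chains of irreducible closed sets in the set of points `[Θ (v ⊗ (κ + c • S v))]`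
with `v ∈ A`, `κ ∈ K` and `c ∈ C'`. -/
theorem length_add_two_le_of_rankOne [FiniteDimensional ℂ L]
    [FiniteDimensional ℂ N] (hΘ : Function.Injective Θ) {T : Type*} [TopologicalSpace T]
    {ι : T → ℙ ℂ E} (hι : Topology.IsInducing ι) {Y : Set T} (A : Submodule ℂ L)
    (C' : Submodule ℂ ℂ) {K : Submodule ℂ N} (S : L →ₗ[ℂ] N) (πK : N →ₗ[ℂ] K) (χ : N →ₗ[ℂ] C')
    (l : Module.Dual ℂ L) (μ : Module.Dual ℂ K)
    (hπ : ∀ v ∈ A, ∀ (κ : K) (c : C'), πK (κ + (c : ℂ) • S v) = κ)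
    (hχ : ∀ v ∈ A, ∀ (κ : K) (c : C'), χ (κ + (c : ℂ) • S v) = l v • c)
    {v₀ : L} (hv₀ : v₀ ∈ A) (hl : l v₀ = 1) {κ₀ : K} (hμ : μ κ₀ = 1)
    (hY : ∀ y ∈ Y, ∃ v ∈ A, ∃ (κ : K) (c : C'), l v ≠ 0 ∧ μ κ ≠ 0 ∧
      Θ (v ⊗ₜ (κ + (c : ℂ) • S v)) ∈ (ι y).submodule)
    (p : LTSeries (TopologicalSpace.IrreducibleCloseds T)) (hp : (p.last : Set T) ⊆ Y) :
    p.length + 2 ≤ Module.finrank ℂ A + Module.finrank ℂ K + Module.finrank ℂ C' := by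
  obtain ⟨Ψ, hΨ⟩ := Θ.exists_leftInverse_of_injective (LinearMap.ker_eq_bot.mpr hΘ)
  replace hΨ : ∀ t, Ψ (Θ t) = t := fun t => LinearMap.congr_fun hΨ t
  obtain ⟨πA, hπA⟩ := A.subtype.exists_leftInverse_of_injective A.ker_subtype
  replace hπA : ∀ a : A, πA a = a := fun a => LinearMap.congr_fun hπA a
  let lA : Module.Dual ℂ A := l ∘ₗ A.subtype
  have hlA : lA ⟨v₀, hv₀⟩ = 1 := hl
  let pA : A →ₗ[ℂ] LinearMap.ker lA := (LinearMap.id - lA.smulRight (⟨v₀, hv₀⟩ : A)).codRestrict _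
    fun a => by
      rw [LinearMap.mem_ker, LinearMap.sub_apply, map_sub, LinearMap.smulRight_apply, map_smul, hlA,
        smul_eq_mul, mul_one, LinearMap.id_apply, sub_self]
  let pK : K →ₗ[ℂ] LinearMap.ker μ := (LinearMap.id - μ.smulRight κ₀).codRestrict _
    fun a => by simp [hμ]
  have hpA : ∀ a : A, ((pA a : A) : L) = a - l a • v₀ := fun a => rfl
  have hpK : ∀ a, (pK a : K) = a - μ a • κ₀ := fun a => rfl
  let e := (Module.finBasis ℂ (LinearMap.ker lA × LinearMap.ker μ × C')).equivFun
  -- The chart normalizes l(v) = 1 and μ(κ) = 1. Its parameters are the deviations of v from v₀ and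
  -- of κ from κ₀, together with c, which accounts for the two dimensions lost. Contractions recover
  -- v and b up to scalars, so numerators and denominator are linear on E.
  let ν : E →ₗ[ℂ] LinearMap.ker lA × LinearMap.ker μ × C' :=
    (pA ∘ₗ πA ∘ₗ contractSnd (μ ∘ₗ πK) ∘ₗ Ψ).prod ((pK ∘ₗ πK ∘ₗ contractFst l ∘ₗ Ψ).prod
      (χ ∘ₗ contractFst l ∘ₗ Ψ))
  let δ : Module.Dual ℂ E := l ∘ₗ contractSnd (μ ∘ₗ πK) ∘ₗ Ψ
  let s : LinearMap.ker lA × LinearMap.ker μ × C' → E := fun m =>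
    Θ ((v₀ + (m.1 : A)) ⊗ₜ ((κ₀ + (m.2.1 : K)) + (m.2.2 : ℂ) • S (v₀ + (m.1 : A))))
  have hs : IsPolynomialMap fun a => s (e.symm a) := by
    have h1 : IsPolynomialMap fun a => v₀ + (((e.symm a).1 : A) : L) :=
      IsPolynomialMap.const_add_linear v₀ (A.subtype ∘ₗ Submodule.subtype _ ∘ₗ
        LinearMap.fst ℂ _ _ ∘ₗ e.symm.toLinearMap)
    have h2 : IsPolynomialMap fun a => (κ₀ : N) + (((e.symm a).2.1 : K) : N) :=
      IsPolynomialMap.const_add_linear (κ₀ : N) (K.subtype ∘ₗ Submodule.subtype _ ∘ₗ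
        LinearMap.fst ℂ _ _ ∘ₗ LinearMap.snd ℂ _ _ ∘ₗ e.symm.toLinearMap)
    have h3 : IsPolynomialMap fun a => (0 : C') + (e.symm a).2.2 :=
      IsPolynomialMap.const_add_linear (0 : C') (LinearMap.snd ℂ _ _ ∘ₗ LinearMap.snd ℂ _ _ ∘ₗ
        e.symm.toLinearMap)
    simp only [zero_add] at h3
    exact IsPolynomialMap.bilinear ((TensorProduct.mk ℂ L N).compr₂ Θ) h1 (h2.add
      (IsPolynomialMap.bilinear
        (((LinearMap.lsmul ℂ N : ℂ →ₗ[ℂ] N →ₗ[ℂ] N) ∘ₗ C'.subtype).compl₂ S) h3 h1))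
  have h := length_le_of_chart hι (fun i => LinearMap.proj i ∘ₗ e.toLinearMap ∘ₗ ν) δ hs (A := Y)
    (fun y hy w hw h0 => ?_) p hp
  · have h1 := finrank_ker_add_one (l := lA) (v := ⟨v₀, hv₀⟩) (by rw [hlA]; exact one_ne_zero)
    have h2 := finrank_ker_add_one (l := μ) (v := κ₀) (by rw [hμ]; exact one_ne_zero)
    rw [Nat.card_fin, Module.finrank_prod, Module.finrank_prod] at h
    omega
  · obtain ⟨v, hv, κ, c, hlv, hμκ, hvκ⟩ := hY y hy
    have hv0 : v ≠ 0 := fun h => hlv (by rw [h, map_zero])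
    set b : N := κ + (c : ℂ) • S v with hb
    have hb0 : b ≠ 0 := fun h => hμκ (by rw [← hπ v hv κ c, ← hb, h, map_zero, map_zero])
    have hΘ0 := apply_tmul_ne_zero hΘ hv0 hb0
    obtain ⟨g, hgw⟩ := exists_smul_of_mem hvκ hΘ0 hw
    have hg : g ≠ 0 := fun h => h0 (by rw [hgw, h, zero_smul])
    have hSnd : contractSnd (μ ∘ₗ πK) (Ψ w) = (g * μ κ) • v := by
      rw [hgw, map_smul, hΨ, map_smul, contractSnd_tmul, LinearMap.comp_apply, hb, hπ v hv, smul_smul]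
    have hFst : contractFst l (Ψ w) = (g * l v) • b := by
      rw [hgw, map_smul, hΨ, map_smul, contractFst_tmul, smul_smul]
    have hδ : δ w = g * μ κ * l v := by
      change l (contractSnd _ _) = _
      rw [hSnd, map_smul, smul_eq_mul]
    have hδ0 : δ w ≠ 0 := by
      rw [hδ]
      exact mul_ne_zero (mul_ne_zero hg hμκ) hlv
    have harg : e.symm (fun i => (δ w)⁻¹ *
        (LinearMap.proj i ∘ₗ e.toLinearMap ∘ₗ ν) w) =
        (δ w)⁻¹ • ν w := by
      rw [LinearEquiv.symm_apply_eq, map_smul]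
      rfl
    have hs' : s ((δ w)⁻¹ • ν w) =
        ((l v)⁻¹ * (μ κ)⁻¹) • Θ (v ⊗ₜ b) := by
      have e1 : v₀ + ((((δ w)⁻¹ • ν w).1 : A) : L) = (l v)⁻¹ • v := by
        change v₀ + (δ w)⁻¹ • ((pA (πA (contractSnd _ _)) : A) : L) = _
        have : πA v = ⟨v, hv⟩ := hπA ⟨v, hv⟩
        rw [hSnd, map_smul, this, map_smul, Submodule.coe_smul, Submodule.coe_smul, hpA, hδ, smul_sub,
          smul_sub, smul_smul, smul_smul, smul_smul]
        rw [show (g * μ κ * l v)⁻¹ * (g * μ κ) = (l v)⁻¹ by field_simp, inv_mul_cancel₀ hlv, one_smul,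
          add_sub_cancel]
      have e2 : (κ₀ : N) + ((((δ w)⁻¹ • ν w).2.1 : K) : N) =
          (μ κ)⁻¹ • (κ : N) := by
        change (κ₀ : N) + (δ w)⁻¹ • ((pK (πK (contractFst _ _)) : K) : N) = _
        rw [hFst, map_smul, hb, hπ v hv, map_smul, Submodule.coe_smul, Submodule.coe_smul, hpK, hδ]
        rw [Submodule.coe_sub, Submodule.coe_smul, smul_sub, smul_sub, smul_smul, smul_smul, smul_smul,
          show (g * μ κ * l v)⁻¹ * (g * l v) = (μ κ)⁻¹ by field_simp, inv_mul_cancel₀ hμκ, one_smul,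
          add_sub_cancel]
      have e3 : ((((δ w)⁻¹ • ν w).2.2 : C') : ℂ) =
          (μ κ)⁻¹ * l v * c := by
        change (δ w)⁻¹ * ((χ (contractFst _ _) : C') : ℂ) = _
        rw [hFst, map_smul, hb, hχ v hv, hδ, Submodule.coe_smul, Submodule.coe_smul, smul_eq_mul,
          smul_eq_mul]
        field_simp
      simp only [s]
      rw [e1, e2, e3, map_smul, smul_smul, show (μ κ)⁻¹ * l v * c * (l v)⁻¹ = (μ κ)⁻¹ * c by field_simp,
        mul_smul (μ κ)⁻¹, ← smul_add, ← hb, TensorProduct.tmul_smul, ← TensorProduct.smul_tmul',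
        map_smul, map_smul, smul_smul, mul_comm]
    refine ⟨hδ0, ?_, ?_⟩
    · rw [harg, hs']
      exact smul_ne_zero (mul_ne_zero (inv_ne_zero hlv) (inv_ne_zero hμκ)) hΘ0
    · rw [harg, hs']
      exact Submodule.smul_mem _ _ hvκ

/-- The loci β b = 0 and v ∈ ker l₀ cover the variety. Put n = dim L + dim ker β. Near a suitable
common point v₀ ⊗ κ₀ both have dimension at most n - 2, whereas the tangent cone construction of
`finrank_tangentVectors_ge` yields vector dimension at least n instead of n - 1. -/
theorem not_isSmoothVariety_rankOneLocus [FiniteDimensional ℂ E] [FiniteDimensional ℂ L]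
    [FiniteDimensional ℂ N] (hΘ : Function.Injective Θ) {l₀ : Module.Dual ℂ L} (hl₀ : l₀ ≠ 0)
    (hβ : LinearMap.range β = LinearMap.ker l₀) (hL : 2 ≤ Module.finrank ℂ L)
    (hker : LinearMap.ker β ≠ ⊥) : ¬ IsSmoothVariety (rankOneLocus Θ β) := by
  intro hsmooth
  obtain ⟨Ψ, hΨ⟩ := Θ.exists_leftInverse_of_injective (LinearMap.ker_eq_bot.mpr hΘ)
  replace hΨ : ∀ t, Ψ (Θ t) = t := fun t => LinearMap.congr_fun hΨ t
  obtain ⟨u, hu⟩ : ∃ u, l₀ u ≠ 0 := by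
    by_contra! h
    exact hl₀ (LinearMap.ext h)
  have hkerl₀ := finrank_ker_add_one hu
  have hrank := LinearMap.finrank_range_add_finrank_ker β
  rw [hβ] at hrank
  obtain ⟨v₀, hv₀, hv₀0⟩ : ∃ v₀ ∈ LinearMap.ker l₀, v₀ ≠ 0 := by
    refine (Submodule.ne_bot_iff _).mp fun h => ?_
    rw [h, finrank_bot] at hkerl₀
    omega
  obtain ⟨κ₀, hκ₀, hκ₀0⟩ := (Submodule.ne_bot_iff _).mp hker
  have hex : ∀ {V : Type _} [AddCommGroup V] [Module ℂ V] {v : V}, v ≠ 0 →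
      ∃ l : Module.Dual ℂ V, l v = 1 := fun {V} _ _ {v} hv => by
    obtain ⟨l, hl⟩ := exists_dual_ne_zero hv
    exact ⟨(l v)⁻¹ • l, by simp [hl]⟩
  obtain ⟨l, hl⟩ := hex hv₀0
  obtain ⟨μ, hμ⟩ : ∃ μ : Module.Dual ℂ (LinearMap.ker β), μ ⟨κ₀, hκ₀⟩ = 1 := by
    obtain ⟨μ, hμ⟩ := exists_dual_ne_zero (b := (⟨κ₀, hκ₀⟩ : LinearMap.ker β))
      fun h => hκ₀0 (congrArg Subtype.val h)
    exact ⟨(μ ⟨κ₀, hκ₀⟩)⁻¹ • μ, by simp [hμ]⟩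
  obtain ⟨S, hS⟩ : ∃ S : L →ₗ[ℂ] N, ∀ v ∈ LinearMap.ker l₀, β (S v) = v := by
    obtain ⟨S₀, hS₀⟩ := β.rangeRestrict.exists_rightInverse_of_surjective β.range_rangeRestrict
    obtain ⟨S, hS⟩ := S₀.exists_extend
    refine ⟨S, fun v hv => ?_⟩
    rw [← hβ] at hv
    have h1 := LinearMap.congr_fun hS ⟨v, hv⟩
    have h2 := congrArg Subtype.val (LinearMap.congr_fun hS₀ ⟨v, hv⟩)
    rw [LinearMap.comp_apply, Submodule.subtype_apply] at h1
    rw [h1]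
    exact h2
  have hβmem : ∀ b, β b ∈ LinearMap.ker l₀ := fun b => hβ ▸ LinearMap.mem_range_self β b
  let πK : N →ₗ[ℂ] LinearMap.ker β := (LinearMap.id - S ∘ₗ β).codRestrict _ fun b => by
    simp [hS _ (hβmem b)]
  have hπK : ∀ b, (πK b : N) = b - S (β b) := fun b => rfl
  have h0 := apply_tmul_ne_zero hΘ hv₀0 hκ₀0
  set F := rankOneLocus Θ β
  set p := Projectivization.mk ℂ _ h0 with hp
  have hpF : p ∈ F := ⟨v₀, κ₀, hv₀0, hκ₀0, by
    rw [LinearMap.mem_ker.mp hκ₀]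
    exact Submodule.zero_mem _, mem_mk h0⟩
  let δ : Module.Dual ℂ E := l ∘ₗ contractSnd (μ ∘ₗ πK) ∘ₗ Ψ
  have hδ : ∀ v b, δ (Θ (v ⊗ₜ b)) = μ (πK b) * l v := fun v b => by
    simp [δ, hΨ]
  set U : Set (ℙ ℂ E) := {q | ¬ q.submodule ≤ LinearMap.ker δ} with hU
  have hpU : p ∈ U := fun h => by
    have h1 := h (mem_mk h0)
    have h2 : πK κ₀ = ⟨κ₀, hκ₀⟩ := Subtype.ext (by
      rw [hπK, LinearMap.mem_ker.mp hκ₀, map_zero, sub_zero])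
    rw [LinearMap.mem_ker, hδ, h2, hμ, hl, one_mul] at h1
    exact one_ne_zero h1
  have hdata : ∀ y : ↥(F ∩ U), ∃ (v : L) (b : N) (c : ℂ), β b = c • v ∧ l v ≠ 0 ∧ μ (πK b) ≠ 0 ∧ v ≠ 0 ∧ b ≠ 0 ∧
      Θ (v ⊗ₜ b) ∈ (y : ℙ ℂ E).submodule := by
    rintro ⟨y, ⟨v, b, hv, hb, hvb, hy⟩, hyU⟩
    obtain ⟨c, hc⟩ := Submodule.mem_span_singleton.mp hvb
    have h1 : δ (Θ (v ⊗ₜ b)) ≠ 0 := fun h1 => hyU (by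
      rw [submodule_eq_span hy (apply_tmul_ne_zero hΘ hv hb)]
      simpa using h1)
    rw [hδ] at h1
    exact ⟨v, b, c, hc.symm, right_ne_zero_of_mul h1, left_ne_zero_of_mul h1, hv, hb, hy⟩
  have hι : Topology.IsInducing (Subtype.val : ↥(F ∩ U) → ℙ ℂ E) := Topology.IsInducing.subtypeVal
  let Y₁ : Set ↥(F ∩ U) := Subtype.val ⁻¹'
    {q | ∀ w ∈ q.submodule, (β ∘ₗ contractFst l ∘ₗ Ψ) w = 0}
  let Y₂ : Set ↥(F ∩ U) := Subtype.val ⁻¹'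
    {q | ∀ w ∈ q.submodule, (l₀ ∘ₗ contractSnd (μ ∘ₗ πK) ∘ₗ Ψ) w = 0}
  have hY₁ : IsClosed Y₁ := (isClosed_zeros (IsHomogeneousPolyMap.of_linearMap
    (β ∘ₗ contractFst l ∘ₗ Ψ))).preimage hι.continuous
  have hY₂ : IsClosed Y₂ := (isClosed_zeros (IsHomogeneousPolyMap.of_linearMap
    (l₀ ∘ₗ contractSnd (μ ∘ₗ πK) ∘ₗ Ψ))).preimage hι.continuous
  have hcover : ∀ y, y ∈ Y₁ ∪ Y₂ := by
    intro y
    obtain ⟨v, b, c, hc, hlv, hμb, hv, hb, hy⟩ := hdata y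
    -- If c v = β b with c ≠ 0, then v lies in the range of β, which is ker l₀.
    by_cases hc0 : c = 0
    · refine Or.inl fun w hw => ?_
      obtain ⟨g, rfl⟩ := exists_smul_of_mem hy (apply_tmul_ne_zero hΘ hv hb) hw
      simp [hΨ, hc, hc0]
    · refine Or.inr fun w hw => ?_
      obtain ⟨g, rfl⟩ := exists_smul_of_mem hy (apply_tmul_ne_zero hΘ hv hb) hw
      have h1 := hβmem b
      rw [hc, LinearMap.mem_ker, map_smul, smul_eq_zero] at h1
      simp [hΨ, h1.resolve_left hc0]
  -- The parameter count for both loci: dim L + dim ker β on the first, where c = 0 and C' = ⊥; (dim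
  -- L - 1) + dim ker β + 1 on the second, where c is free and C' = ⊤. Here n ≥ 3, so n - 2 is not
  -- truncated.
  set n := Module.finrank ℂ L + Module.finrank ℂ (LinearMap.ker β) with hn
  have hdim : topologicalKrullDim ↥(F ∩ U) ≤ ((n - 2 : ℕ) : WithBot ℕ∞) := by
    refine iSup_le fun q => ?_
    suffices h : q.length + 2 ≤ n by
      have : q.length ≤ n - 2 := by omega
      exact_mod_cast this
    obtain h | h := isPreirreducible_iff_isClosed_union_isClosed.mp
      q.last.isIrreducible'.isPreirreducible Y₁ Y₂ hY₁ hY₂ fun y _ => hcover y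
    · have h2 := length_add_two_le_of_rankOne hΘ hι ⊤ ⊥ S πK 0 l μ (fun v _ κ c => ?_)
        (fun v _ κ c => Subsingleton.elim _ _) (v₀ := v₀) trivial hl hμ (Y := Y₁)
        (fun y hy => ?_) q h
      · rwa [finrank_top, finrank_bot, add_zero] at h2
      · have : c = 0 := Subsingleton.elim _ _
        refine Subtype.ext ?_
        rw [this, hπK]
        simp
      · obtain ⟨v, b, c, hc, hlv, hμb, hv, hb, hw⟩ := hdata y
        have h1 := hy _ hw
        simp only [LinearMap.comp_apply, hΨ, contractFst_tmul, map_smul, smul_eq_zero] at h1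
        have h3 := h1.resolve_left hlv
        have h4 : (πK b : N) = b := by rw [hπK, h3, map_zero, sub_zero]
        refine ⟨v, trivial, πK b, 0, hlv, hμb, ?_⟩
        rw [h4, Submodule.coe_zero, zero_smul, add_zero]
        exact hw
    · have h2 := length_add_two_le_of_rankOne hΘ hι (LinearMap.ker l₀) ⊤ S πK
        ((l ∘ₗ β).codRestrict ⊤ fun _ => trivial) l μ (fun v hv κ c => ?_)
        (fun v hv κ c => ?_) hv₀ hl hμ (Y := Y₂)
        (fun y hy => ?_) q h
      · rw [finrank_top, Module.finrank_self] at h2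
        omega
      · refine Subtype.ext ?_
        rw [hπK, map_add, LinearMap.mem_ker.mp κ.2, zero_add, map_smul, hS v hv, map_smul,
          add_sub_cancel_right]
      · refine Subtype.ext ?_
        change l (β _) = l v * (c : ℂ)
        rw [map_add, LinearMap.mem_ker.mp κ.2, zero_add, map_smul, hS v hv, map_smul, smul_eq_mul,
          mul_comm]
      · obtain ⟨v, b, c, hc, hlv, hμb, hv, hb, hw⟩ := hdata y
        have h1 := hy _ hw
        simp only [LinearMap.comp_apply, hΨ, contractSnd_tmul, map_smul, smul_eq_zero] at h1
        refine ⟨v, h1.resolve_left hμb, πK b, ⟨c, trivial⟩, hlv, hμb, ?_⟩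
        rw [hπK, hc, map_smul, sub_add_cancel]
        exact hw
  have hloc : localDim F p ≤ ((n - 2 : ℕ) : WithBot ℕ∞) :=
    (iInf_le _ (⟨U, isOpen_linear_ne δ, hpU⟩ : {U : Set (ℙ ℂ E) // IsOpen U ∧ p ∈ U})).trans hdim
  have htan : Module.finrank ℂ L + Module.finrank ℂ ((Submodule.span ℂ {v₀}).comap β) ≤
      Module.finrank ℂ (Submodule.span ℂ (tangentVectors F p)) + 1 :=
    finrank_tangentVectors_ge hΘ hv₀0 hκ₀0 (LinearMap.mem_ker.mp hκ₀) (p := p) (mem_mk h0)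
  -- As v₀ lies in the range of β, its preimage line adds a direction to ker β. This is the excess
  -- in the tangent space.
  have hD : Module.finrank ℂ (LinearMap.ker β) + 1 ≤
      Module.finrank ℂ ((Submodule.span ℂ {v₀}).comap β) := by
    have hlt : LinearMap.ker β < (Submodule.span ℂ {v₀}).comap β := by
      refine lt_of_le_of_ne (fun b hb => ?_) fun h => ?_
      · rw [Submodule.mem_comap, LinearMap.mem_ker.mp hb]
        exact Submodule.zero_mem _
      · have h1 : S v₀ ∈ (Submodule.span ℂ {v₀}).comap β := by
          rw [Submodule.mem_comap, hS v₀ hv₀]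
          exact Submodule.mem_span_singleton_self _
        rw [← h, LinearMap.mem_ker, hS v₀ hv₀] at h1
        exact hv₀0 h1
    exact Submodule.finrank_lt_finrank_of_lt hlt
  have h1 := hsmooth p hpF
  have h2 : ((Module.finrank ℂ (Submodule.span ℂ (tangentVectors F p)) : ℕ) : WithBot ℕ∞) ≤
      ((n - 2 + 1 : ℕ) : WithBot ℕ∞) := by
    rw [h1]
    push_cast
    gcongr
  have h3 : Module.finrank ℂ (Submodule.span ℂ (tangentVectors F p)) ≤ n - 2 + 1 := by
    exact_mod_cast h2
  have h4 : 1 ≤ Module.finrank ℂ (LinearMap.ker β) :=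
    Nat.one_le_iff_ne_zero.mpr fun h => hker (Submodule.finrank_eq_zero.mp h)
  omega

end Singular

/-! ### Decomposable vectors in the exterior power and Plücker lines -/

section Exterior

variable {V : Type*} [AddCommGroup V] [Module ℂ V]

theorem exists_dual_family {σ : Type*} [Fintype σ] [DecidableEq σ] {u : σ → V}
    (hu : LinearIndependent ℂ u) :
    ∃ φ : σ → Module.Dual ℂ V, ∀ i j, φ i (u j) = if i = j then 1 else 0 := by
  obtain ⟨g, hg⟩ := LinearMap.exists_leftInverse_of_injective (Fintype.linearCombination ℂ u)
    (LinearMap.ker_eq_bot.mpr (linearIndependent_iff_injective_fintypeLinearCombination.mp hu))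
  refine ⟨fun i => LinearMap.proj i ∘ₗ g, fun i j => ?_⟩
  have h := LinearMap.congr_fun hg (Pi.single j 1)
  simp only [LinearMap.comp_apply, LinearMap.id_apply, Fintype.linearCombination_apply_single,
    one_smul] at h
  simp [h, Pi.single_apply]

/-- The coordinate of an element of the exterior power belonging to a family of linear forms. -/
noncomputable def exteriorCoord {k : ℕ} (φ : Fin k → Module.Dual ℂ V) :
    Module.Dual ℂ (⋀[ℂ]^k V) :=
  exteriorPower.pairingDual ℂ V k (exteriorPower.ιMulti ℂ k φ)

theorem exteriorCoord_ιMulti {k : ℕ} (φ : Fin k → Module.Dual ℂ V) (v : Fin k → V) :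
    exteriorCoord φ (exteriorPower.ιMulti ℂ k v) = Matrix.det (.of fun i j => φ j (v i)) :=
  exteriorPower.pairingDual_ιMulti_ιMulti φ v

theorem exteriorCoord_dual_family {k : ℕ} {φ : Fin k → Module.Dual ℂ V} {u : Fin k → V}
    (h : ∀ i j, φ i (u j) = if i = j then 1 else 0) :
    exteriorCoord φ (exteriorPower.ιMulti ℂ k u) = 1 := by
  rw [exteriorCoord_ιMulti, ← Matrix.det_one (n := Fin k)]
  congr 1
  ext i j
  simp [h, Matrix.one_apply, eq_comm]

theorem ιMulti_ne_zero_iff {k : ℕ} {u : Fin k → V} :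
    exteriorPower.ιMulti ℂ k u ≠ 0 ↔ LinearIndependent ℂ u := by
  refine ⟨fun h => by_contra fun hn => h ?_, fun hu h0 => ?_⟩
  · exact AlternatingMap.map_linearDependent _ _ hn
  · obtain ⟨φ, hφ⟩ := exists_dual_family hu
    have := exteriorCoord_dual_family hφ
    simp [h0] at this

theorem exists_exteriorCoord_ne_zero [FiniteDimensional ℂ V] {k : ℕ} {w : ⋀[ℂ]^k V} (hw : w ≠ 0) :
    ∃ φ : Fin k → Module.Dual ℂ V, exteriorCoord φ w ≠ 0 := by
  by_contra! h
  let b := Module.finBasis ℂ V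
  refine hw ((b.exteriorPower k).ext_elem fun s => ?_)
  rw [exteriorPower.basis_repr_apply, exteriorPower.basis_repr_apply, map_zero]
  exact h _

/-- Contraction of an element of the exterior power with all but one of the linear forms `φ`. -/
noncomputable def contractExcept [FiniteDimensional ℂ V] {k : ℕ} (φ : Fin k → Module.Dual ℂ V)
    (i : Fin k) : ⋀[ℂ]^k V →ₗ[ℂ] V :=
  (Module.evalEquiv ℂ V).symm.toLinearMap ∘ₗ
    LinearMap.flip (((exteriorPower.pairingDual ℂ V k).compAlternatingMap
      (exteriorPower.ιMulti ℂ k)).toMultilinearMap.toLinearMap φ i)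

theorem apply_contractExcept [FiniteDimensional ℂ V] {k : ℕ} (φ : Fin k → Module.Dual ℂ V)
    (i : Fin k) (w : ⋀[ℂ]^k V) (ψ : Module.Dual ℂ V) :
    ψ (contractExcept φ i w) = exteriorCoord (Function.update φ i ψ) w := by
  simp [contractExcept, exteriorCoord]

theorem apply_contractExcept_self [FiniteDimensional ℂ V] {k : ℕ} (φ : Fin k → Module.Dual ℂ V)
    (i j : Fin k) (w : ⋀[ℂ]^k V) :
    φ j (contractExcept φ i w) = if i = j then exteriorCoord φ w else 0 := by
  rw [apply_contractExcept]
  split_ifs with h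
  · subst h; rw [Function.update_eq_self]
  · have : exteriorPower.ιMulti ℂ k (Function.update φ i (φ j)) = 0 :=
      AlternatingMap.map_update_self _ _ h
    rw [exteriorCoord, this]; simp

/-- The contractions are dual to φ up to the common factor `exteriorCoord φ w`. -/
theorem linearIndependent_contractExcept [FiniteDimensional ℂ V] {k : ℕ}
    {φ : Fin k → Module.Dual ℂ V} {w : ⋀[ℂ]^k V} (h : exteriorCoord φ w ≠ 0) :
    LinearIndependent ℂ (fun i => contractExcept φ i w) := by
  rw [Fintype.linearIndependent_iff]
  intro g hg i
  have := congrArg (φ i) hg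
  simpa [map_sum, apply_contractExcept_self, h] using this

theorem contractLeft_mem_exteriorPower {k : ℕ} (φ : Module.Dual ℂ V) {w : ExteriorAlgebra ℂ V}
    (hw : w ∈ ⋀[ℂ]^(k + 1) V) :
    CliffordAlgebra.contractLeft (Q := (0 : QuadraticForm ℂ V)) φ w ∈ ⋀[ℂ]^k V := by
  induction k generalizing w with
  | zero =>
    rw [ExteriorAlgebra.exteriorPower, zero_add, pow_one] at hw
    obtain ⟨v, rfl⟩ := hw
    erw [CliffordAlgebra.contractLeft_ι]
    rw [ExteriorAlgebra.exteriorPower, pow_zero]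
    exact Submodule.algebraMap_mem _
  | succ k ih =>
    rw [ExteriorAlgebra.exteriorPower, pow_succ'] at hw
    induction hw using Submodule.mul_induction_on' with
    | mem_mul_mem m hm n hn =>
      obtain ⟨v, rfl⟩ := hm
      erw [CliffordAlgebra.contractLeft_ι_mul]
      refine Submodule.sub_mem _ (Submodule.smul_mem _ _ hn) ?_
      rw [ExteriorAlgebra.exteriorPower, pow_succ']
      exact Submodule.mul_mem_mul (LinearMap.mem_range_self _ v) (ih hn)
    | add x _ y _ hx hy => rw [map_add]; exact Submodule.add_mem _ hx hy

/-- Contracting c₀ ∧ w = 0 with φ₀ gives w = c₀ ∧ (φ₀ ⌟ w). The other c_i annihilate φ₀ ⌟ w because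
φ₀(c_i) = 0, so induction on the degree applies. -/
theorem eq_smul_ιMulti_of_ι_mul_eq_zero {k : ℕ} {c : Fin k → V} {φ : Fin k → Module.Dual ℂ V}
    (hφ : ∀ i j, φ i (c j) = if i = j then 1 else 0) {w : ExteriorAlgebra ℂ V}
    (hw : w ∈ ⋀[ℂ]^k V) (h : ∀ i, ExteriorAlgebra.ι ℂ (c i) * w = 0) :
    ∃ γ : ℂ, w = γ • ExteriorAlgebra.ιMulti ℂ k c := by
  induction k generalizing w with
  | zero =>
    rw [ExteriorAlgebra.exteriorPower, pow_zero, Submodule.mem_one] at hw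
    obtain ⟨γ, rfl⟩ := hw
    exact ⟨γ, by rw [ExteriorAlgebra.ιMulti_zero_apply, Algebra.algebraMap_eq_smul_one]⟩
  | succ k ih =>
    let d : ExteriorAlgebra ℂ V →ₗ[ℂ] ExteriorAlgebra ℂ V :=
      CliffordAlgebra.contractLeft (Q := (0 : QuadraticForm ℂ V)) (φ 0)
    have hd : ∀ v x, d (ExteriorAlgebra.ι ℂ v * x) =
        φ 0 v • x - ExteriorAlgebra.ι ℂ v * d x :=
      fun v x => CliffordAlgebra.contractLeft_ι_mul (φ 0) v x
    have hw0 : w = ExteriorAlgebra.ι ℂ (c 0) * d w := by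
      have := hd (c 0) w
      rw [h 0, map_zero, hφ, if_pos rfl, one_smul] at this
      exact (sub_eq_zero.mp this.symm)
    obtain ⟨γ, hγ⟩ := ih (c := fun i => c i.succ) (φ := fun i => φ i.succ) (w := d w)
      (fun i j => by simp [hφ]) (contractLeft_mem_exteriorPower (φ 0) hw) (fun i => by
        have := hd (c i.succ) w
        rw [h i.succ, map_zero, hφ, if_neg (Fin.succ_ne_zero i).symm, zero_smul, zero_sub] at this
        exact neg_eq_zero.mp this.symm)
    refine ⟨γ, ?_⟩
    rw [ExteriorAlgebra.ιMulti_succ_apply, ← mul_smul_comm, hw0, hγ]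
    rfl

theorem ι_mul_ιMulti {k : ℕ} (v : V) (u : Fin k → V) :
    ExteriorAlgebra.ι ℂ v * (exteriorPower.ιMulti ℂ k u : ExteriorAlgebra ℂ V) =
      exteriorPower.ιMulti ℂ (k + 1) (Fin.cons v u : Fin (k + 1) → V) := by
  rw [exteriorPower.ιMulti_apply_coe, exteriorPower.ιMulti_apply_coe,
    ExteriorAlgebra.ιMulti_succ_apply]
  rfl

theorem ι_mul_ιMulti_eq_zero_iff {k : ℕ} {u : Fin k → V} (hu : LinearIndependent ℂ u) (v : V) :
    ExteriorAlgebra.ι ℂ v * (exteriorPower.ιMulti ℂ k u : ExteriorAlgebra ℂ V) = 0 ↔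
      v ∈ Submodule.span ℂ (Set.range u) := by
  rw [ι_mul_ιMulti, ZeroMemClass.coe_eq_zero, ← not_iff_not]
  change _ ≠ _ ↔ _
  rw [ιMulti_ne_zero_iff, linearIndependent_finCons]
  simp [hu]

/-- The line `⋀ᵏ U` in `⋀ᵏ V`. -/
noncomputable def pluckerLine (k : ℕ) (U : Submodule ℂ V) : Submodule ℂ (⋀[ℂ]^k V) :=
  LinearMap.range (exteriorPower.map k U.subtype)

theorem exists_family_of_finrank [FiniteDimensional ℂ V] {k : ℕ} {U : Submodule ℂ V}
    (hU : Module.finrank ℂ U = k) :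
    ∃ u : Fin k → V, LinearIndependent ℂ u ∧ Submodule.span ℂ (Set.range u) = U := by
  let b := Module.finBasisOfFinrankEq ℂ U hU
  refine ⟨fun i => b i, b.linearIndependent.map' U.subtype (Submodule.ker_subtype U), ?_⟩
  have : Set.range (fun i => (b i : V)) = U.subtype '' Set.range b := by
    rw [← Set.range_comp]; rfl
  rw [this, ← Submodule.map_span, b.span_eq, Submodule.map_subtype_top]

theorem ιMulti_mem_pluckerLine {k : ℕ} {U : Submodule ℂ V} {u : Fin k → V} (hu : ∀ i, u i ∈ U) :
    exteriorPower.ιMulti ℂ k u ∈ pluckerLine k U :=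
  ⟨exteriorPower.ιMulti ℂ k fun i => ⟨u i, hu i⟩, by rw [exteriorPower.map_apply_ιMulti]; rfl⟩

theorem finrank_pluckerLine [FiniteDimensional ℂ V] {k : ℕ} {U : Submodule ℂ V}
    (hU : Module.finrank ℂ U = k) : Module.finrank ℂ (pluckerLine k U) = 1 := by
  rw [pluckerLine, LinearMap.finrank_range_of_inj
    (exteriorPower.map_injective_field U.injective_subtype), exteriorPower.finrank_eq, hU,
    Nat.choose_self]

theorem pluckerLine_eq_span [FiniteDimensional ℂ V] {k : ℕ} {U : Submodule ℂ V}
    (hU : Module.finrank ℂ U = k) {w : ⋀[ℂ]^k V} (hw : w ∈ pluckerLine k U) (h0 : w ≠ 0) :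
    pluckerLine k U = Submodule.span ℂ {w} := by
  refine (Submodule.eq_of_le_of_finrank_le ?_ ?_).symm
  · rwa [Submodule.span_singleton_le_iff_mem]
  · rw [finrank_pluckerLine hU, finrank_span_singleton h0]

/-- Recovers U from its Plücker vector, whence the injectivity of the Plücker embedding. -/
theorem ι_mul_eq_zero_iff [FiniteDimensional ℂ V] {k : ℕ} {U : Submodule ℂ V}
    (hU : Module.finrank ℂ U = k) {w : ⋀[ℂ]^k V} (hw : w ∈ pluckerLine k U) (h0 : w ≠ 0) (v : V) :
    ExteriorAlgebra.ι ℂ v * (w : ExteriorAlgebra ℂ V) = 0 ↔ v ∈ U := by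
  obtain ⟨u, hu, rfl⟩ := exists_family_of_finrank hU
  have h1 := ιMulti_mem_pluckerLine (U := Submodule.span ℂ (Set.range u)) (u := u)
    (fun i => Submodule.subset_span ⟨i, rfl⟩)
  rw [pluckerLine_eq_span hU h1 (ιMulti_ne_zero_iff.mpr hu), Submodule.mem_span_singleton] at hw
  obtain ⟨c, rfl⟩ := hw
  have hc : c ≠ 0 := by rintro rfl; simp at h0
  rw [Submodule.coe_smul, mul_smul_comm, smul_eq_zero, ι_mul_ιMulti_eq_zero_iff hu]
  simp [hc]

theorem eq_of_mem_pluckerLine [FiniteDimensional ℂ V] {k : ℕ} {U U' : Submodule ℂ V}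
    (hU : Module.finrank ℂ U = k) (hU' : Module.finrank ℂ U' = k) {w : ⋀[ℂ]^k V}
    (hw : w ∈ pluckerLine k U) (hw' : w ∈ pluckerLine k U') (h0 : w ≠ 0) : U = U' := by
  ext v
  rw [← ι_mul_eq_zero_iff hU hw h0, ι_mul_eq_zero_iff hU' hw' h0]

/-- For v ∈ U'' outside U the relation v ∧ (w + w') = 0 makes v ∧ w and v ∧ w' opposite and nonzero,
so U + ⟨v⟩ = U' + ⟨v⟩. This space of dimension k + 1 contains U + U'. -/
theorem finrank_inf_of_add_mem [FiniteDimensional ℂ V] {k : ℕ} {U U' U'' : Submodule ℂ V}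
    (hU : Module.finrank ℂ U = k) (hU' : Module.finrank ℂ U' = k) (hU'' : Module.finrank ℂ U'' = k)
    {w w' : ⋀[ℂ]^k V} (hw : w ∈ pluckerLine k U) (hw0 : w ≠ 0) (hw' : w' ∈ pluckerLine k U')
    (hw0' : w' ≠ 0) (hs : w + w' ∈ pluckerLine k U'') (hs0 : w + w' ≠ 0) :
    k ≤ Module.finrank ℂ (U ⊓ U' : Submodule ℂ V) + 1 := by
  by_cases hle : U'' ≤ U
  · have he : U'' = U := Submodule.eq_of_le_of_finrank_eq hle (hU''.trans hU.symm)
    subst he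
    have : w' ∈ pluckerLine k U'' := by
      have := Submodule.sub_mem _ hs hw
      rwa [add_sub_cancel_left] at this
    rw [eq_of_mem_pluckerLine hU' hU'' hw' this hw0', inf_idem, hU'']
    omega
  · obtain ⟨v, hv, hvU⟩ := SetLike.not_le_iff_exists.mp hle
    have h1 : ExteriorAlgebra.ι ℂ v * (w : ExteriorAlgebra ℂ V) ≠ 0 := fun h =>
      hvU ((ι_mul_eq_zero_iff hU hw hw0 v).mp h)
    have h2 := (ι_mul_eq_zero_iff hU'' hs hs0 v).mpr hv
    rw [Submodule.coe_add, mul_add] at h2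
    have key : ∀ {A : Submodule ℂ V} {x : ⋀[ℂ]^k V}, Module.finrank ℂ A = k → x ∈ pluckerLine k A →
        x ≠ 0 → ExteriorAlgebra.ι ℂ v * (x : ExteriorAlgebra ℂ V) ≠ 0 →
        Module.finrank ℂ (A ⊔ Submodule.span ℂ {v} : Submodule ℂ V) = k + 1 ∧
        ∃ y ∈ pluckerLine (k + 1) (A ⊔ Submodule.span ℂ {v}),
          (y : ExteriorAlgebra ℂ V) = ExteriorAlgebra.ι ℂ v * (x : ExteriorAlgebra ℂ V) := by
      intro A x hA hx hx0 hvx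
      obtain ⟨u, hu, rfl⟩ := exists_family_of_finrank hA
      have h1 := ιMulti_mem_pluckerLine (U := Submodule.span ℂ (Set.range u)) (u := u)
        (fun i => Submodule.subset_span ⟨i, rfl⟩)
      rw [pluckerLine_eq_span hA h1 (ιMulti_ne_zero_iff.mpr hu), Submodule.mem_span_singleton] at hx
      obtain ⟨c, rfl⟩ := hx
      have hl : LinearIndependent ℂ (Fin.cons v u : Fin (k + 1) → V) := by
        rw [← ιMulti_ne_zero_iff]
        intro h
        rw [Submodule.coe_smul, mul_smul_comm, ι_mul_ιMulti, h] at hvx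
        simp at hvx
      have hr : Submodule.span ℂ (Set.range (Fin.cons v u : Fin (k + 1) → V)) =
          Submodule.span ℂ (Set.range u) ⊔ Submodule.span ℂ {v} := by
        rw [Fin.range_cons, Submodule.span_insert, sup_comm]
      refine ⟨?_, c • exteriorPower.ιMulti ℂ (k + 1) (Fin.cons v u : Fin (k + 1) → V), ?_, ?_⟩
      · rw [← hr, finrank_span_eq_card hl, Fintype.card_fin]
      · rw [← hr]
        exact Submodule.smul_mem _ _
          (ιMulti_mem_pluckerLine fun i => Submodule.subset_span ⟨i, rfl⟩)
      · rw [Submodule.coe_smul, Submodule.coe_smul, mul_smul_comm, ι_mul_ιMulti]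
    have h3 : ExteriorAlgebra.ι ℂ v * (w' : ExteriorAlgebra ℂ V) =
        -(ExteriorAlgebra.ι ℂ v * (w : ExteriorAlgebra ℂ V)) := eq_neg_of_add_eq_zero_right h2
    have h4 : ExteriorAlgebra.ι ℂ v * (w' : ExteriorAlgebra ℂ V) ≠ 0 := by
      rw [h3]; exact neg_ne_zero.mpr h1
    obtain ⟨hd, y, hy, hyw⟩ := key hU hw hw0 h1
    obtain ⟨hd', y', hy', hyw'⟩ := key hU' hw' hw0' h4
    have h5 : y' = -y := Subtype.ext (by rw [Submodule.coe_neg, hyw', hyw, h3])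
    have h6 : U ⊔ Submodule.span ℂ {v} = U' ⊔ Submodule.span ℂ {v} :=
      eq_of_mem_pluckerLine hd hd' hy (by rw [h5] at hy'; simpa using hy') (by
        rintro rfl; exact h1 (by rw [← hyw]; rfl))
    have h7 : U ⊔ U' ≤ U ⊔ Submodule.span ℂ {v} :=
      sup_le le_sup_left (h6 ▸ le_sup_left)
    have h8 := Submodule.finrank_mono h7
    have h9 := Submodule.finrank_sup_add_finrank_inf_eq U U'
    omega

theorem map_pluckerLine {k : ℕ} (f : V →ₗ[ℂ] V) (U : Submodule ℂ V) :
    (pluckerLine k U).map (exteriorPower.map k f) = pluckerLine k (U.map f) := by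
  have h : f ∘ₗ U.subtype = (U.map f).subtype ∘ₗ (f.restrict (fun x hx => ⟨x, hx, rfl⟩) :
    U →ₗ[ℂ] U.map f) := rfl
  rw [pluckerLine, pluckerLine, ← LinearMap.range_comp, ← exteriorPower.map_comp, h,
    exteriorPower.map_comp, LinearMap.range_comp, LinearMap.range_eq_top.mpr, Submodule.map_top]
  apply exteriorPower.map_surjective
  rintro ⟨_, x, hx, rfl⟩
  exact ⟨⟨x, hx⟩, rfl⟩

end Exterior

/-! ### The isotropic Grassmannian as a closed set -/

section Isotropic

variable {V : Type*} [AddCommGroup V] [Module ℂ V] {k : ℕ} {ω : LinearMap.BilinForm ℂ V}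

theorem isotropic_span {σ : Type*} {u : σ → V} (h : ∀ i j, ω (u i) (u j) = 0) :
    ∀ x ∈ Submodule.span ℂ (Set.range u), ∀ y ∈ Submodule.span ℂ (Set.range u), ω x y = 0 := by
  intro x hx y hy
  induction hx using Submodule.span_induction with
  | mem x hx =>
    obtain ⟨i, rfl⟩ := hx
    induction hy using Submodule.span_induction with
    | mem y hy => obtain ⟨j, rfl⟩ := hy; exact h i j
    | zero => simp
    | add y z _ _ h1 h2 => rw [map_add, h1, h2, add_zero]
    | smul c y _ h1 => rw [map_smul, h1, smul_zero]
  | zero => simp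
  | add x z _ _ h1 h2 => rw [map_add, LinearMap.add_apply, h1, h2, add_zero]
  | smul c x _ h1 => rw [map_smul, LinearMap.smul_apply, h1, smul_zero]

theorem mem_isotropicGrassmannian_iff {p : ℙ ℂ (⋀[ℂ]^k V)} :
    p ∈ isotropicGrassmannian k ω ↔ ∃ U : Submodule ℂ V, Module.finrank ℂ U = k ∧
      (∀ u ∈ U, ∀ v ∈ U, ω u v = 0) ∧ p.submodule = pluckerLine k U := Iff.rfl

variable [FiniteDimensional ℂ V]

theorem mem_cone_isotropicGrassmannian_iff {w : ⋀[ℂ]^k V} :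
    w ∈ cone (isotropicGrassmannian k ω) ↔ w ≠ 0 ∧ ∃ U : Submodule ℂ V, Module.finrank ℂ U = k ∧
      (∀ u ∈ U, ∀ v ∈ U, ω u v = 0) ∧ w ∈ pluckerLine k U := by
  constructor
  · rintro ⟨h0, U, h1, h2, h3⟩
    exact ⟨h0, U, h1, h2, by rw [pluckerLine, ← h3]; exact mem_mk h0⟩
  · rintro ⟨h0, U, h1, h2, h3⟩
    refine ⟨h0, U, h1, h2, ?_⟩
    rw [submodule_eq_span (mem_mk h0) h0]
    exact (pluckerLine_eq_span h1 h3 h0).symm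

theorem ιMulti_mem_cone {u : Fin k → V} (hu : LinearIndependent ℂ u)
    (h : ∀ i j, ω (u i) (u j) = 0) :
    exteriorPower.ιMulti ℂ k u ∈ cone (isotropicGrassmannian k ω) :=
  mem_cone_isotropicGrassmannian_iff.mpr ⟨ιMulti_ne_zero_iff.mpr hu, _,
    by rw [finrank_span_eq_card hu, Fintype.card_fin], isotropic_span h,
    ιMulti_mem_pluckerLine fun i => Submodule.subset_span ⟨i, rfl⟩⟩

/-- The point of the projective space of `⋀ᵏ V` given by a `k`-dimensional subspace. -/
noncomputable def pluckerPoint (U : Submodule ℂ V) (hU : Module.finrank ℂ U = k) :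
    ℙ ℂ (⋀[ℂ]^k V) :=
  Projectivization.mk'' (pluckerLine k U) (finrank_pluckerLine hU)

theorem submodule_pluckerPoint (U : Submodule ℂ V) (hU : Module.finrank ℂ U = k) :
    (pluckerPoint U hU).submodule = pluckerLine k U := Projectivization.submodule_mk'' _ _

/-- Quadratic equations suffice: every contraction c of w must satisfy c ∧ w = 0, which makes w
decomposable, and contractions must be orthogonal to each other under ω. For w ∈ ⋀ᵏ U all
contractions lie in U. -/
theorem isClosed_isotropicGrassmannian :
    IsClosed (isotropicGrassmannian k ω) := by
  let B (φ : Fin k → Module.Dual ℂ V) (i : Fin k) :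
      ⋀[ℂ]^k V →ₗ[ℂ] ⋀[ℂ]^k V →ₗ[ℂ] ExteriorAlgebra ℂ V :=
    (LinearMap.mul ℂ (ExteriorAlgebra ℂ V)).compl₁₂ (ExteriorAlgebra.ι ℂ ∘ₗ contractExcept φ i)
      (⋀[ℂ]^k V).subtype
  let C (φ ψ : Fin k → Module.Dual ℂ V) (i j : Fin k) : ⋀[ℂ]^k V →ₗ[ℂ] ⋀[ℂ]^k V →ₗ[ℂ] ℂ :=
    ω.compl₁₂ (contractExcept φ i) (contractExcept ψ j)
  have hX : isotropicGrassmannian k ω =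
      (⋂ φ, ⋂ i, {p | ∀ w ∈ p.submodule, B φ i w w = 0}) ∩
      (⋂ φ, ⋂ ψ, ⋂ i, ⋂ j, {p | ∀ w ∈ p.submodule, C φ ψ i j w w = 0}) := by
    ext p
    simp only [Set.mem_inter_iff, Set.mem_iInter, Set.mem_ofPred_eq]
    constructor
    · rintro ⟨U, h1, h2, h3⟩
      have hU : ∀ φ i, ∀ w ∈ pluckerLine k U, contractExcept φ i w ∈ U := by
        intro φ i w hw
        rw [← Subspace.dualAnnihilator_dualCoannihilator_eq (W := U),
          Submodule.mem_dualCoannihilator]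
        intro ψ hψ
        obtain ⟨u, hu, hs⟩ := exists_family_of_finrank h1
        have hm : ∀ i, u i ∈ U := fun i => hs ▸ Submodule.subset_span ⟨i, rfl⟩
        rw [pluckerLine_eq_span h1 (ιMulti_mem_pluckerLine hm) (ιMulti_ne_zero_iff.mpr hu),
          Submodule.mem_span_singleton] at hw
        obtain ⟨c, rfl⟩ := hw
        rw [map_smul, map_smul, apply_contractExcept, exteriorCoord_ιMulti,
          Matrix.det_eq_zero_of_column_eq_zero i, smul_zero]
        intro j
        simpa using (Submodule.mem_dualAnnihilator _).mp hψ _ (hm j)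
      refine ⟨fun φ i w hw => ?_, fun φ ψ i j w hw => ?_⟩
      · rw [h3] at hw
        by_cases h0 : w = 0
        · simp [h0]
        exact (ι_mul_eq_zero_iff h1 hw h0 _).mpr (hU φ i w hw)
      · rw [h3] at hw
        exact h2 _ (hU φ i w hw) _ (hU ψ j w hw)
    · rintro ⟨h1, h2⟩
      have h0 := p.rep_nonzero
      have hw := rep_mem p
      -- With a nonzero coordinate at hand, the k contractions along φ are independent and span the
      -- subspace represented by the point.
      obtain ⟨φ, hφ⟩ := exists_exteriorCoord_ne_zero h0
      set c : Fin k → V := fun i => contractExcept φ i p.rep with hc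
      have hcl : LinearIndependent ℂ c := linearIndependent_contractExcept hφ
      obtain ⟨χ, hχ⟩ := exists_dual_family hcl
      obtain ⟨γ, hγ⟩ := eq_smul_ιMulti_of_ι_mul_eq_zero hχ p.rep.2 (fun i => h1 φ i _ hw)
      have hγ' : p.rep = γ • exteriorPower.ιMulti ℂ k c := Subtype.ext (by
        rw [hγ, Submodule.coe_smul, exteriorPower.ιMulti_apply_coe])
      have hγ0 : γ ≠ 0 := by rintro rfl; rw [zero_smul] at hγ'; exact h0 hγ'
      rw [← mem_cone_iff hw h0, hγ', smul_mem_cone_iff hγ0]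
      exact ιMulti_mem_cone hcl fun i j => h2 φ φ i j _ hw
  rw [hX]
  refine IsClosed.inter ?_ ?_
  · exact isClosed_iInter fun φ => isClosed_iInter fun i =>
      isClosed_zeros (IsHomogeneousPolyMap.of_bilinear (B φ i))
  · exact isClosed_iInter fun φ => isClosed_iInter fun ψ => isClosed_iInter fun i =>
      isClosed_iInter fun j => isClosed_zeros (IsHomogeneousPolyMap.of_bilinear (C φ ψ i j))

/-- The points of the isotropic Grassmannian given by the subspaces which contain `e`. -/
def isotropicThrough (k : ℕ) (ω : LinearMap.BilinForm ℂ V) (e : V) : Set (ℙ ℂ (⋀[ℂ]^k V)) :=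
  {p | ∃ U : Submodule ℂ V, Module.finrank ℂ U = k ∧ (∀ u ∈ U, ∀ v ∈ U, ω u v = 0) ∧
    p.submodule = pluckerLine k U ∧ e ∈ U}

theorem eq_of_submodule_eq_pluckerLine {U U' : Submodule ℂ V} (hU : Module.finrank ℂ U = k)
    (hU' : Module.finrank ℂ U' = k) (h : pluckerLine k U = pluckerLine k U') : U = U' := by
  have h1 := finrank_pluckerLine hU
  obtain ⟨w, hw, h0⟩ := (pluckerLine k U).ne_bot_iff.mp (by rintro h'; rw [h', finrank_bot] at h1; omega)
  exact eq_of_mem_pluckerLine hU hU' hw (h ▸ hw) h0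

theorem isotropicThrough_subset (e : V) :
    isotropicThrough k ω e ⊆ isotropicGrassmannian k ω :=
  fun _ ⟨U, h1, h2, h3, _⟩ => ⟨U, h1, h2, h3⟩

theorem mem_isotropicThrough_iff {p : ℙ ℂ (⋀[ℂ]^k V)} {U : Submodule ℂ V} {e : V}
    (hU : Module.finrank ℂ U = k) (hiso : ∀ u ∈ U, ∀ v ∈ U, ω u v = 0)
    (hp : p.submodule = pluckerLine k U) : p ∈ isotropicThrough k ω e ↔ e ∈ U := by
  refine ⟨fun ⟨U', h1, _, h3, h4⟩ => ?_, fun h => ⟨U, hU, hiso, hp, h⟩⟩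
  rwa [eq_of_submodule_eq_pluckerLine hU h1 (hp.symm.trans h3)]

theorem isClosed_isotropicThrough (e : V) : IsClosed (isotropicThrough k ω e) := by
  have h : isotropicThrough k ω e = isotropicGrassmannian k ω ∩ {p | ∀ w ∈ p.submodule,
      (LinearMap.mulLeft ℂ (ExteriorAlgebra.ι ℂ e) ∘ₗ (⋀[ℂ]^k V).subtype) w = 0} := by
    ext p
    constructor
    · rintro ⟨U, h1, h2, h3, h4⟩
      refine ⟨⟨U, h1, h2, h3⟩, fun w hw => ?_⟩
      by_cases h0 : w = 0
      · simp [h0]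
      exact (ι_mul_eq_zero_iff h1 (h3 ▸ hw) h0 e).mpr h4
    · rintro ⟨⟨U, h1, h2, h3⟩, h4⟩
      refine ⟨U, h1, h2, h3, ?_⟩
      have h5 : p.rep ∈ pluckerLine k U := by rw [pluckerLine, ← h3]; exact rep_mem p
      exact (ι_mul_eq_zero_iff h1 h5 p.rep_nonzero e).mp
        (h4 _ (rep_mem p))
  rw [h]
  exact isClosed_isotropicGrassmannian.inter (isClosed_zeros (IsHomogeneousPolyMap.of_linearMap _))

end Isotropic

/-! ### The subspaces containing a given A as one of their hyperplanes -/

section Star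

variable {V : Type*} [AddCommGroup V] [Module ℂ V] {n : ℕ}

/-- The linear map `b ↦ b ∧ a₁ ∧ ⋯ ∧ aₙ`. -/
noncomputable def star (a : Fin n → V) : V →ₗ[ℂ] ⋀[ℂ]^(n + 1) V where
  toFun b := exteriorPower.ιMulti ℂ (n + 1) (Fin.cons b a : Fin (n + 1) → V)
  map_add' b b' := by
    have := (exteriorPower.ιMulti ℂ (n + 1) (M := V)).toMultilinearMap.cons_add a b b'
    exact this
  map_smul' c b := by
    have := (exteriorPower.ιMulti ℂ (n + 1) (M := V)).toMultilinearMap.cons_smul a c b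
    exact this

theorem star_apply (a : Fin n → V) (b : V) :
    star a b = exteriorPower.ιMulti ℂ (n + 1) (Fin.cons b a : Fin (n + 1) → V) := rfl

theorem star_ne_zero_iff {a : Fin n → V} (ha : LinearIndependent ℂ a) {b : V} :
    star a b ≠ 0 ↔ b ∉ Submodule.span ℂ (Set.range a) := by
  rw [star_apply, ιMulti_ne_zero_iff, linearIndependent_finCons]
  simp [ha]

theorem ker_star {a : Fin n → V} (ha : LinearIndependent ℂ a) :
    LinearMap.ker (star a) = Submodule.span ℂ (Set.range a) := by
  ext b
  rw [LinearMap.mem_ker, ← not_iff_not]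
  exact star_ne_zero_iff ha

theorem star_mem_pluckerLine (a : Fin n → V) (b : V) :
    star a b ∈ pluckerLine (n + 1) (Submodule.span ℂ (Set.range a) ⊔ Submodule.span ℂ {b}) := by
  refine ιMulti_mem_pluckerLine fun i => ?_
  refine Fin.cases ?_ (fun i => ?_) i
  · exact Submodule.mem_sup_right (Submodule.mem_span_singleton_self b)
  · exact Submodule.mem_sup_left (Submodule.subset_span ⟨i, rfl⟩)

theorem finrank_sup_span_singleton [FiniteDimensional ℂ V] {A : Submodule ℂ V} {b : V}
    (hb : b ∉ A) :
    Module.finrank ℂ (A ⊔ Submodule.span ℂ {b} : Submodule ℂ V) = Module.finrank ℂ A + 1 := by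
  have h := Submodule.finrank_sup_add_finrank_inf_eq A (Submodule.span ℂ {b})
  have hb0 : b ≠ 0 := by rintro rfl; exact hb A.zero_mem
  rw [finrank_span_singleton hb0] at h
  have hd : A ⊓ Submodule.span ℂ {b} = ⊥ := by
    rw [eq_bot_iff]
    rintro x ⟨hx, hx'⟩
    obtain ⟨c, rfl⟩ := Submodule.mem_span_singleton.mp hx'
    by_cases hc : c = 0
    · simp [hc]
    · exact absurd ((A.smul_mem_iff hc).mp hx) hb
  rw [hd, finrank_bot] at h
  omega

theorem exists_eq_sup_span_singleton [FiniteDimensional ℂ V] {A U : Submodule ℂ V} (h : A ≤ U)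
    (hd : Module.finrank ℂ U = Module.finrank ℂ A + 1) :
    ∃ b, b ∉ A ∧ b ∈ U ∧ U = A ⊔ Submodule.span ℂ {b} := by
  obtain ⟨b, hb, hbA⟩ := SetLike.exists_of_lt (lt_of_le_of_ne h (by rintro rfl; omega))
  refine ⟨b, hbA, hb, (Submodule.eq_of_le_of_finrank_le ?_ ?_).symm⟩
  · exact sup_le h (by rwa [Submodule.span_singleton_le_iff_mem])
  · rw [hd, finrank_sup_span_singleton hbA]

theorem pluckerLine_sup_span_singleton [FiniteDimensional ℂ V] {a : Fin n → V}
    (ha : LinearIndependent ℂ a) {b : V} (hb : b ∉ Submodule.span ℂ (Set.range a)) :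
    pluckerLine (n + 1) (Submodule.span ℂ (Set.range a) ⊔ Submodule.span ℂ {b}) =
      Submodule.span ℂ {star a b} :=
  pluckerLine_eq_span (by rw [finrank_sup_span_singleton hb, finrank_span_eq_card ha,
    Fintype.card_fin]) (star_mem_pluckerLine a b) ((star_ne_zero_iff ha).mpr hb)

end Star

/-! ### Tangent vectors of the Grassmannian -/

section TangentMap

variable {V : Type*} [AddCommGroup V] [Module ℂ V] {k : ℕ} (u : Fin k → V)

/-- The derivative of `u ↦ u₁ ∧ ⋯ ∧ uₖ` in the direction `(v₁ b, …, vₖ b)`. -/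
noncomputable def substDeriv : (Fin k → ℂ) →ₗ[ℂ] V →ₗ[ℂ] ⋀[ℂ]^k V :=
  ∑ i, (LinearMap.proj i : (Fin k → ℂ) →ₗ[ℂ] ℂ).smulRight
    ((exteriorPower.ιMulti ℂ k (M := V)).toMultilinearMap.toLinearMap u i)

theorem substDeriv_apply (v : Fin k → ℂ) (b : V) :
    substDeriv u v b = ∑ i, v i • exteriorPower.ιMulti ℂ k (Function.update u i b) := by
  simp [substDeriv]

/-- Terms of order at least 2 contain b twice and vanish. Hence moving all u_i along one vector b
traces a line in the Plücker space. -/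
theorem ιMulti_add_smul (v : Fin k → ℂ) (b : V) (t : ℂ) :
    exteriorPower.ιMulti ℂ k (fun i => u i + (t * v i) • b) =
      exteriorPower.ιMulti ℂ k u + t • substDeriv u v b := by
  have h := (exteriorPower.ιMulti ℂ k (M := V)).toMultilinearMap.map_add_eq_map_add_linearDeriv_add
    u (fun i => (t * v i) • b)
  have hz : ∑ s : Finset (Fin k) with 2 ≤ s.card, (exteriorPower.ιMulti ℂ k (M := V)).toMultilinearMap
      (s.piecewise (fun i => (t * v i) • b) u) = 0 := by
    refine Finset.sum_eq_zero fun s hs => ?_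
    obtain ⟨i, hi, j, hj, hij⟩ := Finset.one_lt_card.mp (Finset.mem_filter.mp hs).2
    by_contra h0
    have hl : LinearIndependent ℂ (s.piecewise (fun i => (t * v i) • b) u) :=
      ιMulti_ne_zero_iff.mp h0
    obtain ⟨φ, hφ⟩ := exists_dual_family hl
    have h1 := hφ j i
    have h2 := hφ j j
    rw [if_neg hij.symm, Finset.piecewise_eq_of_mem _ _ _ hi, map_smul, smul_eq_mul] at h1
    rw [if_pos rfl, Finset.piecewise_eq_of_mem _ _ _ hj, map_smul, smul_eq_mul] at h2
    have h3 := hφ i i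
    rw [if_pos rfl, Finset.piecewise_eq_of_mem _ _ _ hi, map_smul, smul_eq_mul] at h3
    rcases mul_eq_zero.mp h1 with h4 | h4
    · rw [h4, zero_mul] at h3; exact zero_ne_one h3
    · rw [h4, mul_zero] at h2; exact zero_ne_one h2
  rw [hz, add_zero, MultilinearMap.linearDeriv_apply] at h
  refine h.trans ?_
  rw [substDeriv_apply, Finset.smul_sum]
  congr 1
  refine Finset.sum_congr rfl fun i _ => ?_
  rw [MultilinearMap.map_update_smul, mul_smul]
  rfl

theorem substDeriv_self (v : Fin k → ℂ) (j : Fin k) :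
    substDeriv u v (u j) = v j • exteriorPower.ιMulti ℂ k u := by
  rw [substDeriv_apply, Finset.sum_eq_single j]
  · rw [Function.update_eq_self]
  · intro i _ hij
    rw [AlternatingMap.map_update_self _ _ hij, smul_zero]
  · simp

theorem substDeriv_mem_span (v : Fin k → ℂ) {b : V} (hb : b ∈ Submodule.span ℂ (Set.range u)) :
    substDeriv u v b ∈ Submodule.span ℂ {exteriorPower.ιMulti ℂ k u} := by
  induction hb using Submodule.span_induction with
  | mem b hb =>
    obtain ⟨j, rfl⟩ := hb
    rw [substDeriv_self]
    exact Submodule.smul_mem _ _ (Submodule.mem_span_singleton_self _)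
  | zero => simp
  | add x y _ _ hx hy => rw [map_add]; exact Submodule.add_mem _ hx hy
  | smul c x _ hx => rw [map_smul]; exact Submodule.smul_mem _ _ hx

/-- Only the i-th summand survives, and its matrix is the identity with one row replaced. These
coordinates read off the tensor v ⊗ b from its image. -/
theorem exteriorCoord_update_substDeriv {φ : Fin k → Module.Dual ℂ V}
    (hφ : ∀ i j, φ i (u j) = if i = j then 1 else 0) {ψ : Module.Dual ℂ V} (hψ : ∀ j, ψ (u j) = 0)
    (i : Fin k) (v : Fin k → ℂ) (b : V) :
    exteriorCoord (Function.update φ i ψ) (substDeriv u v b) = v i * ψ b := by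
  rw [substDeriv_apply, map_sum, Finset.sum_eq_single i]
  · rw [map_smul, exteriorCoord_ιMulti, smul_eq_mul]
    congr 1
    have hM : (Matrix.of fun l m => Function.update φ i ψ m (Function.update u i b l)) =
        Matrix.updateRow 1 i (fun m => Function.update φ i ψ m b) := by
      ext l m
      by_cases hl : l = i
      · subst hl; simp
      · by_cases hm : m = i
        · subst hm; simp [hl, hψ]
        · simp [hl, hm, hφ, Matrix.one_apply, eq_comm]
    rw [hM, ← Matrix.det_transpose, ← Matrix.updateCol_transpose, Matrix.transpose_one,
      ← Matrix.cramer_apply, Matrix.cramer_one]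
    simp
  · intro j _ hji
    rw [map_smul, exteriorCoord_ιMulti, Matrix.det_eq_zero_of_row_eq_zero i, smul_zero]
    intro m
    by_cases hm : m = i
    · subst hm; simp [hji.symm, hψ]
    · simp [hm, hji.symm, hφ]
  · simp

theorem exteriorCoord_update_ιMulti {φ : Fin k → Module.Dual ℂ V} {ψ : Module.Dual ℂ V}
    (hψ : ∀ j, ψ (u j) = 0) (i : Fin k) :
    exteriorCoord (Function.update φ i ψ) (exteriorPower.ιMulti ℂ k u) = 0 := by
  rw [exteriorCoord_ιMulti, Matrix.det_eq_zero_of_column_eq_zero i]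
  simp [hψ]

/-- The tangent space of the Grassmannian: the map from `U ⊗ (V / U)` to `⋀ᵏ V / ⋀ᵏ U`, where `U`
has the basis `u`. -/
noncomputable def tangentMap {p : ℙ ℂ (⋀[ℂ]^k V)} (hp : exteriorPower.ιMulti ℂ k u ∈ p.submodule) :
    (Fin k → ℂ) ⊗[ℂ] (V ⧸ Submodule.span ℂ (Set.range u)) →ₗ[ℂ] (⋀[ℂ]^k V) ⧸ p.submodule :=
  TensorProduct.lift (Submodule.liftQ _ ((substDeriv u).compr₂ p.submodule.mkQ).flip (by
    intro b hb
    rw [LinearMap.mem_ker]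
    refine LinearMap.ext fun v => (Submodule.Quotient.mk_eq_zero _).mpr ?_
    exact (Submodule.span_singleton_le_iff_mem _ _).mpr hp (substDeriv_mem_span u v hb))).flip

variable {u}

theorem tangentMap_tmul {p : ℙ ℂ (⋀[ℂ]^k V)} (hp : exteriorPower.ιMulti ℂ k u ∈ p.submodule)
    (v : Fin k → ℂ) (b : V) :
    tangentMap u hp (v ⊗ₜ Submodule.Quotient.mk b) = Submodule.Quotient.mk (substDeriv u v b) := rfl

theorem eq_sum_tmul_contractFst {N : Type*} [AddCommGroup N] [Module ℂ N]
    (t : (Fin k → ℂ) ⊗[ℂ] N) :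
    t = ∑ i, Pi.single i (1 : ℂ) ⊗ₜ[ℂ] contractFst (LinearMap.proj i) t := by
  induction t with
  | zero => simp
  | tmul v b =>
    simp only [contractFst_tmul, LinearMap.proj_apply, TensorProduct.tmul_smul,
      TensorProduct.smul_tmul', ← TensorProduct.sum_tmul]
    congr 1
    ext j
    simp [Pi.single_apply]
  | add x y hx hy =>
    simp only [map_add, TensorProduct.tmul_add, Finset.sum_add_distrib]
    rw [← hx, ← hy]

/-- For a functional ψ on V / U, replacing φ_i by ψ gives a coordinate that kills ⋀ᵏ U and so
descends to the quotient. It evaluates to ψ of the i-th component of the tensor. -/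
theorem injective_tangentMap (hu : LinearIndependent ℂ u) {p : ℙ ℂ (⋀[ℂ]^k V)}
    (hp : exteriorPower.ιMulti ℂ k u ∈ p.submodule) : Function.Injective (tangentMap u hp) := by
  rw [injective_iff_map_eq_zero]
  intro t ht
  obtain ⟨φ, hφ⟩ := exists_dual_family hu
  rw [eq_sum_tmul_contractFst t]
  refine Finset.sum_eq_zero fun i _ => ?_
  suffices h : contractFst (LinearMap.proj i) t = 0 by rw [h, TensorProduct.tmul_zero]
  rw [← Module.forall_dual_apply_eq_zero_iff ℂ]
  intro ψ
  have hψ : ∀ j, (ψ ∘ₗ (Submodule.span ℂ (Set.range u)).mkQ) (u j) = 0 := fun j => by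
    rw [LinearMap.comp_apply, Submodule.mkQ_apply,
      (Submodule.Quotient.mk_eq_zero (Submodule.span ℂ (Set.range u))).mpr
        (Submodule.subset_span ⟨j, rfl⟩), map_zero]
  let F : Module.Dual ℂ ((⋀[ℂ]^k V) ⧸ p.submodule) :=
    p.submodule.liftQ (exteriorCoord (Function.update φ i (ψ ∘ₗ (Submodule.span ℂ (Set.range u)).mkQ))) (by
      rw [submodule_eq_span hp (ιMulti_ne_zero_iff.mpr hu), Submodule.span_singleton_le_iff_mem]
      exact exteriorCoord_update_ιMulti u hψ i)
  have hF : F ∘ₗ tangentMap u hp = ψ ∘ₗ contractFst (LinearMap.proj i) := by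
    refine TensorProduct.ext' fun v b => ?_
    obtain ⟨b, rfl⟩ := Submodule.Quotient.mk_surjective _ b
    rw [LinearMap.comp_apply, LinearMap.comp_apply, tangentMap_tmul, contractFst_tmul, map_smul]
    exact exteriorCoord_update_substDeriv u hφ hψ i v b
  have := LinearMap.congr_fun hF t
  rw [LinearMap.comp_apply, ht, map_zero] at this
  exact this.symm

end TangentMap

/-! ### Lines through a point of the isotropic Grassmannian -/

section Vmrt

variable {V : Type*} [AddCommGroup V] [Module ℂ V] {n : ℕ} {ω : LinearMap.BilinForm ℂ V}

/-- The map `V / U → U*` given by the form `ω`, in terms of a basis of the isotropic space `U`. -/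
noncomputable def pairingMap {u : Fin n → V} (hu : ∀ i j, ω (u i) (u j) = 0) :
    (V ⧸ Submodule.span ℂ (Set.range u)) →ₗ[ℂ] (Fin n → ℂ) :=
  Submodule.liftQ _ (LinearMap.pi fun i => ω (u i)) (by
    rw [Submodule.span_le]
    rintro _ ⟨j, rfl⟩
    ext i
    exact hu i j)

theorem pairingMap_mk {u : Fin n → V} (hu : ∀ i j, ω (u i) (u j) = 0) (b : V) (i : Fin n) :
    pairingMap hu (Submodule.Quotient.mk b) i = ω (u i) b := rfl

theorem exists_functional_of_hyperplane [FiniteDimensional ℂ V] {u : Fin (n + 1) → V}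
    (hu : LinearIndependent ℂ u) {A : Submodule ℂ V} (hd : Module.finrank ℂ A = n) :
    ∃ f : Module.Dual ℂ V, (∀ a ∈ A, f a = 0) ∧ ∃ i, f (u i) ≠ 0 := by
  have hd' : Module.finrank ℂ (Submodule.span ℂ (Set.range u)) = Module.finrank ℂ A + 1 := by
    rw [finrank_span_eq_card hu, Fintype.card_fin, hd]
  have hlt : ¬ Submodule.span ℂ (Set.range u) ≤ A := fun h => by
    have := Submodule.finrank_mono h
    omega
  rw [Submodule.span_le] at hlt
  obtain ⟨_, ⟨i, rfl⟩, hi⟩ := Set.not_subset.mp hlt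
  obtain ⟨f, hf, hfA⟩ := Submodule.exists_le_ker_of_notMem hi
  exact ⟨f, fun a ha => hfA ha, i, hf⟩

/-- A line in the Grassmannian joins U to some U' meeting it in a hyperplane A of U. It is the
direction v ⊗ b with b ∈ U' \ U and v a functional on U with kernel A. Isotropy along the line
amounts to β(b) ∧ v = 0. -/
theorem vmrt_isotropicGrassmannian [FiniteDimensional ℂ V] (hω : ω.IsAlt) {u : Fin (n + 1) → V}
    (hu : LinearIndependent ℂ u) (hiso : ∀ i j, ω (u i) (u j) = 0) {x : ℙ ℂ (⋀[ℂ]^(n + 1) V)}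
    (hx : exteriorPower.ιMulti ℂ (n + 1) u ∈ x.submodule) :
    vmrt (isotropicGrassmannian (n + 1) ω) x = rankOneLocus (tangentMap u hx) (pairingMap hiso) := by
  have hu0 := ιMulti_ne_zero_iff.mpr hu
  have hinj := injective_tangentMap hu hx
  ext q
  constructor
  · intro hq
    obtain ⟨y, hy⟩ := Submodule.Quotient.mk_surjective _ q.rep
    have hyx : y ∉ x.submodule := fun h => q.rep_nonzero (by
      rw [← hy]; exact (Submodule.Quotient.mk_eq_zero _).mpr h)
    have hyq : y ∈ q.submodule.comap x.submodule.mkQ := by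
      change Submodule.Quotient.mk y ∈ q.submodule
      rw [hy]; exact rep_mem q
    have hxq : x.submodule ≤ q.submodule.comap x.submodule.mkQ := by
      intro v hv
      change Submodule.Quotient.mk v ∈ q.submodule
      rw [(Submodule.Quotient.mk_eq_zero _).mpr hv]; exact Submodule.zero_mem _
    have hcone : ∀ v ∈ q.submodule.comap x.submodule.mkQ, v ≠ 0 →
        v ∈ cone (isotropicGrassmannian (n + 1) ω) := fun v hv h0 => by
      rw [mem_cone_iff (mem_mk h0) h0]
      refine hq _ ?_
      rwa [submodule_eq_span (mem_mk h0) h0, Submodule.span_singleton_le_iff_mem]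
    have hy0 : y ≠ 0 := by rintro rfl; exact hyx (Submodule.zero_mem _)
    have hs0 : exteriorPower.ιMulti ℂ (n + 1) u + y ≠ 0 := fun h => hyx (by
      rw [eq_neg_of_add_eq_zero_right h]; exact Submodule.neg_mem _ hx)
    obtain ⟨-, U', hU', hiso', hyU'⟩ := mem_cone_isotropicGrassmannian_iff.mp (hcone y hyq hy0)
    obtain ⟨-, U'', hU'', -, hsU''⟩ := mem_cone_isotropicGrassmannian_iff.mp
      (hcone _ (Submodule.add_mem _ (hxq hx) hyq) hs0)
    set U := Submodule.span ℂ (Set.range u) with hUdef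
    have hU : Module.finrank ℂ U = n + 1 := by rw [finrank_span_eq_card hu, Fintype.card_fin]
    have huU : ∀ i, u i ∈ U := fun i => Submodule.subset_span ⟨i, rfl⟩
    have hxU : x.submodule = pluckerLine (n + 1) U := by
      rw [pluckerLine_eq_span hU (ιMulti_mem_pluckerLine huU) hu0, submodule_eq_span hx hu0]
    have hne : U ≠ U' := by
      intro h
      rw [hxU, h] at hyx
      exact hyx hyU'
    -- Two points of the line and their sum are decomposable, which forces U and U' to meet in
    -- dimension n.
    have hinf := finrank_inf_of_add_mem hU hU' hU'' (ιMulti_mem_pluckerLine huU) hu0 hyU' hy0 hsU'' hs0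
    have hA : Module.finrank ℂ (U ⊓ U' : Submodule ℂ V) = n := by
      have h1 : Module.finrank ℂ (U ⊓ U' : Submodule ℂ V) < Module.finrank ℂ U := by
        refine Submodule.finrank_lt_finrank_of_lt (lt_of_le_of_ne inf_le_left fun h => hne ?_)
        exact Submodule.eq_of_le_of_finrank_eq (inf_eq_left.mp h) (hU.trans hU'.symm)
      omega
    obtain ⟨a, ha, haA⟩ := exists_family_of_finrank hA
    obtain ⟨b₀, hb₀A, hb₀U, hb₀⟩ := exists_eq_sup_span_singleton (A := U ⊓ U') (U := U) inf_le_left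
      (by rw [hU, hA])
    obtain ⟨b, hbA, hbU', hb⟩ := exists_eq_sup_span_singleton (A := U ⊓ U') (U := U') inf_le_right
      (by rw [hU', hA])
    have hbU : b ∉ U := fun h => hbA ⟨h, hbU'⟩
    -- The vector v of the pure tensor consists of the values f(u_i), where f vanishes on U ⊓ U' but
    -- not on U.
    obtain ⟨f, hfA, i₀, hi₀⟩ := exists_functional_of_hyperplane hu hA
    have hfb₀ : f b₀ ≠ 0 := by
      intro h
      apply hi₀
      have h1 := huU i₀
      rw [hb₀, Submodule.mem_sup] at h1
      obtain ⟨c, hc, d, hd, h1⟩ := h1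
      obtain ⟨r, rfl⟩ := Submodule.mem_span_singleton.mp hd
      rw [← h1, map_add, map_smul, h, hfA c hc, smul_zero, add_zero]
    set v : Fin (n + 1) → ℂ := fun i => f (u i) with hv
    have hv0 : v ≠ 0 := fun h => hi₀ (congrFun h i₀)
    have hmk0 : (Submodule.Quotient.mk b : V ⧸ U) ≠ 0 := fun h =>
      hbU ((Submodule.Quotient.mk_eq_zero _).mp h)
    refine ⟨v, Submodule.Quotient.mk b, hv0, hmk0, ?_, ?_⟩
    -- On U both f and ω(·, b) vanish on U ⊓ U', the latter because U' is isotropic. Comparing them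
    -- at b₀ gives the factor.
    · refine Submodule.mem_span_singleton.mpr ⟨(f b₀)⁻¹ * ω b₀ b, ?_⟩
      ext i
      rw [pairingMap_mk]
      have h1 := huU i
      rw [hb₀, Submodule.mem_sup] at h1
      obtain ⟨c, hc, d, hd, h1⟩ := h1
      obtain ⟨r, rfl⟩ := Submodule.mem_span_singleton.mp hd
      have h2 : ω c b = 0 := hiso' _ hc.2 _ hbU'
      simp only [Pi.smul_apply, smul_eq_mul, hv]
      rw [← h1, map_add, map_smul, hfA c hc, map_add, LinearMap.add_apply, h2, map_smul,
        LinearMap.smul_apply]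
      simp only [smul_eq_mul]
      field_simp
      ring
    · rw [tangentMap_tmul]
      change substDeriv u v b ∈ q.submodule.comap x.submodule.mkQ
      -- At t = 1 the vectors u_i + f(u_i) b lie in (U ⊓ U') + ⟨b₀ + f(b₀) b⟩, whose Plücker line is
      -- spanned by `star a b₀ + f b₀ • star a b`. This vector is in the plane of the given line.
      have h1 := ιMulti_add_smul u v b 1
      rw [one_smul] at h1
      have h2 : substDeriv u v b = exteriorPower.ιMulti ℂ (n + 1) (fun i => u i + (1 * v i) • b) -
          exteriorPower.ιMulti ℂ (n + 1) u := by rw [h1, add_sub_cancel_left]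
      rw [h2]
      refine Submodule.sub_mem _ ?_ (hxq hx)
      have hb₀' : b₀ ∉ Submodule.span ℂ (Set.range a) := by rwa [haA]
      have hb' : b ∉ Submodule.span ℂ (Set.range a) := by rwa [haA]
      have hq₀ : star a b₀ ∈ q.submodule.comap x.submodule.mkQ := by
        apply hxq
        rw [hxU, hb₀, ← haA]
        exact star_mem_pluckerLine a b₀
      have hq₁ : star a b ∈ q.submodule.comap x.submodule.mkQ := by
        have h3 : star a b ∈ pluckerLine (n + 1) U' := by
          rw [hb, ← haA]
          exact star_mem_pluckerLine a b
        rw [pluckerLine_eq_span hU' hyU' hy0, Submodule.mem_span_singleton] at h3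
        obtain ⟨c, hc⟩ := h3
        rw [← hc]
        exact Submodule.smul_mem _ _ hyq
      have hc₀ : b₀ + f b₀ • b ∉ Submodule.span ℂ (Set.range a) := by
        rw [haA]
        intro h
        have h3 : f b₀ • b ∈ U := by
          have := U.sub_mem h.1 hb₀U
          rwa [add_sub_cancel_left] at this
        exact hbU ((U.smul_mem_iff hfb₀).mp h3)
      have h4 : exteriorPower.ιMulti ℂ (n + 1) (fun i => u i + (1 * v i) • b) ∈
          pluckerLine (n + 1) (Submodule.span ℂ (Set.range a) ⊔
            Submodule.span ℂ {b₀ + f b₀ • b}) := by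
        refine ιMulti_mem_pluckerLine fun i => ?_
        rw [haA]
        have h1 := huU i
        rw [hb₀, Submodule.mem_sup] at h1
        obtain ⟨c, hc, d, hd, h1⟩ := h1
        obtain ⟨r, rfl⟩ := Submodule.mem_span_singleton.mp hd
        refine Submodule.mem_sup.mpr ⟨c, hc, r • (b₀ + f b₀ • b),
          Submodule.smul_mem _ _ (Submodule.mem_span_singleton_self _), ?_⟩
        rw [one_mul, hv]
        simp only
        rw [← h1, map_add, map_smul, hfA c hc, zero_add, smul_add, smul_eq_mul, mul_smul, add_assoc]
      rw [pluckerLine_sup_span_singleton ha hc₀, Submodule.mem_span_singleton] at h4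
      obtain ⟨r, hr⟩ := h4
      rw [← hr, map_add, map_smul]
      exact Submodule.smul_mem _ _ (Submodule.add_mem _ hq₀ (Submodule.smul_mem _ _ hq₁))
  · rintro ⟨v, b, hv, hb, hβ, hq⟩ p hp
    obtain ⟨b, rfl⟩ := Submodule.Quotient.mk_surjective _ b
    obtain ⟨c, hc⟩ := Submodule.mem_span_singleton.mp hβ
    have hc' : ∀ i, ω (u i) b = c * v i := fun i => by
      rw [← pairingMap_mk hiso, ← hc]; rfl
    have hne := apply_tmul_ne_zero hinj hv hb
    rw [tangentMap_tmul] at hq hne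
    have hθ : substDeriv u v b ∉ x.submodule := fun h =>
      hne ((Submodule.Quotient.mk_eq_zero _).mpr h)
    have hline : ∀ t : ℂ, exteriorPower.ιMulti ℂ (n + 1) u + t • substDeriv u v b ∈
        cone (isotropicGrassmannian (n + 1) ω) := by
      intro t
      have h0 : exteriorPower.ιMulti ℂ (n + 1) u + t • substDeriv u v b ≠ 0 := by
        intro h
        by_cases ht : t = 0
        · rw [ht, zero_smul, add_zero] at h; exact hu0 h
        · refine hθ ((Submodule.smul_mem_iff _ ht).mp ?_)
          rw [eq_neg_of_add_eq_zero_right h]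
          exact Submodule.neg_mem _ hx
      rw [← ιMulti_add_smul] at h0 ⊢
      refine ιMulti_mem_cone (ιMulti_ne_zero_iff.mp h0) fun i j => ?_
      -- The terms of first order in t are c v_i v_j - c v_i v_j, and the quadratic one contains
      -- ω(b, b) = 0.
      have hbu : ω b (u j) = -(c * v j) := by rw [← hc', hω.neg_eq b (u j) |>.symm, neg_neg]
      simp only [map_add, map_smul, LinearMap.add_apply, LinearMap.smul_apply, hiso, hc', hbu,
        hω.self_eq_zero b, smul_eq_mul]
      ring
    rw [← mem_cone_iff (rep_mem p) p.rep_nonzero]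
    have hpr : Submodule.Quotient.mk p.rep ∈ q.submodule := hp (rep_mem p)
    obtain ⟨r, hr⟩ := exists_smul_of_mem hq hne hpr
    rw [← Submodule.Quotient.mk_smul, Submodule.Quotient.eq] at hr
    obtain ⟨s, hs⟩ := exists_smul_of_mem hx hu0 hr
    have hp' : p.rep = s • exteriorPower.ιMulti ℂ (n + 1) u + r • substDeriv u v b := by
      rw [← hs, sub_add_cancel]
    rw [hp']
    -- The case s = 0 is the point of the line at t = ∞; it belongs to X because X is closed.
    by_cases hs0 : s = 0
    · have hr0 : r ≠ 0 := by
        rintro rfl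
        rw [hs0, zero_smul, zero_smul, add_zero] at hp'
        exact p.rep_nonzero hp'
      rw [hs0, zero_smul, zero_add, smul_mem_cone_iff hr0]
      refine mem_cone_of_isClosed isClosed_isotropicGrassmannian (fun h => hθ ?_) hline
      rw [h]; exact Submodule.zero_mem _
    · have := hline (s⁻¹ * r)
      rw [← smul_mem_cone_iff hs0, smul_add, smul_smul, mul_inv_cancel_left₀ hs0] at this
      exact this

end Vmrt

/-! ### The image of β and the structure of the projection -/

section LocalStructure

theorem finrank_comap_of_le_range {N L : Type*} [AddCommGroup N] [Module ℂ N] [AddCommGroup L]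
    [Module ℂ L] [FiniteDimensional ℂ N] (β : N →ₗ[ℂ] L) {P : Submodule ℂ L}
    (h : P ≤ LinearMap.range β) : Module.finrank ℂ (P.comap β) =
      Module.finrank ℂ P + Module.finrank ℂ (LinearMap.ker β) := by
  have h1 := LinearMap.finrank_range_add_finrank_ker (β.domRestrict (P.comap β))
  rw [LinearMap.range_domRestrict, Submodule.map_comap_eq, inf_eq_right.mpr h,
    LinearMap.ker_domRestrict] at h1
  rw [← h1]
  congr 1
  exact (Submodule.comapSubtypeEquivOfLe (LinearMap.ker_le_comap β)).finrank_eq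

theorem dual_pi_apply {σ : Type*} [Fintype σ] [DecidableEq σ] (f : Module.Dual ℂ (σ → ℂ))
    (v : σ → ℂ) : f v = ∑ i, v i * f (Pi.single i 1) := by
  rw [LinearMap.pi_apply_eq_sum_univ f]
  refine Finset.sum_congr rfl fun i _ => ?_
  rw [show (fun j => if i = j then (1 : ℂ) else 0) = Pi.single i 1 by
    ext j; simp [Pi.single_apply, eq_comm], smul_eq_mul]

variable {V : Type*} [AddCommGroup V] [Module ℂ V] [FiniteDimensional ℂ V] {n : ℕ}
  {ω : LinearMap.BilinForm ℂ V} {e : V}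

/-- A functional f on U* is the vector ∑ f_i u_i of U. If it kills the image of β, that vector is
orthogonal to all of V and lies in the radical ⟨e⟩. -/
theorem exists_smul_of_forall_pairingMap (he : ∀ v, (∀ w, ω v w = 0) → v ∈ Submodule.span ℂ {e})
    {u : Fin (n + 1) → V} (hiso : ∀ i j, ω (u i) (u j) = 0)
    {f : Module.Dual ℂ (Fin (n + 1) → ℂ)} (hf : LinearMap.range (pairingMap hiso) ≤ LinearMap.ker f) :
    ∃ r : ℂ, ∑ i, f (Pi.single i 1) • u i = r • e := by
  obtain ⟨r, hr⟩ := Submodule.mem_span_singleton.mp (he (∑ i, f (Pi.single i 1) • u i) fun w => by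
    have h1 : f (pairingMap hiso (Submodule.Quotient.mk w)) = 0 := hf ⟨_, rfl⟩
    rw [← h1, dual_pi_apply f]
    simp only [map_sum, map_smul, LinearMap.sum_apply, LinearMap.smul_apply, pairingMap_mk,
      smul_eq_mul]
    exact Finset.sum_congr rfl fun i _ => mul_comm _ _)
  exact ⟨r, hr.symm⟩

theorem surjective_pairingMap (he : ∀ v, (∀ w, ω v w = 0) → v ∈ Submodule.span ℂ {e})
    {u : Fin (n + 1) → V} (hu : LinearIndependent ℂ u) (hiso : ∀ i j, ω (u i) (u j) = 0)
    (heU : e ∉ Submodule.span ℂ (Set.range u)) : Function.Surjective (pairingMap hiso) := by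
  rw [← LinearMap.range_eq_top, eq_top_iff]
  intro v _
  by_contra hv
  obtain ⟨f, hfv, hf⟩ := Submodule.exists_le_ker_of_notMem hv
  obtain ⟨r, hr⟩ := exists_smul_of_forall_pairingMap he hiso hf
  have hr0 : r = 0 := by
    by_contra hr0
    refine heU ((Submodule.smul_mem_iff _ hr0).mp ?_)
    rw [← hr]
    exact Submodule.sum_mem _ fun i _ => Submodule.smul_mem _ _ (Submodule.subset_span ⟨i, rfl⟩)
  rw [hr0, zero_smul] at hr
  have h0 := Fintype.linearIndependent_iff.mp hu _ hr
  apply hfv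
  rw [dual_pi_apply f]
  exact Finset.sum_eq_zero fun i _ => by rw [h0, mul_zero]

/-- The hyperplane is the annihilator of e in U*: the coefficients of l are the coordinates of e in
the basis u. -/
theorem exists_range_pairingMap_eq_ker (he0 : e ≠ 0) (he' : ∀ w, ω w e = 0)
    (he : ∀ v, (∀ w, ω v w = 0) → v ∈ Submodule.span ℂ {e}) (hω : ω.IsAlt)
    {u : Fin (n + 1) → V} (hu : LinearIndependent ℂ u) (hiso : ∀ i j, ω (u i) (u j) = 0)
    (heU : e ∈ Submodule.span ℂ (Set.range u)) :
    ∃ l : Module.Dual ℂ (Fin (n + 1) → ℂ), l ≠ 0 ∧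
      LinearMap.range (pairingMap hiso) = LinearMap.ker l := by
  obtain ⟨c, hc⟩ := (Submodule.mem_span_range_iff_exists_fun ℂ).mp heU
  have hl : ∀ v, Fintype.linearCombination ℂ c v = ∑ i, v i * c i := fun v => by
    simp [Fintype.linearCombination_apply]
  refine ⟨Fintype.linearCombination ℂ c, fun h => he0 ?_, le_antisymm ?_ ?_⟩
  · rw [← hc]
    refine Finset.sum_eq_zero fun i _ => ?_
    have := LinearMap.congr_fun h (Pi.single i 1)
    rw [Fintype.linearCombination_apply_single, one_smul, LinearMap.zero_apply] at this
    rw [this, zero_smul]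
  · rintro _ ⟨b, rfl⟩
    obtain ⟨b, rfl⟩ := Submodule.Quotient.mk_surjective _ b
    rw [LinearMap.mem_ker, hl]
    have h1 : ω e b = 0 := by rw [← hω.neg_eq, he', neg_zero]
    rw [← hc] at h1
    simp only [map_sum, map_smul, LinearMap.sum_apply, LinearMap.smul_apply, smul_eq_mul] at h1
    rw [← h1]
    exact Finset.sum_congr rfl fun i _ => mul_comm _ _
  · intro v hv
    by_contra hv'
    obtain ⟨f, hfv, hf⟩ := Submodule.exists_le_ker_of_notMem hv'
    obtain ⟨r, hr⟩ := exists_smul_of_forall_pairingMap he hiso hf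
    rw [← hc, Finset.smul_sum, ← sub_eq_zero, ← Finset.sum_sub_distrib] at hr
    have h0 := Fintype.linearIndependent_iff.mp hu (fun i => f (Pi.single i 1) - r * c i) (by
      rw [← hr]; exact Finset.sum_congr rfl fun i _ => by rw [sub_smul, mul_smul])
    apply hfv
    rw [LinearMap.mem_ker, hl] at hv
    rw [dual_pi_apply f, ← mul_zero r, ← hv, Finset.mul_sum]
    refine Finset.sum_congr rfl fun i _ => ?_
    rw [sub_eq_zero.mp (h0 i)]
    ring

/-- Here dim V/U = 2m - n. If β is onto, its kernel has dimension 2m - 2n - 1; if its image is a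
hyperplane, the kernel has dimension 2m - 2n. In the second case β⁻¹⟨v⟩ is one dimension larger than
the kernel for v ∈ H, and equal to the kernel otherwise. -/
theorem vmrt_structure {m : ℕ} (hn : 1 ≤ n) (hnm : n + 1 ≤ m) (hV : Module.finrank ℂ V = 2 * m + 1)
    (hω : ω.IsAlt) (he0 : e ≠ 0) (he' : ∀ w, ω w e = 0)
    (he : ∀ v, (∀ w, ω v w = 0) → v ∈ Submodule.span ℂ {e}) {x : ℙ ℂ (⋀[ℂ]^(n + 1) V)}
    (hx : x ∈ isotropicGrassmannian (n + 1) ω) :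
    ∃ π : vmrt (isotropicGrassmannian (n + 1) ω) x → PSpace n,
      IsRegularMap π ∧ Function.Surjective π ∧
      (x ∉ isotropicThrough (n + 1) ω e → IsProjectiveBundle (2 * m - 2 * (n + 1) + 1) π) ∧
      (x ∈ isotropicThrough (n + 1) ω e →
        (∃ H : Set (PSpace n), IsHyperplane H ∧
          (∀ v ∈ H, Isomorphic (preim π {v})
            (Set.univ : Set (PSpace (2 * m - 2 * (n + 1) + 2)))) ∧
          (∀ v ∉ H, Isomorphic (preim π {v})
            (Set.univ : Set (PSpace (2 * m - 2 * (n + 1) + 1))))) ∧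
        ¬ IsSmoothVariety (vmrt (isotropicGrassmannian (n + 1) ω) x)) := by
  obtain ⟨U, hU, hUiso, hxU⟩ := mem_isotropicGrassmannian_iff.mp hx
  obtain ⟨u, hu, rfl⟩ := exists_family_of_finrank hU
  have huU : ∀ i, u i ∈ Submodule.span ℂ (Set.range u) := fun i => Submodule.subset_span ⟨i, rfl⟩
  have hxu : exteriorPower.ιMulti ℂ (n + 1) u ∈ x.submodule := hxU ▸ ιMulti_mem_pluckerLine huU
  have hiso : ∀ i j, ω (u i) (u j) = 0 := fun i j => hUiso _ (huU i) _ (huU j)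
  rw [mem_isotropicThrough_iff hU hUiso hxU, vmrt_isotropicGrassmannian hω hu hiso hxu]
  have hΘ := injective_tangentMap hu hxu
  set β := pairingMap hiso with hβ
  have hN : Module.finrank ℂ (V ⧸ Submodule.span ℂ (Set.range u)) = 2 * m - n := by
    have := Submodule.finrank_quotient_add_finrank (Submodule.span ℂ (Set.range u))
    omega
  have hrk := LinearMap.finrank_range_add_finrank_ker β
  rw [hN] at hrk
  have hker : LinearMap.ker β ≠ ⊥ := by
    intro h
    rw [h, finrank_bot] at hrk
    have := Submodule.finrank_le (LinearMap.range β)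
    rw [Module.finrank_fin_fun] at this
    omega
  refine ⟨rankOneProj (tangentMap u hxu) β, isRegularMap_rankOneProj hΘ,
    rankOneProj_surjective hΘ hker, fun heU => ?_, fun heU => ?_⟩
  · have hs : Function.Surjective β := surjective_pairingMap he hu hiso heU
    rw [LinearMap.range_eq_top.mpr hs, finrank_top, Module.finrank_fin_fun] at hrk
    exact isProjectiveBundle_rankOneProj hΘ hs (by omega)
  · obtain ⟨l, hl0, (hl : LinearMap.range β = _)⟩ := exists_range_pairingMap_eq_ker he0 he' he hω hu hiso heU
    obtain ⟨v, hv⟩ : ∃ v, l v ≠ 0 := by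
      by_contra! h; exact hl0 (LinearMap.ext h)
    have hkl := finrank_ker_add_one hv
    rw [← hl, Module.finrank_fin_fun] at hkl
    refine ⟨⟨{p | p.submodule ≤ LinearMap.ker l}, ⟨l, hl0, rfl⟩, fun p hp => ?_, fun p hp => ?_⟩, ?_⟩
    · refine isomorphic_preim_rankOneProj hΘ ?_
      rw [finrank_comap_of_le_range _ (hl ▸ hp), Projectivization.finrank_submodule]
      omega
    · refine isomorphic_preim_rankOneProj hΘ ?_
      have : p.submodule.comap β = LinearMap.ker β := by
        refine le_antisymm (fun b hb => ?_) (LinearMap.ker_le_comap β)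
        by_contra h0
        apply hp
        change p.submodule ≤ LinearMap.ker l
        rw [submodule_eq_span hb h0, Submodule.span_singleton_le_iff_mem, ← hl]
        exact ⟨b, rfl⟩
      rw [this]
      omega
    · exact not_isSmoothVariety_rankOneLocus hΘ hl0 hl (by rw [Module.finrank_fin_fun]; omega) hker

end LocalStructure

/-! ### Linear subspaces of a variety and conjugates of one-parameter groups -/

section LinearSubspaces

variable {E : Type*} [AddCommGroup E] [Module ℂ E] {X : Set (ℙ ℂ E)}

/-- The linear subspace `W` of the projective space is contained in the variety `X`. -/
def IsLinearSubspaceOf (X : Set (ℙ ℂ E)) (W : Submodule ℂ E) : Prop :=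
  ∀ p : ℙ ℂ E, p.submodule ≤ W → p ∈ X

/-- The line through two points lies in `X`. -/
def Collinear (X : Set (ℙ ℂ E)) (p q : ℙ ℂ E) : Prop :=
  IsLinearSubspaceOf X (p.submodule ⊔ q.submodule)

/-- The bijection `φ` maps linear subspaces of `X` to linear subspaces of the same dimension. -/
def PreservesLinearSubspaces (φ : X ≃ X) : Prop :=
  ∀ W : Submodule ℂ E, IsLinearSubspaceOf X W → 2 ≤ Module.finrank ℂ W →
    ∃ W' : Submodule ℂ E, IsLinearSubspaceOf X W' ∧ Module.finrank ℂ W' = Module.finrank ℂ W ∧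
      ∀ x : X, (x : ℙ ℂ E).submodule ≤ W ↔ (φ x : ℙ ℂ E).submodule ≤ W'

theorem finrank_sup_submodule [FiniteDimensional ℂ E] {p q : ℙ ℂ E} (h : p ≠ q) :
    Module.finrank ℂ (p.submodule ⊔ q.submodule : Submodule ℂ E) = 2 := by
  have h1 := finrank_sup_span_singleton (A := p.submodule) (b := q.rep) (fun h' =>
    h (eq_of_mem h' (rep_mem q) q.rep_nonzero))
  rwa [← Projectivization.submodule_eq, Projectivization.finrank_submodule] at h1

theorem Collinear.map [FiniteDimensional ℂ E] {φ : X ≃ X} (hφ : PreservesLinearSubspaces φ)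
    {p q : X} (h : Collinear X p q) : Collinear X (φ p) (φ q) := by
  by_cases hpq : p = q
  · subst hpq
    intro y hy
    rw [sup_idem] at hy
    rw [eq_of_mem (hy (rep_mem y)) (rep_mem y) y.rep_nonzero |>.symm]
    exact (φ p).2
  · obtain ⟨W', hW', -, h2⟩ := hφ _ h
      (finrank_sup_submodule fun h' => hpq (Subtype.ext h')).ge
    intro y hy
    exact hW' y (hy.trans (sup_le ((h2 p).mp le_sup_left) ((h2 q).mp le_sup_right)))

/-- Any two points of `X` which are collinear with all points of `L` are collinear. -/
def IsSpecialLine (X : Set (ℙ ℂ E)) (L : Submodule ℂ E) : Prop :=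
  ∀ p ∈ X, ∀ q ∈ X, (∀ z : ℙ ℂ E, z.submodule ≤ L → Collinear X p z) →
    (∀ z : ℙ ℂ E, z.submodule ≤ L → Collinear X q z) → Collinear X p q

/-- Through `x` there is a special line contained in a linear subspace of dimension `d`. -/
def HasSpecialLine (X : Set (ℙ ℂ E)) (d : ℕ) (x : ℙ ℂ E) : Prop :=
  ∃ L : Submodule ℂ E, Module.finrank ℂ L = 2 ∧ x.submodule ≤ L ∧ IsSpecialLine X L ∧
    ∃ W, L ≤ W ∧ IsLinearSubspaceOf X W ∧ Module.finrank ℂ W = d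

/-- The property is expressed by linear subspaces of X and collinearity alone. The inverse is needed
to pull collinearity with the image line back to L. -/
theorem HasSpecialLine.map [FiniteDimensional ℂ E] {φ : X ≃ X} (hφ : PreservesLinearSubspaces φ)
    (hφ' : PreservesLinearSubspaces φ.symm) {d : ℕ} {x : X} (h : HasSpecialLine X d x) :
    HasSpecialLine X d (φ x) := by
  obtain ⟨L, hL, hxL, hs, W, hLW, hW, hd⟩ := h
  have hLX : IsLinearSubspaceOf X L := fun p hp => hW p (hp.trans hLW)
  obtain ⟨L', hLX', hL', h1⟩ := hφ L hLX hL.ge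
  obtain ⟨W', hWX', hW', h2⟩ := hφ W hW (hL.ge.trans (Submodule.finrank_mono hLW))
  refine ⟨L', hL'.trans hL, (h1 x).mp hxL, fun p hp q hq hpL hqL => ?_, W', ?_, hWX', hW'.trans hd⟩
  · have key : ∀ {p} (hp : p ∈ X), (∀ z : ℙ ℂ E, z.submodule ≤ L' → Collinear X p z) →
        ∀ z : ℙ ℂ E, z.submodule ≤ L → Collinear X (φ.symm ⟨p, hp⟩) z := by
      intro p hp hpL z hz
      have := Collinear.map hφ' (p := ⟨p, hp⟩) (q := φ ⟨z, hLX z hz⟩)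
        (hpL _ ((h1 ⟨z, hLX z hz⟩).mp hz))
      rwa [φ.symm_apply_apply] at this
    have := Collinear.map hφ (hs _ (φ.symm ⟨p, hp⟩).2 _ (φ.symm ⟨q, hq⟩).2 (key hp hpL) (key hq hqL))
    rwa [φ.apply_symm_apply, φ.apply_symm_apply] at this
  · intro v hv
    by_cases h0 : v = 0
    · rw [h0]; exact Submodule.zero_mem _
    have hp : (Projectivization.mk ℂ v h0).submodule ≤ L' := by
      rwa [submodule_eq_span (mem_mk h0) h0, Submodule.span_singleton_le_iff_mem]
    obtain ⟨y, hy⟩ := φ.surjective ⟨_, hLX' _ hp⟩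
    have hy' : (φ y : ℙ ℂ E) = Projectivization.mk ℂ v h0 := congrArg Subtype.val hy
    have := (h2 y).mp (((h1 y).mpr (hy' ▸ hp)).trans hLW)
    rw [hy'] at this
    exact this (mem_mk h0)

theorem IsLocallyPolynomial.of_linearMap {σ : Type*} [Finite σ] {S : Set (σ → ℂ)} {f : S → ℙ ℂ E}
    (G : (σ → ℂ) →ₗ[ℂ] E) (h : ∀ a : S, G a.1 ≠ 0 ∧ G a.1 ∈ (f a).submodule) :
    IsLocallyPolynomial f := fun _ =>
  ⟨fun a => 0 + G a, 1, IsPolynomialMap.const_add_linear 0 G, by simp, fun b _ => by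
    simpa using h b⟩

theorem IsLocallyPolynomial.add_smul {σ : Type*} {S : Set (σ → ℂ)} {f f' : S → ℙ ℂ E}
    (hf : IsLocallyPolynomial f) (s : σ) (D : E →ₗ[ℂ] E)
    (h : ∀ a : S, ∀ v ∈ (f a).submodule, v ≠ 0 →
      v + a.1 s • D v ≠ 0 ∧ v + a.1 s • D v ∈ (f' a).submodule) : IsLocallyPolynomial f' := by
  intro a
  obtain ⟨H, q, hH, ha, hb⟩ := hf a
  refine ⟨fun a => H a + a s • D (H a), q, fun ψ => ?_, ha, fun b hqb =>
    h b _ (hb b hqb).2 (hb b hqb).1⟩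
  obtain ⟨P, hP⟩ := hH ψ
  obtain ⟨Q, hQ⟩ := hH (ψ ∘ₗ D)
  exact ⟨P + MvPolynomial.X s * Q, fun a => by
    rw [map_add, map_smul, hP, map_add, map_mul, MvPolynomial.eval_X, ← hQ]; rfl⟩

/-- A one-parameter group of automorphisms of the form `v ↦ v + t D v`. -/
structure LinearFlow (X : Set (ℙ ℂ E)) where
  /-- The derivative. -/
  D : E →ₗ[ℂ] E
  /-- The automorphisms. -/
  τ : ℂ → X ≃ X
  apply_mem : ∀ t (x : X), ∀ v ∈ (x : ℙ ℂ E).submodule, v ≠ 0 →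
    v + t • D v ≠ 0 ∧ v + t • D v ∈ (τ t x : ℙ ℂ E).submodule
  symm_apply : ∀ t x, (τ t).symm x = τ (-t) x

theorem LinearFlow.isBiregular (A : LinearFlow X) (t : ℂ) : IsBiregular (A.τ t) := by
  have h : ∀ t, IsRegularMap (fun x => (A.τ t x : ℙ ℂ E)) := fun t =>
    IsRegularMap.of_linearMap (LinearMap.id + t • A.D) (A.apply_mem t)
  refine ⟨h t, ?_⟩
  simp only [A.symm_apply]
  exact h (-t)

theorem LinearFlow.zero_apply (A : LinearFlow X) (x : X) : A.τ 0 x = x := by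
  have := A.apply_mem 0 x _ (rep_mem _) (x : ℙ ℂ E).rep_nonzero
  rw [zero_smul, add_zero] at this
  exact Subtype.ext (eq_of_mem this.2 (rep_mem _) this.1)

/-- On the projective space of W the maps g τ_t g⁻¹ form an algebraic family in t whose member at t
= 0 is the inclusion. By `IsLocallyPolynomial.exists_linearMap` every member is then linear,
although g itself need not be. -/
theorem LinearFlow.preservesLinearSubspaces_conj [FiniteDimensional ℂ E] (A : LinearFlow X)
    {g : X ≃ X} (hg : IsBiregular g) (t : ℂ) :
    PreservesLinearSubspaces ((g.symm.trans (A.τ t)).trans g) := by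
  intro W hW hr
  set r := Module.finrank ℂ W with hrdef
  let ε := (Module.finBasis ℂ W).equivFun.symm
  let j : (Fin r → ℂ) →ₗ[ℂ] E := W.subtype ∘ₗ ε.toLinearMap
  have hj : Function.Injective j := W.injective_subtype.comp ε.injective
  have hj0 : ∀ {w}, w ≠ 0 → j w ≠ 0 := fun hw => (map_ne_zero_iff j hj).mpr hw
  have hjW : ∀ {w} (hw : w ≠ 0), Projectivization.mk ℂ (j w) (hj0 hw) ∈ X := fun {w} hw => by
    refine hW _ ?_
    rw [Projectivization.submodule_mk, Submodule.span_singleton_le_iff_mem]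
    exact (ε w).2
  -- The coordinate at `none` is the time t, the others are coordinates on W. The family is built by
  -- applying g⁻¹, the flow at time t, and g to the constant family f₀.
  let f₀ : {a : Option (Fin r) → ℂ | a ∘ some ≠ 0} → ℙ ℂ E := fun a =>
    Projectivization.mk ℂ (j (a.1 ∘ some)) (hj0 a.2)
  have hf₀ : IsLocallyPolynomial f₀ := IsLocallyPolynomial.of_linearMap
    (j ∘ₗ LinearMap.funLeft ℂ ℂ some) fun a => ⟨hj0 a.2, mem_mk _⟩
  have hf₀X : ∀ a, f₀ a ∈ X := fun a => hjW a.2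
  have h1 := hf₀.comp hf₀X hg.2
  have h2 : IsLocallyPolynomial fun a : {a : Option (Fin r) → ℂ | a ∘ some ≠ 0} =>
      (A.τ (a.1 none) (g.symm ⟨f₀ a, hf₀X a⟩) : ℙ ℂ E) :=
    h1.add_smul none A.D fun a => A.apply_mem _ _
  have h3 := h2.comp (fun a => (A.τ (a.1 none) (g.symm ⟨f₀ a, hf₀X a⟩)).2) hg.1
  have hmk : ∀ (z : ℂ) (hz : z ≠ 0) (w : Fin r → ℂ) (hw : w ≠ 0) (hw' : (fun i => z * w i) ≠ 0),
      Projectivization.mk ℂ (j fun i => z * w i) (hj0 hw') = Projectivization.mk ℂ (j w) (hj0 hw) :=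
    fun z hz w hw hw' => by
      rw [Projectivization.mk_eq_mk_iff']
      exact ⟨z, by rw [← map_smul]; rfl⟩
  obtain ⟨T, hT⟩ := h3.exists_linearMap hr j hj (fun t w hw hw' => by
      have : (⟨f₀ ⟨consPoint t fun i => 2 * w i, hw'⟩, hf₀X _⟩ : X) =
          ⟨f₀ ⟨consPoint t w, hw⟩, hf₀X _⟩ := Subtype.ext (hmk 2 two_ne_zero w hw hw')
      simp only [Subtype.coe_eta, this]
      rfl) (fun w hw => by
      change j w ∈ (g (A.τ 0 (g.symm _)) : ℙ ℂ E).submodule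
      rw [A.zero_apply, g.apply_symm_apply]
      exact mem_mk _) t
  have hTi : Function.Injective T := by
    rw [injective_iff_map_eq_zero]
    exact fun w hw => by_contra fun h => (hT w h).1 hw
  have key : ∀ (w : Fin r → ℂ) (hw : w ≠ 0) (x : X), j w ∈ (x : ℙ ℂ E).submodule →
      T w ∈ (((g.symm.trans (A.τ t)).trans g) x : ℙ ℂ E).submodule := by
    intro w hw x hx
    have h4 : x = ⟨f₀ ⟨consPoint t w, hw⟩, hf₀X _⟩ := Subtype.ext (eq_mk hx (hj0 hw))
    rw [h4]
    exact (hT w hw).2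
  have hX : ∀ w (hw : w ≠ 0), ∃ x : X, (x : ℙ ℂ E).submodule ≤ W ∧ j w ∈ (x : ℙ ℂ E).submodule :=
    fun w hw => ⟨⟨_, hjW hw⟩, by
      rw [Projectivization.submodule_mk, Submodule.span_singleton_le_iff_mem]
      exact (ε w).2, mem_mk _⟩
  have hrange : ∀ y : ℙ ℂ E, y.submodule ≤ LinearMap.range T → ∃ x : X,
      (x : ℙ ℂ E).submodule ≤ W ∧ (((g.symm.trans (A.τ t)).trans g) x : ℙ ℂ E) = y := by
    intro y hy
    obtain ⟨w, hw⟩ := hy (rep_mem y)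
    have hw0 : w ≠ 0 := by rintro rfl; exact y.rep_nonzero (by rw [← hw, map_zero])
    obtain ⟨x, hx, hwx⟩ := hX w hw0
    exact ⟨x, hx, eq_of_mem (key w hw0 x hwx) (hw ▸ rep_mem y) (hT w hw0).1⟩
  refine ⟨LinearMap.range T, fun y hy => ?_, ?_, fun x => ⟨fun hx => ?_, fun hx => ?_⟩⟩
  · obtain ⟨x, -, hx⟩ := hrange y hy
    rw [← hx]
    exact Subtype.property _
  · rw [LinearMap.finrank_range_of_inj hTi, Module.finrank_fin_fun]
  · have h5 := hx (rep_mem _)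
    have h6 : j (ε.symm ⟨_, h5⟩) = (x : ℙ ℂ E).rep := by simp [j]
    have h7 : ε.symm ⟨_, h5⟩ ≠ 0 := fun h => (x : ℙ ℂ E).rep_nonzero (by rw [← h6, h, map_zero])
    have h8 := key _ h7 x (by rw [h6]; exact rep_mem _)
    rw [submodule_eq_span h8 (hT _ h7).1, Submodule.span_singleton_le_iff_mem]
    exact ⟨_, rfl⟩
  · obtain ⟨x', hx', h5⟩ := hrange _ hx
    rwa [((g.symm.trans (A.τ t)).trans g).injective (Subtype.ext h5)] at hx'

theorem LinearFlow.hasSpecialLine_conj [FiniteDimensional ℂ E] (A : LinearFlow X)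
    {g : X ≃ X} (hg : IsBiregular g) (t : ℂ) {d : ℕ} {x : X} (h : HasSpecialLine X d (g x)) :
    HasSpecialLine X d (g (A.τ t x)) := by
  have h1 := A.preservesLinearSubspaces_conj hg t
  have h2 := A.preservesLinearSubspaces_conj hg (-t)
  have h3 : ((g.symm.trans (A.τ t)).trans g).symm = (g.symm.trans (A.τ (-t))).trans g := by
    ext y
    simp [A.symm_apply]
  rw [← h3] at h2
  have := h.map h1 h2
  simpa using this

end LinearSubspaces

theorem finrank_map_of_injective {V W : Type*} [AddCommGroup V] [Module ℂ V] [AddCommGroup W]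
    [Module ℂ W] {f : V →ₗ[ℂ] W} (hf : Function.Injective f) (U : Submodule ℂ V) :
    Module.finrank ℂ (U.map f) = Module.finrank ℂ U :=
  (Submodule.equivMapOfInjective f hf U).finrank_eq.symm

/-! ### Symplectic transvections acting on the isotropic Grassmannian -/

section Transvections

variable {V : Type*} [AddCommGroup V] [Module ℂ V] {ω : LinearMap.BilinForm ℂ V}

/-- The symplectic transvection `v ↦ v + t ω(a, v) a`. -/
noncomputable def symplecticTransvection (ω : LinearMap.BilinForm ℂ V) (a : V) (t : ℂ) :
    V →ₗ[ℂ] V := LinearMap.id + t • (ω a).smulRight a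

theorem symplecticTransvection_apply (a : V) (t : ℂ) (v : V) :
    symplecticTransvection ω a t v = v + (t * ω a v) • a := by
  simp [symplecticTransvection, mul_smul]

theorem symplecticTransvection_comp (hω : ω.IsAlt) (a : V) (s t : ℂ) :
    symplecticTransvection ω a s ∘ₗ symplecticTransvection ω a t =
      symplecticTransvection ω a (s + t) := by
  ext v
  simp only [LinearMap.comp_apply, symplecticTransvection_apply]
  rw [map_add, map_smul, hω.self_eq_zero a, smul_zero, add_zero, add_assoc, ← add_smul]
  congr 2
  ring

theorem symplecticTransvection_zero (a : V) : symplecticTransvection ω a 0 = LinearMap.id := by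
  simp [symplecticTransvection]

theorem apply_symplecticTransvection (hω : ω.IsAlt) (a : V) (t : ℂ) (v w : V) :
    ω (symplecticTransvection ω a t v) (symplecticTransvection ω a t w) = ω v w := by
  simp only [symplecticTransvection_apply, map_add, map_smul, LinearMap.add_apply,
    LinearMap.smul_apply, hω.self_eq_zero a, smul_eq_mul]
  rw [← hω.neg_eq v a]
  ring

theorem symplecticTransvection_neg_apply (hω : ω.IsAlt) (a : V) (t : ℂ) (v : V) :
    symplecticTransvection ω a (-t) (symplecticTransvection ω a t v) = v := by
  rw [← LinearMap.comp_apply, symplecticTransvection_comp hω, neg_add_cancel,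
    symplecticTransvection_zero, LinearMap.id_apply]

theorem injective_symplecticTransvection (hω : ω.IsAlt) (a : V) (t : ℂ) :
    Function.Injective (symplecticTransvection ω a t) :=
  Function.LeftInverse.injective (symplecticTransvection_neg_apply hω a t)

/-- A transvection moves all vectors along the single vector a, so by `ιMulti_add_smul` its action
on ⋀ᵏ V is affine in t. This is the form required by `LinearFlow`. -/
theorem exteriorPower_map_symplecticTransvection {k : ℕ} (a : V) (t : ℂ) :
    exteriorPower.map k (symplecticTransvection ω a t) = LinearMap.id +
      t • (exteriorPower.map k (symplecticTransvection ω a 1) - LinearMap.id) := by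
  have key : ∀ (t : ℂ) (u : Fin k → V), exteriorPower.map k (symplecticTransvection ω a t)
      (exteriorPower.ιMulti ℂ k u) = exteriorPower.ιMulti ℂ k u +
        t • substDeriv u (fun i => ω a (u i)) a := fun t u => by
    rw [exteriorPower.map_apply_ιMulti, ← ιMulti_add_smul]
    congr 1
    ext i
    exact symplecticTransvection_apply a t (u i)
  refine exteriorPower.linearMap_ext (AlternatingMap.ext fun u => ?_)
  simp only [LinearMap.compAlternatingMap_apply, LinearMap.add_apply, LinearMap.smul_apply,
    LinearMap.sub_apply, LinearMap.id_apply, key, one_smul, add_sub_cancel_left]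

variable [FiniteDimensional ℂ V] {k : ℕ}

theorem map_isotropic (hω : ω.IsAlt) {U : Submodule ℂ V} (hU : Module.finrank ℂ U = k)
    (hiso : ∀ u ∈ U, ∀ v ∈ U, ω u v = 0) (a : V) (t : ℂ) :
    Module.finrank ℂ (U.map (symplecticTransvection ω a t)) = k ∧
    ∀ u ∈ U.map (symplecticTransvection ω a t), ∀ v ∈ U.map (symplecticTransvection ω a t),
      ω u v = 0 := by
  refine ⟨?_, ?_⟩
  · rw [finrank_map_of_injective (injective_symplecticTransvection hω a t), hU]
  · rintro _ ⟨u, hu, rfl⟩ _ ⟨v, hv, rfl⟩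
    rw [apply_symplecticTransvection hω]
    exact hiso u hu v hv

theorem exists_transvection_image (hω : ω.IsAlt) (a : V) (t : ℂ)
    (x : isotropicGrassmannian k ω) : ∃ y : isotropicGrassmannian k ω,
      (y : ℙ ℂ (⋀[ℂ]^k V)).submodule =
        (x : ℙ ℂ (⋀[ℂ]^k V)).submodule.map (exteriorPower.map k (symplecticTransvection ω a t)) := by
  obtain ⟨x, U, h1, h2, h3⟩ := x
  obtain ⟨h4, h5⟩ := map_isotropic hω h1 h2 a t
  refine ⟨⟨pluckerPoint _ h4, _, h4, h5, submodule_pluckerPoint _ h4⟩, ?_⟩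
  simp only [submodule_pluckerPoint]
  rw [h3, ← map_pluckerLine]
  rfl

/-- The action of the transvections on the isotropic Grassmannian. -/
noncomputable def transvectionFlow (k : ℕ) (hω : ω.IsAlt) (a : V) :
    LinearFlow (isotropicGrassmannian k ω) := by
  have hinv : ∀ t x, (exists_transvection_image hω a (-t)
      (exists_transvection_image (k := k) hω a t x).choose).choose = x := fun t x => by
    refine Subtype.ext (Projectivization.submodule_injective ?_)
    rw [(exists_transvection_image hω a (-t) _).choose_spec,
      (exists_transvection_image hω a t x).choose_spec, ← Submodule.map_comp,
      ← exteriorPower.map_comp, symplecticTransvection_comp hω, neg_add_cancel,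
      symplecticTransvection_zero, exteriorPower.map_id, Submodule.map_id]
  exact
  { D := exteriorPower.map k (symplecticTransvection ω a 1) - LinearMap.id
    τ := fun t =>
      { toFun := fun x => (exists_transvection_image hω a t x).choose
        invFun := fun x => (exists_transvection_image hω a (-t) x).choose
        left_inv := hinv t
        right_inv := fun x => by
          have := hinv (-t) x
          rwa [neg_neg] at this }
    apply_mem := fun t x v hv h0 => by
      have h1 : v + t • (exteriorPower.map k (symplecticTransvection ω a 1) -
          LinearMap.id : ⋀[ℂ]^k V →ₗ[ℂ] ⋀[ℂ]^k V) v =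
          exteriorPower.map k (symplecticTransvection ω a t) v := by
        rw [exteriorPower_map_symplecticTransvection a t]; rfl
      rw [h1]
      refine ⟨(map_ne_zero_iff _ (exteriorPower.map_injective_field
        (injective_symplecticTransvection hω a t))).mpr h0, ?_⟩
      change _ ∈ ((exists_transvection_image hω a t x).choose : ℙ ℂ (⋀[ℂ]^k V)).submodule
      rw [(exists_transvection_image hω a t x).choose_spec]
      exact ⟨v, hv, rfl⟩
    symm_apply := fun t x => rfl }

theorem submodule_transvectionFlow (hω : ω.IsAlt) (a : V) (t : ℂ) (x : isotropicGrassmannian k ω) :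
    ((transvectionFlow k hω a).τ t x : ℙ ℂ (⋀[ℂ]^k V)).submodule =
      (x : ℙ ℂ (⋀[ℂ]^k V)).submodule.map (exteriorPower.map k (symplecticTransvection ω a t)) :=
  (exists_transvection_image hω a t x).choose_spec

end Transvections

/-! ### Transitivity of the transvections on the two kinds of isotropic subspaces -/

section Reachability

variable {V : Type*} [AddCommGroup V] [Module ℂ V] [FiniteDimensional ℂ V] {n : ℕ}
  {ω : LinearMap.BilinForm ℂ V} {e : V}

/-- The double orthogonal of A is A + ⟨e⟩: a functional ω(b, ·) vanishing on the common kernel of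
the ω(a_i, ·) is a combination of them, and the difference of the vectors is in the radical. -/
theorem mem_sup_span_of_forall_orthogonal (he : ∀ v, (∀ w, ω v w = 0) → v ∈ Submodule.span ℂ {e})
    {A : Submodule ℂ V} {b : V} (h : ∀ c, (∀ a ∈ A, ω a c = 0) → ω b c = 0) :
    b ∈ A ⊔ Submodule.span ℂ {e} := by
  obtain ⟨a, ha, hs⟩ := exists_family_of_finrank (U := A) rfl
  have h1 : ω b ∈ Submodule.span ℂ (Set.range fun i => ω (a i)) := by
    refine mem_span_of_iInf_ker_le_ker fun c hc => h c fun x hx => ?_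
    rw [Submodule.mem_iInf] at hc
    rw [← hs] at hx
    induction hx using Submodule.span_induction with
    | mem x hx => obtain ⟨i, rfl⟩ := hx; exact hc i
    | zero => simp
    | add x y _ _ h1 h2 => rw [map_add, LinearMap.add_apply, h1, h2, add_zero]
    | smul c x _ h1 => rw [map_smul, LinearMap.smul_apply, h1, smul_zero]
  obtain ⟨c, hc⟩ := (Submodule.mem_span_range_iff_exists_fun ℂ).mp h1
  have h2 : b - ∑ i, c i • a i ∈ Submodule.span ℂ {e} := he _ fun w => by
    rw [map_sub, ← hc, map_sum]
    simp
  rw [← sub_add_cancel b (∑ i, c i • a i), add_comm]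
  refine Submodule.add_mem_sup (Submodule.sum_mem _ fun i _ => Submodule.smul_mem _ _ ?_) h2
  rw [← hs]; exact Submodule.subset_span ⟨i, rfl⟩

theorem isotropic_sup_span (hω : ω.IsAlt) {A : Submodule ℂ V}
    (hA : ∀ u ∈ A, ∀ v ∈ A, ω u v = 0) {b : V} (hb : ∀ a ∈ A, ω a b = 0) :
    ∀ u ∈ A ⊔ Submodule.span ℂ {b}, ∀ v ∈ A ⊔ Submodule.span ℂ {b}, ω u v = 0 := by
  intro u hu v hv
  obtain ⟨a, ha, c, hc, rfl⟩ := Submodule.mem_sup.mp hu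
  obtain ⟨a', ha', c', hc', rfl⟩ := Submodule.mem_sup.mp hv
  obtain ⟨r, rfl⟩ := Submodule.mem_span_singleton.mp hc
  obtain ⟨r', rfl⟩ := Submodule.mem_span_singleton.mp hc'
  have h1 : ω b a' = 0 := by rw [← hω.neg_eq, hb a' ha', neg_zero]
  simp only [map_add, map_smul, LinearMap.add_apply, LinearMap.smul_apply, hA a ha a' ha', hb a ha,
    h1, hω.self_eq_zero b, smul_zero, add_zero]

/-- A vector space is not the union of two proper subspaces; one of c, c', c + c' works. -/
theorem exists_orthogonal_ne_zero {A : Submodule ℂ V}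
    {b b' : V} (h : ∃ c, (∀ a ∈ A, ω a c = 0) ∧ ω b c ≠ 0)
    (h' : ∃ c, (∀ a ∈ A, ω a c = 0) ∧ ω b' c ≠ 0) :
    ∃ c, (∀ a ∈ A, ω a c = 0) ∧ ω b c ≠ 0 ∧ ω b' c ≠ 0 := by
  obtain ⟨c, hc, hbc⟩ := h
  obtain ⟨c', hc', hbc'⟩ := h'
  by_cases h1 : ω b' c = 0
  · by_cases h2 : ω b c' = 0
    · exact ⟨c + c', fun a ha => by rw [map_add, hc a ha, hc' a ha, add_zero],
        by rwa [map_add, h2, add_zero], by rwa [map_add, h1, zero_add]⟩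
    · exact ⟨c', hc', h2, hbc'⟩
  · exact ⟨c, hc, hbc, h1⟩

/-- The vector b' - b is orthogonal to A, so A is fixed pointwise; and ω(b' - b, b) = ω(b', b), so
the chosen time sends b to b'. -/
theorem transvection_map_sup_span (hω : ω.IsAlt) {A : Submodule ℂ V} {b b' : V}
    (hb : ∀ a ∈ A, ω a b = 0) (hb' : ∀ a ∈ A, ω a b' = 0) (h : ω b b' ≠ 0) :
    (A ⊔ Submodule.span ℂ {b}).map (symplecticTransvection ω (b' - b) (ω b' b)⁻¹) =
      A ⊔ Submodule.span ℂ {b'} := by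
  have h' : ω b' b ≠ 0 := by rw [← hω.neg_eq]; exact neg_ne_zero.mpr h
  have hA : ∀ a ∈ A, symplecticTransvection ω (b' - b) (ω b' b)⁻¹ a = a := fun a ha => by
    rw [symplecticTransvection_apply, ← hω.neg_eq a, map_sub, hb a ha, hb' a ha]
    simp
  have hbb : symplecticTransvection ω (b' - b) (ω b' b)⁻¹ b = b' := by
    rw [symplecticTransvection_apply, map_sub, LinearMap.sub_apply, hω.self_eq_zero b, sub_zero,
      inv_mul_cancel₀ h', one_smul, add_sub_cancel]
  rw [Submodule.map_sup, Submodule.map_span, Set.image_singleton, hbb]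
  congr 1
  ext v
  constructor
  · rintro ⟨a, ha, rfl⟩; rw [hA a ha]; exact ha
  · intro hv; exact ⟨v, hv, hA v hv⟩

/-- Two spaces sharing A are joined through a third A + ⟨c⟩ with ω(b, c) and ω(b', c) both nonzero.
-/
theorem adjacent_of_transvection_invariant (hω : ω.IsAlt)
    (he : ∀ v, (∀ w, ω v w = 0) → v ∈ Submodule.span ℂ {e})
    {P : Submodule ℂ V → Prop} (hP : ∀ U : Submodule ℂ V, Module.finrank ℂ U = n + 1 →
      (∀ u ∈ U, ∀ v ∈ U, ω u v = 0) → P U → ∀ a t, P (U.map (symplecticTransvection ω a t)))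
    {A : Submodule ℂ V} (hA : Module.finrank ℂ A = n) (hAiso : ∀ u ∈ A, ∀ v ∈ A, ω u v = 0)
    {b b' : V} (hb : ∀ a ∈ A, ω a b = 0) (hb' : ∀ a ∈ A, ω a b' = 0) (hbA : b ∉ A) (hbA' : b' ∉ A)
    (hee : e ∈ A ⊔ Submodule.span ℂ {b} ↔ e ∈ A ⊔ Submodule.span ℂ {b'})
    (h : P (A ⊔ Submodule.span ℂ {b})) : P (A ⊔ Submodule.span ℂ {b'}) := by
  have step : ∀ {b b'}, (∀ a ∈ A, ω a b = 0) → (∀ a ∈ A, ω a b' = 0) → b ∉ A → ω b b' ≠ 0 →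
      P (A ⊔ Submodule.span ℂ {b}) → P (A ⊔ Submodule.span ℂ {b'}) :=
    fun {b b'} hb hb' hbA h hPb => by
      rw [← transvection_map_sup_span hω hb hb' h]
      exact hP _ (by rw [finrank_sup_span_singleton hbA, hA]) (isotropic_sup_span hω hAiso hb) hPb _ _
  by_cases hc : ∃ c, (∀ a ∈ A, ω a c = 0) ∧ ω b c ≠ 0 ∧ ω b' c ≠ 0
  · obtain ⟨c, hc, hbc, hbc'⟩ := hc
    have hcA : c ∉ A := fun h0 => hbc (by rw [← hω.neg_eq, hb c h0, neg_zero])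
    exact step hc hb' hcA (by rw [← hω.neg_eq]; exact neg_ne_zero.mpr hbc') (step hb hc hbA hbc h)
  -- If no such c exists, then b or b' is orthogonal to A^⊥ and lies in A + ⟨e⟩. By `hee` both
  -- spaces are then A + ⟨e⟩, hence equal.
  · have key : ∀ {b}, b ∉ A → (¬ ∃ c, (∀ a ∈ A, ω a c = 0) ∧ ω b c ≠ 0) →
        e ∈ A ⊔ Submodule.span ℂ {b} ∧ e ∉ A := by
      intro b hbA hn
      push Not at hn
      obtain ⟨a, ha, c, hc, hac⟩ := Submodule.mem_sup.mp (mem_sup_span_of_forall_orthogonal he hn)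
      obtain ⟨r, rfl⟩ := Submodule.mem_span_singleton.mp hc
      have hr : r ≠ 0 := by
        rintro rfl; rw [zero_smul, add_zero] at hac; exact hbA (hac ▸ ha)
      refine ⟨?_, fun heA => hbA (hac ▸ A.add_mem ha (A.smul_mem r heA))⟩
      rw [← Submodule.smul_mem_iff _ hr, eq_sub_of_add_eq' hac]
      exact Submodule.sub_mem _ (Submodule.mem_sup_right (Submodule.mem_span_singleton_self b))
        (Submodule.mem_sup_left ha)
    have heq : ∀ {b}, e ∈ A ⊔ Submodule.span ℂ {b} → b ∉ A → e ∉ A →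
        A ⊔ Submodule.span ℂ {b} = A ⊔ Submodule.span ℂ {e} := by
      intro b heb hbA heA
      refine (Submodule.eq_of_le_of_finrank_eq (sup_le le_sup_left ?_) ?_).symm
      · rwa [Submodule.span_singleton_le_iff_mem]
      · rw [finrank_sup_span_singleton hbA, finrank_sup_span_singleton heA]
    have : (e ∈ A ⊔ Submodule.span ℂ {b} ∧ e ∈ A ⊔ Submodule.span ℂ {b'}) ∧ e ∉ A := by
      by_cases h1 : ∃ c, (∀ a ∈ A, ω a c = 0) ∧ ω b c ≠ 0
      · have h2 : ¬ ∃ c, (∀ a ∈ A, ω a c = 0) ∧ ω b' c ≠ 0 := fun h2 =>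
          hc (exists_orthogonal_ne_zero h1 h2)
        obtain ⟨h3, h4⟩ := key hbA' h2
        exact ⟨⟨hee.mpr h3, h3⟩, h4⟩
      · obtain ⟨h3, h4⟩ := key hbA h1
        exact ⟨⟨h3, hee.mp h3⟩, h4⟩
    obtain ⟨⟨h1, h2⟩, h3⟩ := this
    rwa [heq h2 hbA' h3, ← heq h1 hbA h3]

theorem exists_hyperplane_le (U B : Submodule ℂ V) {d : ℕ} (hU : Module.finrank ℂ U = d + 1)
    (hBU : B ≤ U) (hne : B ≠ U) (f : Module.Dual ℂ V) (hf : ∀ x ∈ B, f x = 0) :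
    ∃ A : Submodule ℂ V, B ≤ A ∧ A ≤ U ∧ Module.finrank ℂ A = d ∧ ∀ x ∈ A, f x = 0 := by
  -- If f vanishes on U it cuts out no hyperplane there, and any functional that kills B but not U
  -- replaces it.
  have hex : ∃ f' : Module.Dual ℂ V, (∀ x ∈ B, f' x = 0) ∧ (∃ x ∈ U, f' x ≠ 0) ∧
      ∀ x ∈ U, f' x = 0 → f x = 0 := by
    by_cases h : ∃ x ∈ U, f x ≠ 0
    · exact ⟨f, hf, h, fun _ _ => id⟩
    · push Not at h
      obtain ⟨x, hxU, hxB⟩ := SetLike.exists_of_lt (lt_of_le_of_ne hBU hne)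
      obtain ⟨f', h1, h2⟩ := Submodule.exists_le_ker_of_notMem hxB
      exact ⟨f', fun x hx => h2 hx, ⟨x, hxU, h1⟩, fun x hx _ => h x hx⟩
  obtain ⟨f', h1, ⟨x, hx, hx'⟩, h3⟩ := hex
  refine ⟨U ⊓ LinearMap.ker f', le_inf hBU fun x hx => h1 x hx, inf_le_left, ?_,
    fun x hx => h3 x hx.1 hx.2⟩
  have h4 := finrank_ker_add_one (l := f'.domRestrict U) (v := ⟨x, hx⟩) hx'
  rw [LinearMap.ker_domRestrict, hU] at h4
  have h5 : Module.finrank ℂ (U ⊓ LinearMap.ker f' : Submodule ℂ V) =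
      Module.finrank ℂ ((LinearMap.ker f').comap U.subtype) := by
    rw [← finrank_map_of_injective U.injective_subtype, Submodule.map_comap_subtype]
  omega

/-- Induction on the codimension of U ⊓ U'. Pick b' ∈ U' outside U and a hyperplane A of U
containing U ⊓ U' and orthogonal to b'. Then A + ⟨b'⟩ is adjacent to U and meets U' in a larger
space. -/
theorem of_transvection_invariant (hω : ω.IsAlt)
    (he : ∀ v, (∀ w, ω v w = 0) → v ∈ Submodule.span ℂ {e})
    {P : Submodule ℂ V → Prop} (hP : ∀ U : Submodule ℂ V, Module.finrank ℂ U = n + 1 →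
      (∀ u ∈ U, ∀ v ∈ U, ω u v = 0) → P U → ∀ a t, P (U.map (symplecticTransvection ω a t)))
    {U U' : Submodule ℂ V} (hU : Module.finrank ℂ U = n + 1) (hU' : Module.finrank ℂ U' = n + 1)
    (hiso : ∀ u ∈ U, ∀ v ∈ U, ω u v = 0) (hiso' : ∀ u ∈ U', ∀ v ∈ U', ω u v = 0)
    (hee : e ∈ U ↔ e ∈ U') (h : P U) : P U' := by
  induction hd : n + 1 - Module.finrank ℂ (U ⊓ U' : Submodule ℂ V) using Nat.strong_induction_on
    generalizing U with
  | _ d ih =>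
  by_cases hUU : U ⊓ U' = U
  · rwa [← Submodule.eq_of_le_of_finrank_eq (inf_eq_left.mp hUU) (hU.trans hU'.symm)]
  have hlt := Submodule.finrank_lt_finrank_of_lt (lt_of_le_of_ne (inf_le_left : U ⊓ U' ≤ U) hUU)
  -- Choosing b' outside U + ⟨e⟩ ensures that the intermediate space contains e if and only if U
  -- does. When this is impossible, U and U' are already adjacent.
  by_cases hle : U' ≤ U ⊔ Submodule.span ℂ {e}
  · have hA : Module.finrank ℂ (U ⊓ U' : Submodule ℂ V) = n := by
      have h1 := Submodule.finrank_mono (sup_le le_sup_left hle : U ⊔ U' ≤ U ⊔ Submodule.span ℂ {e})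
      have h2 := Submodule.finrank_sup_add_finrank_inf_eq U U'
      have h3 : Module.finrank ℂ (U ⊔ Submodule.span ℂ {e} : Submodule ℂ V) ≤ n + 2 := by
        by_cases heU : e ∈ U
        · rw [sup_eq_left.mpr (by rwa [Submodule.span_singleton_le_iff_mem]), hU]; omega
        · rw [finrank_sup_span_singleton heU, hU]
      omega
    obtain ⟨b, hbA, hbU, hb⟩ := exists_eq_sup_span_singleton (A := U ⊓ U') (U := U) inf_le_left
      (by rw [hU, hA])
    obtain ⟨b', hbA', hbU', hb'⟩ := exists_eq_sup_span_singleton (A := U ⊓ U') (U := U') inf_le_right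
      (by rw [hU', hA])
    have := adjacent_of_transvection_invariant hω he hP hA (fun u hu v hv => hiso u hu.1 v hv.1)
      (b := b) (b' := b') (fun a ha => hiso a ha.1 b hbU) (fun a ha => hiso' a ha.2 b' hbU') hbA hbA'
      (by rw [← hb, ← hb']; exact hee) (by rwa [← hb])
    rwa [← hb'] at this
  · obtain ⟨b', hbU', hbe⟩ := SetLike.not_le_iff_exists.mp hle
    have hbU : b' ∉ U := fun h => hbe (Submodule.mem_sup_left h)
    obtain ⟨A, hBA, hAU, hA, hAb⟩ := exists_hyperplane_le U (U ⊓ U') hU inf_le_left hUU (ω b')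
      (fun x hx => hiso' b' hbU' x hx.2)
    have hb'A : ∀ a ∈ A, ω a b' = 0 := fun a ha => by rw [← hω.neg_eq, hAb a ha, neg_zero]
    have hbA' : b' ∉ A := fun h => hbU (hAU h)
    have hAiso : ∀ u ∈ A, ∀ v ∈ A, ω u v = 0 := fun u hu v hv => hiso u (hAU hu) v (hAU hv)
    obtain ⟨b, hbA, hb, hUb⟩ := exists_eq_sup_span_singleton hAU (by rw [hU, hA])
    have hee' : e ∈ U ↔ e ∈ A ⊔ Submodule.span ℂ {b'} := by
      constructor
      · intro h1
        exact Submodule.mem_sup_left (hBA ⟨h1, hee.mp h1⟩)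
      · intro h1
        obtain ⟨a, ha, c, hc, hac⟩ := Submodule.mem_sup.mp h1
        obtain ⟨r, rfl⟩ := Submodule.mem_span_singleton.mp hc
        by_cases hr : r = 0
        · rw [hr, zero_smul, add_zero] at hac
          exact hac ▸ hAU ha
        · exfalso
          apply hbe
          rw [← Submodule.smul_mem_iff _ hr, eq_sub_of_add_eq' hac]
          exact Submodule.sub_mem _ (Submodule.mem_sup_right (Submodule.mem_span_singleton_self e))
            (Submodule.mem_sup_left (hAU ha))
    have hA' : Module.finrank ℂ (A ⊔ Submodule.span ℂ {b'} : Submodule ℂ V) = n + 1 := by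
      rw [finrank_sup_span_singleton hbA', hA]
    have hPA := adjacent_of_transvection_invariant hω he hP hA hAiso
      (b := b) (b' := b') (fun a ha => hiso a (hAU ha) b hb) hb'A hbA hbA'
      (by rw [← hUb]; exact hee') (by rwa [← hUb])
    refine ih _ ?_ hA' (isotropic_sup_span hω hAiso hb'A) (hee'.symm.trans hee) hPA rfl
    have h1 : (U ⊓ U') ⊔ Submodule.span ℂ {b'} ≤ (A ⊔ Submodule.span ℂ {b'}) ⊓ U' := by
      refine le_inf (sup_le_sup_right hBA _) (sup_le inf_le_right ?_)
      rwa [Submodule.span_singleton_le_iff_mem]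
    have h2 := Submodule.finrank_mono h1
    rw [finrank_sup_span_singleton fun h : b' ∈ U ⊓ U' => hbU h.1] at h2
    omega

end Reachability

/-! ### Special lines of the isotropic Grassmannian detect the vector e -/

section LinearSubspacesOfIsotropic

variable {V : Type*} [AddCommGroup V] [Module ℂ V] [FiniteDimensional ℂ V] {n : ℕ}
  {ω : LinearMap.BilinForm ℂ V} {e : V}

/-- The orthogonal complement of a subspace. -/
def orthogonalSubspace (ω : LinearMap.BilinForm ℂ V) (A : Submodule ℂ V) : Submodule ℂ V where
  carrier := {b | ∀ a ∈ A, ω a b = 0}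
  add_mem' h h' a ha := by rw [map_add, h a ha, h' a ha, add_zero]
  zero_mem' a _ := map_zero _
  smul_mem' c b h a ha := by rw [map_smul, h a ha, smul_zero]

theorem finrank_add_finrank_orthogonalSubspace (hω : ω.IsAlt) (he' : ∀ w, ω w e = 0)
    (he : ∀ v, (∀ w, ω v w = 0) → v ∈ Submodule.span ℂ {e}) (A : Submodule ℂ V) :
    Module.finrank ℂ A + Module.finrank ℂ (orthogonalSubspace ω A) = Module.finrank ℂ V +
      Module.finrank ℂ (A ⊓ Submodule.span ℂ {e} : Submodule ℂ V) := by
  have hr : ω.IsRefl := hω.isRefl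
  have h := LinearMap.BilinForm.finrank_add_finrank_orthogonal hr A
  have h1 : LinearMap.BilinForm.orthogonal ω A = orthogonalSubspace ω A := rfl
  have h2 : LinearMap.BilinForm.orthogonal ω ⊤ = Submodule.span ℂ {e} := by
    ext v
    constructor
    · intro hv
      exact he v fun w => hr w v (hv w trivial)
    · intro hv w _
      obtain ⟨c, rfl⟩ := Submodule.mem_span_singleton.mp hv
      change ω w (c • e) = 0
      rw [map_smul, he', smul_zero]
  rw [h1, h2] at h
  exact h

theorem finrank_orthogonalSubspace_of_mem (hω : ω.IsAlt) (he0 : e ≠ 0) (he' : ∀ w, ω w e = 0)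
    (he : ∀ v, (∀ w, ω v w = 0) → v ∈ Submodule.span ℂ {e}) {A : Submodule ℂ V} (heA : e ∈ A) :
    Module.finrank ℂ A + Module.finrank ℂ (orthogonalSubspace ω A) = Module.finrank ℂ V + 1 := by
  rw [finrank_add_finrank_orthogonalSubspace hω he' he, inf_eq_right.mpr
    (by rwa [Submodule.span_singleton_le_iff_mem]), finrank_span_singleton he0]

theorem finrank_orthogonalSubspace_of_notMem (hω : ω.IsAlt) (he' : ∀ w, ω w e = 0)
    (he : ∀ v, (∀ w, ω v w = 0) → v ∈ Submodule.span ℂ {e}) {A : Submodule ℂ V} (heA : e ∉ A) :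
    Module.finrank ℂ A + Module.finrank ℂ (orthogonalSubspace ω A) = Module.finrank ℂ V := by
  have : A ⊓ Submodule.span ℂ {e} = ⊥ := by
    rw [eq_bot_iff]
    rintro x ⟨hx, hx'⟩
    obtain ⟨c, rfl⟩ := Submodule.mem_span_singleton.mp hx'
    by_cases hc : c = 0
    · simp [hc]
    · exact absurd ((A.smul_mem_iff hc).mp hx) heA
  rw [finrank_add_finrank_orthogonalSubspace hω he' he, this, finrank_bot, add_zero]

theorem star_mem_cone (hω : ω.IsAlt) {a : Fin n → V} (ha : LinearIndependent ℂ a)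
    (hiso : ∀ u ∈ Submodule.span ℂ (Set.range a), ∀ v ∈ Submodule.span ℂ (Set.range a), ω u v = 0)
    {b : V} (hb : b ∈ orthogonalSubspace ω (Submodule.span ℂ (Set.range a))) (h0 : star a b ≠ 0) :
    star a b ∈ cone (isotropicGrassmannian (n + 1) ω) :=
  mem_cone_isotropicGrassmannian_iff.mpr ⟨h0, _, by
    rw [finrank_sup_span_singleton ((star_ne_zero_iff ha).mp h0), finrank_span_eq_card ha,
      Fintype.card_fin], isotropic_sup_span hω hiso hb, star_mem_pluckerLine a b⟩

/-- This is the projective space of A^⊥ / A: the Plücker vector of A + ⟨b⟩ is linear in b. -/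
theorem isLinearSubspaceOf_map_star (hω : ω.IsAlt) {a : Fin n → V} (ha : LinearIndependent ℂ a)
    (hiso : ∀ u ∈ Submodule.span ℂ (Set.range a), ∀ v ∈ Submodule.span ℂ (Set.range a), ω u v = 0) :
    IsLinearSubspaceOf (isotropicGrassmannian (n + 1) ω)
      ((orthogonalSubspace ω (Submodule.span ℂ (Set.range a))).map (star a)) := by
  intro p hp
  obtain ⟨b, hb, hbp⟩ := hp (rep_mem p)
  rw [← mem_cone_iff (rep_mem p) p.rep_nonzero, ← hbp]
  exact star_mem_cone hω ha hiso hb (hbp ▸ p.rep_nonzero)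

theorem IsLinearSubspaceOf.mono {E : Type*} [AddCommGroup E] [Module ℂ E] {X : Set (ℙ ℂ E)}
    {W W' : Submodule ℂ E} (h : IsLinearSubspaceOf X W) (hW : W' ≤ W) : IsLinearSubspaceOf X W' :=
  fun p hp => h p (hp.trans hW)

theorem finrank_map_star {a : Fin n → V} (ha : LinearIndependent ℂ a) {B : Submodule ℂ V}
    (hB : Submodule.span ℂ (Set.range a) ≤ B) :
    Module.finrank ℂ (B.map (star a)) + n = Module.finrank ℂ B := by
  have h := LinearMap.finrank_range_add_finrank_ker ((star a).domRestrict B)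
  rw [LinearMap.range_domRestrict, LinearMap.ker_domRestrict, ker_star ha,
    (Submodule.comapSubtypeEquivOfLe hB).finrank_eq, finrank_span_eq_card ha, Fintype.card_fin] at h
  exact h

/-- If U and U' share a hyperplane A, their line lies in the linear subspace of all A + ⟨b⟩ with b ∈
A^⊥; the converse is `finrank_inf_of_add_mem`. -/
theorem collinear_iff (hω : ω.IsAlt) {U U' : Submodule ℂ V} (hU : Module.finrank ℂ U = n + 1)
    (hU' : Module.finrank ℂ U' = n + 1) (hiso : ∀ u ∈ U, ∀ v ∈ U, ω u v = 0)
    (hiso' : ∀ u ∈ U', ∀ v ∈ U', ω u v = 0) {p q : ℙ ℂ (⋀[ℂ]^(n + 1) V)}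
    (hp : p.submodule = pluckerLine (n + 1) U) (hq : q.submodule = pluckerLine (n + 1) U') :
    Collinear (isotropicGrassmannian (n + 1) ω) p q ↔
      n ≤ Module.finrank ℂ (U ⊓ U' : Submodule ℂ V) := by
  by_cases hUU : U = U'
  · subst hUU
    rw [inf_idem, hU]
    refine ⟨fun _ => by omega, fun _ y hy => ?_⟩
    rw [hp, hq, sup_idem, ← hp] at hy
    rw [← eq_of_mem (hy (rep_mem y)) (rep_mem y) y.rep_nonzero]
    exact ⟨U, hU, hiso, hp⟩
  have hpq : p ≠ q := by
    rintro rfl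
    exact hUU (eq_of_submodule_eq_pluckerLine hU hU' (hp.symm.trans hq))
  constructor
  · intro h
    have hs0 : p.rep + q.rep ≠ 0 := fun h0 => hpq (eq_of_mem (rep_mem p) (by
      rw [eq_neg_of_add_eq_zero_left h0]; exact Submodule.neg_mem _ (rep_mem q)) p.rep_nonzero)
    have hs : p.rep + q.rep ∈ cone (isotropicGrassmannian (n + 1) ω) := by
      rw [mem_cone_iff (mem_mk hs0) hs0]
      refine h _ ?_
      rw [Projectivization.submodule_mk, Submodule.span_singleton_le_iff_mem]
      exact Submodule.add_mem_sup (rep_mem p) (rep_mem q)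
    obtain ⟨-, U'', hU'', -, hs''⟩ := mem_cone_isotropicGrassmannian_iff.mp hs
    have := finrank_inf_of_add_mem hU hU' hU'' (hp ▸ rep_mem p) p.rep_nonzero (hq ▸ rep_mem q)
      q.rep_nonzero hs'' hs0
    omega
  · intro h
    have hlt := Submodule.finrank_lt_finrank_of_lt (lt_of_le_of_ne (inf_le_left : U ⊓ U' ≤ U)
      fun h => hUU (Submodule.eq_of_le_of_finrank_eq (inf_eq_left.mp h) (hU.trans hU'.symm)))
    have hA : Module.finrank ℂ (U ⊓ U' : Submodule ℂ V) = n := by omega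
    obtain ⟨b, hbA, hbU, hb⟩ := exists_eq_sup_span_singleton (A := U ⊓ U') (U := U) inf_le_left
      (by rw [hU, hA])
    obtain ⟨b', hbA', hbU', hb'⟩ := exists_eq_sup_span_singleton (A := U ⊓ U') (U := U') inf_le_right
      (by rw [hU', hA])
    obtain ⟨a, ha, haA⟩ := exists_family_of_finrank hA
    have hAU : ∀ {x}, x ∈ U ⊓ U' → x ∈ U ∧ x ∈ U' := fun h => h
    refine (isLinearSubspaceOf_map_star hω ha (fun u hu v hv => ?_)).mono (sup_le ?_ ?_)
    · rw [haA] at hu hv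
      exact hiso u hu.1 v hv.1
    · rw [hp, hb, ← haA, pluckerLine_sup_span_singleton ha (haA ▸ hbA),
        Submodule.span_singleton_le_iff_mem]
      exact ⟨b, fun x hx => hiso x (hAU (haA ▸ hx)).1 b hbU, rfl⟩
    · rw [hq, hb', ← haA, pluckerLine_sup_span_singleton ha (haA ▸ hbA'),
        Submodule.span_singleton_le_iff_mem]
      exact ⟨b', fun x hx => hiso' x (hAU (haA ▸ hx)).2 b' hbU', rfl⟩

/-- An isotropic subspace which is collinear with two points of a pencil whose span is not isotropic
contains the axis of the pencil. -/
theorem le_of_collinear_of_ne_zero (hω : ω.IsAlt) {A U₁ : Submodule ℂ V}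
    (hA : Module.finrank ℂ A = n) (hAiso : ∀ u ∈ A, ∀ v ∈ A, ω u v = 0)
    (hiso₁ : ∀ u ∈ U₁, ∀ v ∈ U₁, ω u v = 0) {b b' : V} (hb : b ∈ orthogonalSubspace ω A)
    (hb' : b' ∈ orthogonalSubspace ω A) (hbb : ω b b' ≠ 0)
    (h : n ≤ Module.finrank ℂ (U₁ ⊓ (A ⊔ Submodule.span ℂ {b}) : Submodule ℂ V))
    (h' : n ≤ Module.finrank ℂ (U₁ ⊓ (A ⊔ Submodule.span ℂ {b'}) : Submodule ℂ V)) : A ≤ U₁ := by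
  by_contra hn
  have key : ∀ b : V, n ≤ Module.finrank ℂ (U₁ ⊓ (A ⊔ Submodule.span ℂ {b}) : Submodule ℂ V) →
      ∃ a ∈ A, a + b ∈ U₁ := by
    intro b h
    have h1 : ¬ U₁ ⊓ (A ⊔ Submodule.span ℂ {b}) ≤ A := fun h2 => hn (by
      rw [← Submodule.eq_of_le_of_finrank_le h2 (by rwa [hA])]
      exact inf_le_left)
    obtain ⟨x, ⟨hx, hx'⟩, hxA⟩ := SetLike.not_le_iff_exists.mp h1
    obtain ⟨a, ha, c, hc, rfl⟩ := Submodule.mem_sup.mp hx'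
    obtain ⟨r, rfl⟩ := Submodule.mem_span_singleton.mp hc
    have hr : r ≠ 0 := by
      rintro rfl; rw [zero_smul, add_zero] at hxA; exact hxA ha
    refine ⟨r⁻¹ • a, A.smul_mem _ ha, ?_⟩
    have := U₁.smul_mem r⁻¹ hx
    rwa [smul_add, inv_smul_smul₀ hr] at this
  obtain ⟨a, ha, hab⟩ := key b h
  obtain ⟨a', ha', hab'⟩ := key b' h'
  have h1 := hiso₁ _ hab _ hab'
  have h2 : ω b a' = 0 := by rw [← hω.neg_eq, hb a' ha', neg_zero]
  rw [map_add ω, LinearMap.add_apply, map_add, map_add, hAiso a ha a' ha', hb' a ha, h2, zero_add,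
    zero_add, zero_add] at h1
  exact hbb h1

/-- Since n ≥ 1, there is a hyperplane A of U containing e. Write U = A + ⟨b⟩ and take b' ∈ A^⊥ with
ω(b, b') ≠ 0. Points collinear with the whole line from b to b' contain A and are therefore mutually
collinear. As e ∈ A, the quotient A^⊥ / A has dimension 2m + 2 - 2n. -/
theorem hasSpecialLine_of_mem {m : ℕ} (hn : 1 ≤ n) (hV : Module.finrank ℂ V = 2 * m + 1)
    (hnm : n + 1 ≤ m) (hω : ω.IsAlt) (he0 : e ≠ 0) (he' : ∀ w, ω w e = 0)
    (he : ∀ v, (∀ w, ω v w = 0) → v ∈ Submodule.span ℂ {e}) {x : ℙ ℂ (⋀[ℂ]^(n + 1) V)}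
    (hx : x ∈ isotropicThrough (n + 1) ω e) :
    HasSpecialLine (isotropicGrassmannian (n + 1) ω) (2 * m - 2 * n + 2) x := by
  obtain ⟨U, hU, hiso, hxU, heU⟩ := hx
  obtain ⟨A, heA, hAU, hA, -⟩ := exists_hyperplane_le U (Submodule.span ℂ {e}) hU
    (by rwa [Submodule.span_singleton_le_iff_mem]) (by
      intro h
      have := finrank_span_singleton (K := ℂ) he0
      rw [h] at this
      omega) 0 (fun _ _ => rfl)
  rw [Submodule.span_singleton_le_iff_mem] at heA
  obtain ⟨b, hbA, hbU, hUb⟩ := exists_eq_sup_span_singleton hAU (by rw [hU, hA])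
  have hAiso : ∀ u ∈ A, ∀ v ∈ A, ω u v = 0 := fun u hu v hv => hiso u (hAU hu) v (hAU hv)
  have hA' := finrank_orthogonalSubspace_of_mem hω he0 he' he heA
  have hU' := finrank_orthogonalSubspace_of_mem hω he0 he' he heU
  -- A^⊥ has one dimension more than U^⊥; a vector in the difference pairs nontrivially with b.
  have hle : ¬ orthogonalSubspace ω A ≤ orthogonalSubspace ω U := fun h => by
    have := Submodule.finrank_mono h
    omega
  obtain ⟨b', hbA', hbU'⟩ := SetLike.not_le_iff_exists.mp hle
  have hb : b ∈ orthogonalSubspace ω A := fun a ha => hiso a (hAU ha) b hbU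
  have hbb : ω b b' ≠ 0 := by
    intro h
    apply hbU'
    intro u hu
    rw [hUb] at hu
    obtain ⟨a, ha, c, hc, rfl⟩ := Submodule.mem_sup.mp hu
    obtain ⟨r, rfl⟩ := Submodule.mem_span_singleton.mp hc
    rw [map_add, LinearMap.add_apply, hbA' a ha, map_smul, LinearMap.smul_apply, h, smul_zero,
      add_zero]
  obtain ⟨a, ha, haA⟩ := exists_family_of_finrank hA
  have hWX := isLinearSubspaceOf_map_star hω ha (haA ▸ hAiso)
  have hWd := finrank_map_star ha (B := orthogonalSubspace ω (Submodule.span ℂ (Set.range a)))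
    (by rw [haA]; exact fun v hv u hu => hAiso u hu v hv)
  rw [haA] at hWX hWd
  have hb'A : b' ∉ A := fun h => hbb (by rw [← hω.neg_eq, hb b' h, neg_zero])
  have hind : LinearIndependent ℂ ![star a b, star a b'] := by
    rw [LinearIndependent.pair_iff]
    intro s t hst
    rw [← map_smul, ← map_smul, ← map_add, ← LinearMap.mem_ker, ker_star ha, haA] at hst
    have hker : ∀ c, c ∈ orthogonalSubspace ω A → ω (s • b + t • b') c = 0 := fun c hc => hc _ hst
    have h1 := hker b hb
    have h2 := hker b' hbA'
    simp only [map_add, map_smul, LinearMap.add_apply, LinearMap.smul_apply, smul_eq_mul,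
      hω.self_eq_zero] at h1 h2
    rw [← hω.neg_eq b b'] at h1
    simp only [mul_zero, zero_add, add_zero, mul_neg, neg_eq_zero] at h1 h2
    exact ⟨(mul_eq_zero.mp h2).resolve_right hbb, (mul_eq_zero.mp h1).resolve_right hbb⟩
  have hpt : ∀ {c} (hc : c ∉ A), (pluckerPoint (k := n + 1) (A ⊔ Submodule.span ℂ {c})
      (by rw [finrank_sup_span_singleton hc, hA])).submodule = Submodule.span ℂ {star a c} := by
    intro c hc
    rw [submodule_pluckerPoint, ← haA, pluckerLine_sup_span_singleton ha (haA ▸ hc)]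
  refine ⟨Submodule.span ℂ (Set.range ![star a b, star a b']), ?_, ?_, ?_, _, ?_, hWX, by omega⟩
  · rw [finrank_span_eq_card hind, Fintype.card_fin]
  · rw [hxU, hUb, ← haA, pluckerLine_sup_span_singleton ha (haA ▸ hbA),
      Submodule.span_singleton_le_iff_mem]
    exact Submodule.subset_span ⟨0, rfl⟩
  · have key : ∀ {U₁ : Submodule ℂ V} {p : ℙ ℂ (⋀[ℂ]^(n + 1) V)}, Module.finrank ℂ U₁ = n + 1 →
        (∀ u ∈ U₁, ∀ v ∈ U₁, ω u v = 0) → p.submodule = pluckerLine (n + 1) U₁ →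
        (∀ z : ℙ ℂ (⋀[ℂ]^(n + 1) V), z.submodule ≤
          Submodule.span ℂ (Set.range ![star a b, star a b']) →
          Collinear (isotropicGrassmannian (n + 1) ω) p z) → A ≤ U₁ := by
      intro U₁ p h1 h2 h3 h4
      have h5 := h4 _ ((hpt hbA).trans_le (by
        rw [Submodule.span_singleton_le_iff_mem]; exact Submodule.subset_span ⟨0, rfl⟩))
      have h6 := h4 _ ((hpt hb'A).trans_le (by
        rw [Submodule.span_singleton_le_iff_mem]; exact Submodule.subset_span ⟨1, rfl⟩))
      rw [collinear_iff hω h1 (by rw [finrank_sup_span_singleton hbA, hA]) h2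
        (isotropic_sup_span hω hAiso hb) h3 (submodule_pluckerPoint _ _)] at h5
      rw [collinear_iff hω h1 (by rw [finrank_sup_span_singleton hb'A, hA]) h2
        (isotropic_sup_span hω hAiso hbA') h3 (submodule_pluckerPoint _ _)] at h6
      exact le_of_collinear_of_ne_zero hω hA hAiso h2 hb hbA' hbb h5 h6
    rintro p ⟨U₁, h1, h2, h3⟩ q ⟨U₂, h1', h2', h3'⟩ h4 h4'
    rw [collinear_iff hω h1 h1' h2 h2' h3 h3', ← hA]
    exact Submodule.finrank_mono (le_inf (key h1 h2 h3 h4) (key h1' h2' h3' h4'))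
  · rw [Submodule.span_le]
    rintro _ ⟨i, rfl⟩
    fin_cases i
    · exact ⟨b, hb, rfl⟩
    · exact ⟨b', hbA', rfl⟩

/-- A line joining A + ⟨b⟩ and A + ⟨b'⟩ is special only if ω(b, b') ≠ 0. In that case every linear
subspace of X through it lies in the projective space of A^⊥ / A, and the dimension of W forces e ∈
A. -/
theorem mem_of_hasSpecialLine {m : ℕ} (hn : 1 ≤ n) (hV : Module.finrank ℂ V = 2 * m + 1)
    (hnm : n + 1 ≤ m) (hω : ω.IsAlt) (he' : ∀ w, ω w e = 0)
    (he : ∀ v, (∀ w, ω v w = 0) → v ∈ Submodule.span ℂ {e}) {x : ℙ ℂ (⋀[ℂ]^(n + 1) V)}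
    (h : HasSpecialLine (isotropicGrassmannian (n + 1) ω) (2 * m - 2 * n + 2) x) :
    x ∈ isotropicThrough (n + 1) ω e := by
  obtain ⟨L, hL, hxL, hs, W, hLW, hWX, hW⟩ := h
  have hLX := hWX.mono hLW
  obtain ⟨U, hU, hiso, hxU⟩ := hLX x hxL
  obtain ⟨w, hwL, hwx⟩ := SetLike.exists_of_lt (lt_of_le_of_ne hxL (by
    intro h; rw [← h, Projectivization.finrank_submodule] at hL; omega))
  have hw0 : w ≠ 0 := by rintro rfl; exact hwx (Submodule.zero_mem _)
  set y := Projectivization.mk ℂ w hw0 with hy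
  have hyL : y.submodule ≤ L := by
    rwa [hy, Projectivization.submodule_mk, Submodule.span_singleton_le_iff_mem]
  obtain ⟨U', hU', hiso', hyU'⟩ := hLX y hyL
  have hcoll : ∀ {p q : ℙ ℂ (⋀[ℂ]^(n + 1) V)}, p.submodule ≤ W → q.submodule ≤ W →
      Collinear (isotropicGrassmannian (n + 1) ω) p q := fun hp hq => hWX.mono (sup_le hp hq)
  have hxy : x ≠ y := fun h => hwx (h ▸ mem_mk hw0)
  have hUU : U ≠ U' := by
    rintro rfl
    exact hxy (Projectivization.submodule_injective (hxU.trans hyU'.symm))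
  have hinf := (collinear_iff hω hU hU' hiso hiso' hxU hyU').mp
    (hcoll (hxL.trans hLW) (hyL.trans hLW))
  have hlt := Submodule.finrank_lt_finrank_of_lt (lt_of_le_of_ne (inf_le_left : U ⊓ U' ≤ U)
    fun h => hUU (Submodule.eq_of_le_of_finrank_eq (inf_eq_left.mp h) (hU.trans hU'.symm)))
  obtain ⟨A, hAdef⟩ : ∃ A, A = U ⊓ U' := ⟨_, rfl⟩
  have hAU : A ≤ U := hAdef ▸ inf_le_left
  have hAU' : A ≤ U' := hAdef ▸ inf_le_right
  rw [← hAdef] at hinf hlt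
  have hA : Module.finrank ℂ A = n := by omega
  have hAiso : ∀ u ∈ A, ∀ v ∈ A, ω u v = 0 := fun u hu v hv => hiso u (hAU hu) v (hAU hv)
  obtain ⟨b, hbA, hbU, hb⟩ := exists_eq_sup_span_singleton hAU (by rw [hU, hA])
  obtain ⟨b', hbA', hbU', hb'⟩ := exists_eq_sup_span_singleton hAU' (by rw [hU', hA])
  have hbo : b ∈ orthogonalSubspace ω A := fun a ha => hiso a (hAU ha) b hbU
  have hbo' : b' ∈ orthogonalSubspace ω A := fun a ha => hiso' a (hAU' ha) b' hbU'
  rw [mem_isotropicThrough_iff hU hiso hxU]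
  obtain ⟨a, ha, haA⟩ := exists_family_of_finrank hA
  -- If b and b' are orthogonal, B = U + U' is isotropic. A space A + ⟨c⟩ with c ∈ A^⊥ outside B and
  -- a hyperplane of B not containing A are both collinear with every point of L, but they meet in
  -- dimension less than n.
  by_cases hbb : ω b b' = 0
  · exfalso
    obtain ⟨B, hBdef⟩ : ∃ B, B = U ⊔ Submodule.span ℂ {b'} := ⟨_, rfl⟩
    have hb'U : b' ∉ U := fun h => hbA' (hAdef ▸ ⟨h, hbU'⟩)
    have hB : Module.finrank ℂ B = (n + 1) + 1 := by rw [hBdef, finrank_sup_span_singleton hb'U, hU]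
    have hBiso : ∀ u ∈ B, ∀ v ∈ B, ω u v = 0 := by
      rw [hBdef]
      refine isotropic_sup_span hω hiso fun u hu => ?_
      rw [hb] at hu
      obtain ⟨c, hc, d, hd, rfl⟩ := Submodule.mem_sup.mp hu
      obtain ⟨r, rfl⟩ := Submodule.mem_span_singleton.mp hd
      rw [map_add, LinearMap.add_apply, hbo' c hc, map_smul, LinearMap.smul_apply, hbb, smul_zero,
        add_zero]
    have hAB : A ≤ B := hBdef ▸ hAU.trans le_sup_left
    -- A^⊥ has dimension at least 2m + 1 - n ≥ n + 3, while dim B = n + 2.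
    obtain ⟨c, hcA, hcB⟩ : ∃ c ∈ orthogonalSubspace ω A, c ∉ B := by
      by_contra! h
      have h1 := Submodule.finrank_mono (fun c hc => h c hc : orthogonalSubspace ω A ≤ B)
      have h2 := finrank_add_finrank_orthogonalSubspace hω he' he A
      omega
    have hcA' : c ∉ A := fun h => hcB (hAB h)
    obtain ⟨a₀, ha₀, ha₀0⟩ := A.ne_bot_iff.mp (by rintro h; rw [h, finrank_bot] at hA; omega)
    obtain ⟨f, hf⟩ := exists_dual_ne_zero ha₀0
    have hQ : Module.finrank ℂ (B ⊓ LinearMap.ker f : Submodule ℂ V) = n + 1 := by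
      have h4 := finrank_ker_add_one (l := f.domRestrict B) (v := ⟨a₀, hAB ha₀⟩) hf
      rw [LinearMap.ker_domRestrict, hB] at h4
      rw [← finrank_map_of_injective B.injective_subtype, Submodule.map_comap_subtype] at h4
      omega
    have hQiso : ∀ u ∈ B ⊓ LinearMap.ker f, ∀ v ∈ B ⊓ LinearMap.ker f, ω u v = 0 :=
      fun u hu v hv => hBiso u hu.1 v hv.1
    have hP : Module.finrank ℂ (A ⊔ Submodule.span ℂ {c} : Submodule ℂ V) = n + 1 := by
      rw [finrank_sup_span_singleton hcA', hA]
    have hPiso := isotropic_sup_span hω hAiso hcA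
    have hline : ∀ z : ℙ ℂ (⋀[ℂ]^(n + 1) V), z.submodule ≤ L → ∃ U₁ : Submodule ℂ V,
        Module.finrank ℂ U₁ = n + 1 ∧ (∀ u ∈ U₁, ∀ v ∈ U₁, ω u v = 0) ∧
        z.submodule = pluckerLine (n + 1) U₁ ∧ A ≤ U₁ ∧ U₁ ≤ B := by
      intro z hz
      have hLe : L = x.submodule ⊔ y.submodule :=
        (Submodule.eq_of_le_of_finrank_eq (sup_le hxL hyL) (by
          rw [finrank_sup_submodule hxy, hL])).symm
      have h1 := hz (rep_mem z)
      change x.submodule = pluckerLine (n + 1) U at hxU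
      change y.submodule = pluckerLine (n + 1) U' at hyU'
      rw [hLe, hxU, hyU', hb, hb', ← haA, pluckerLine_sup_span_singleton ha (haA ▸ hbA),
        pluckerLine_sup_span_singleton ha (haA ▸ hbA')] at h1
      obtain ⟨v₁, hv₁, v₂, hv₂, h1⟩ := Submodule.mem_sup.mp h1
      obtain ⟨r, rfl⟩ := Submodule.mem_span_singleton.mp hv₁
      obtain ⟨s, rfl⟩ := Submodule.mem_span_singleton.mp hv₂
      rw [← map_smul, ← map_smul, ← map_add] at h1
      have h2 : r • b + s • b' ∉ A := by
        have := z.rep_nonzero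
        rw [← h1, star_ne_zero_iff ha, haA] at this
        exact this
      refine ⟨A ⊔ Submodule.span ℂ {r • b + s • b'}, by rw [finrank_sup_span_singleton h2, hA],
        isotropic_sup_span hω hAiso ((orthogonalSubspace ω A).add_mem
          ((orthogonalSubspace ω A).smul_mem _ hbo) ((orthogonalSubspace ω A).smul_mem _ hbo')), ?_,
        le_sup_left, sup_le hAB ?_⟩
      · rw [← haA, pluckerLine_sup_span_singleton ha (haA ▸ h2), h1]
        exact submodule_eq_span (rep_mem z) z.rep_nonzero
      · rw [Submodule.span_singleton_le_iff_mem, hBdef]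
        exact Submodule.add_mem_sup (U.smul_mem _ hbU)
          (Submodule.smul_mem _ _ (Submodule.mem_span_singleton_self _))
    have h1 := hs (pluckerPoint _ hP) ⟨_, hP, hPiso, submodule_pluckerPoint _ hP⟩
      (pluckerPoint _ hQ) ⟨_, hQ, hQiso, submodule_pluckerPoint _ hQ⟩ (fun z hz => by
        obtain ⟨U₁, h1, h2, h3, h4, h5⟩ := hline z hz
        rw [collinear_iff hω hP h1 hPiso h2 (submodule_pluckerPoint _ hP) h3, ← hA]
        exact Submodule.finrank_mono (le_inf le_sup_left h4)) (fun z hz => by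
        obtain ⟨U₁, h1, h2, h3, h4, h5⟩ := hline z hz
        rw [collinear_iff hω hQ h1 hQiso h2 (submodule_pluckerPoint _ hQ) h3]
        have h6 := Submodule.finrank_sup_add_finrank_inf_eq (B ⊓ LinearMap.ker f) U₁
        have h7 := Submodule.finrank_mono (sup_le inf_le_left h5 : (B ⊓ LinearMap.ker f) ⊔ U₁ ≤ B)
        omega)
    rw [collinear_iff hω hP hQ hPiso hQiso (submodule_pluckerPoint _ hP)
      (submodule_pluckerPoint _ hQ)] at h1
    have h2 : (A ⊔ Submodule.span ℂ {c}) ⊓ (B ⊓ LinearMap.ker f) ≤ A ⊓ LinearMap.ker f := by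
      rintro v ⟨hv, hvB, hvf⟩
      refine ⟨?_, hvf⟩
      obtain ⟨d, hd, c', hc', rfl⟩ := Submodule.mem_sup.mp hv
      obtain ⟨r, rfl⟩ := Submodule.mem_span_singleton.mp hc'
      have h3 : r • c ∈ B := by
        have := B.sub_mem hvB (hAB hd)
        rwa [add_sub_cancel_left] at this
      by_cases hr : r = 0
      · rw [hr, zero_smul, add_zero]; exact hd
      · exact absurd ((B.smul_mem_iff hr).mp h3) hcB
    have h3 := Submodule.finrank_mono h2
    have h4 : Module.finrank ℂ (A ⊓ LinearMap.ker f : Submodule ℂ V) < Module.finrank ℂ A :=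
      Submodule.finrank_lt_finrank_of_lt (lt_of_le_of_ne inf_le_left fun h =>
        hf ((inf_eq_left.mp h) ha₀))
    omega
  -- Points of W are collinear with all of L and so contain A, which puts W inside the image of A^⊥.
  -- For e ∉ A this image has dimension only 2m - 2n + 1.
  · by_contra heU
    have heA : e ∉ A := fun h => heU (hAU h)
    have hWA : W ≤ (orthogonalSubspace ω A).map (star a) := by
      intro v hv
      by_cases hv0 : v = 0
      · rw [hv0]; exact Submodule.zero_mem _
      have hz : (Projectivization.mk ℂ v hv0).submodule ≤ W := by
        rwa [Projectivization.submodule_mk, Submodule.span_singleton_le_iff_mem]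
      obtain ⟨U₁, h1, h2, h3⟩ := hWX _ hz
      have h4 := (collinear_iff hω h1 hU h2 hiso h3 hxU).mp (hcoll hz (hxL.trans hLW))
      have h5 := (collinear_iff hω h1 hU' h2 hiso' h3 hyU').mp (hcoll hz (hyL.trans hLW))
      rw [hb] at h4
      rw [hb'] at h5
      have h6 := le_of_collinear_of_ne_zero hω hA hAiso h2 hbo hbo' hbb h4 h5
      obtain ⟨c, hcA, hcU, hc⟩ := exists_eq_sup_span_singleton h6 (by rw [h1, hA])
      have h7 := mem_mk hv0
      rw [h3] at h7
      change v ∈ pluckerLine (n + 1) U₁ at h7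
      rw [hc, ← haA, pluckerLine_sup_span_singleton ha (haA ▸ hcA),
        Submodule.mem_span_singleton] at h7
      obtain ⟨r, hr⟩ := h7
      rw [← hr]
      exact Submodule.smul_mem _ _ ⟨c, fun d hd => h2 d (h6 hd) c hcU, rfl⟩
    have h1 := Submodule.finrank_mono hWA
    have h2 := finrank_map_star ha (B := orthogonalSubspace ω (Submodule.span ℂ (Set.range a)))
      (by rw [haA]; exact fun v hv u hu => hAiso u hu v hv)
    rw [haA] at h2
    have h3 := finrank_orthogonalSubspace_of_notMem hω he' he heA
    omega

end LinearSubspacesOfIsotropic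

/-! ### Orbits of the automorphism group -/

section Orbits

variable {V : Type*} [AddCommGroup V] [Module ℂ V] [FiniteDimensional ℂ V] {n : ℕ}
  {ω : LinearMap.BilinForm ℂ V} {e : V}

theorem point_of_transvection_invariant (hω : ω.IsAlt)
    (he : ∀ v, (∀ w, ω v w = 0) → v ∈ Submodule.span ℂ {e})
    {P : ℙ ℂ (⋀[ℂ]^(n + 1) V) → Prop}
    (hP : ∀ (x : isotropicGrassmannian (n + 1) ω), P x → ∀ a t,
      P ((transvectionFlow (n + 1) hω a).τ t x))
    {x y : ℙ ℂ (⋀[ℂ]^(n + 1) V)} (hx : x ∈ isotropicGrassmannian (n + 1) ω)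
    (hy : y ∈ isotropicGrassmannian (n + 1) ω)
    (hxy : x ∈ isotropicThrough (n + 1) ω e ↔ y ∈ isotropicThrough (n + 1) ω e) (h : P x) : P y := by
  obtain ⟨U, hU, hiso, hxU⟩ := id hx
  obtain ⟨U', hU', hiso', hyU'⟩ := id hy
  change x.submodule = pluckerLine (n + 1) U at hxU
  change y.submodule = pluckerLine (n + 1) U' at hyU'
  rw [mem_isotropicThrough_iff hU hiso hxU, mem_isotropicThrough_iff hU' hiso' hyU'] at hxy
  have := of_transvection_invariant hω he
    (P := fun U => ∀ p : ℙ ℂ (⋀[ℂ]^(n + 1) V), p.submodule = pluckerLine (n + 1) U → P p)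
    (fun U hU hiso hPU a t p hp => by
      have h1 := hP ⟨pluckerPoint U hU, U, hU, hiso, submodule_pluckerPoint U hU⟩
        (hPU _ (submodule_pluckerPoint U hU)) a t
      have h2 := submodule_transvectionFlow hω a t
        (⟨pluckerPoint U hU, U, hU, hiso, submodule_pluckerPoint U hU⟩ : isotropicGrassmannian _ ω)
      have h3 := (h2.trans (congrArg _ (submodule_pluckerPoint U hU))).trans
        ((map_pluckerLine _ U).trans hp.symm)
      rwa [Projectivization.submodule_injective h3] at h1)
    hU hU' hiso hiso' hxy (fun p hp => by
      rwa [Projectivization.submodule_injective (hp.trans hxU.symm)])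
  exact this y hyU'

/-- Write U = A + ⟨b⟩. The spaces A + ⟨b + t e⟩ are isotropic, do not contain e, and tend to A + ⟨e⟩
as t → ∞. -/
theorem exists_mem_isotropicThrough_of_isClosed (he' : ∀ w, ω w e = 0) (hω : ω.IsAlt)
    {C : Set (ℙ ℂ (⋀[ℂ]^(n + 1) V))} (hC : IsClosed C)
    (h : ∀ p ∈ isotropicGrassmannian (n + 1) ω, p ∉ isotropicThrough (n + 1) ω e → p ∈ C)
    {x : ℙ ℂ (⋀[ℂ]^(n + 1) V)} (hx : x ∈ isotropicGrassmannian (n + 1) ω)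
    (hxe : x ∉ isotropicThrough (n + 1) ω e) : ∃ z ∈ isotropicThrough (n + 1) ω e, z ∈ C := by
  obtain ⟨U, hU, hiso, hxU⟩ := hx
  rw [mem_isotropicThrough_iff hU hiso hxU] at hxe
  obtain ⟨u, hu, rfl⟩ := exists_family_of_finrank hU
  set a : Fin n → V := fun i => u i.succ with ha
  set b := u 0 with hb
  have hau : (Fin.cons b a : Fin (n + 1) → V) = u := Fin.cons_self_tail u
  have hc := hu
  rw [← hau, linearIndependent_finCons] at hc
  obtain ⟨hal, hbA⟩ := hc
  have hAU : Submodule.span ℂ (Set.range a) ≤ Submodule.span ℂ (Set.range u) :=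
    Submodule.span_mono (by rintro _ ⟨i, rfl⟩; exact ⟨i.succ, rfl⟩)
  have hbU : b ∈ Submodule.span ℂ (Set.range u) := Submodule.subset_span ⟨0, rfl⟩
  have hA : Module.finrank ℂ (Submodule.span ℂ (Set.range a)) = n := by
    rw [finrank_span_eq_card hal, Fintype.card_fin]
  have hAiso : ∀ v ∈ Submodule.span ℂ (Set.range a), ∀ w ∈ Submodule.span ℂ (Set.range a),
      ω v w = 0 := fun v hv w hw => hiso v (hAU hv) w (hAU hw)
  have heA : e ∉ Submodule.span ℂ (Set.range a) := fun h => hxe (hAU h)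
  have hline : ∀ t : ℂ, star a b + t • star a e ∈ cone C := by
    intro t
    rw [← map_smul, ← map_add]
    have horth : ∀ c ∈ Submodule.span ℂ (Set.range a), ω c (b + t • e) = 0 := fun c hc => by
      rw [map_add, map_smul, he', smul_zero, add_zero, hiso c (hAU hc) b hbU]
    have hbt : b + t • e ∉ Submodule.span ℂ (Set.range a) := by
      intro h0
      by_cases ht : t = 0
      · rw [ht, zero_smul, add_zero] at h0; exact hbA h0
      · apply hxe
        rw [← Submodule.smul_mem_iff _ ht]
        have := Submodule.sub_mem _ (hAU h0) hbU
        rwa [add_sub_cancel_left] at this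
    have hf := finrank_sup_span_singleton hbt
    rw [hA] at hf
    have hi := isotropic_sup_span hω hAiso horth
    have hpt := submodule_pluckerPoint _ hf
    have h0 := (star_ne_zero_iff hal).mpr hbt
    have hm : star a (b + t • e) ∈ (pluckerPoint _ hf).submodule := by
      rw [hpt]; exact star_mem_pluckerLine a _
    rw [mem_cone_iff hm h0]
    refine h _ ⟨_, hf, hi, hpt⟩ ?_
    rw [mem_isotropicThrough_iff hf hi hpt]
    intro hmem
    obtain ⟨c, hc, d, hd, hcd⟩ := Submodule.mem_sup.mp hmem
    obtain ⟨r, rfl⟩ := Submodule.mem_span_singleton.mp hd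
    have h1 : (1 - r * t) • e = c + r • b := by
      calc (1 - r * t) • e = e - (r * t) • e := by module
        _ = c + r • (b + t • e) - (r * t) • e := by rw [hcd]
        _ = c + r • b := by module
    have h2 : 1 - r * t = 0 := by
      by_contra h2
      apply hxe
      rw [← Submodule.smul_mem_iff _ h2, h1]
      exact Submodule.add_mem _ (hAU hc) (Submodule.smul_mem _ _ hbU)
    rw [h2, zero_smul] at h1
    have hr : r ≠ 0 := by
      rintro rfl; rw [zero_mul, sub_zero] at h2; exact one_ne_zero h2
    apply hbA
    rw [← Submodule.smul_mem_iff _ hr, eq_neg_of_add_eq_zero_right h1.symm]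
    exact Submodule.neg_mem _ hc
  have he0 := (star_ne_zero_iff hal).mpr heA
  have hmem := mem_cone_of_isClosed hC he0 hline
  have hf := finrank_sup_span_singleton heA
  rw [hA] at hf
  have hi := isotropic_sup_span hω hAiso (b := e) (fun c _ => he' c)
  have hpt := submodule_pluckerPoint _ hf
  refine ⟨pluckerPoint _ hf, ⟨_, hf, hi, hpt,
    Submodule.mem_sup_right (Submodule.mem_span_singleton_self e)⟩, ?_⟩
  rw [← mem_cone_iff _ he0]
  · exact hmem
  · rw [hpt]; exact star_mem_pluckerLine a e

/-- The set g⁻¹(Z) is closed, and it is invariant under transvections because g τ_t g⁻¹ preserves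
special lines, which characterize Z. If it contains a point outside Z, it contains X \ Z by
transitivity, then a point of Z by closedness, and so everything. -/
theorem apply_mem_isotropicThrough_imp {m : ℕ} (hn : 1 ≤ n) (hV : Module.finrank ℂ V = 2 * m + 1)
    (hnm : n + 1 ≤ m) (hω : ω.IsAlt) (he0 : e ≠ 0) (he' : ∀ w, ω w e = 0)
    (he : ∀ v, (∀ w, ω v w = 0) → v ∈ Submodule.span ℂ {e})
    {g : isotropicGrassmannian (n + 1) ω ≃ isotropicGrassmannian (n + 1) ω} (hg : IsBiregular g)
    {x : isotropicGrassmannian (n + 1) ω}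
    (h : (g x : ℙ ℂ (⋀[ℂ]^(n + 1) V)) ∈ isotropicThrough (n + 1) ω e) :
    (x : ℙ ℂ (⋀[ℂ]^(n + 1) V)) ∈ isotropicThrough (n + 1) ω e := by
  by_contra hx
  let P : ℙ ℂ (⋀[ℂ]^(n + 1) V) → Prop := fun p =>
    ∃ y : isotropicGrassmannian (n + 1) ω, (y : ℙ ℂ (⋀[ℂ]^(n + 1) V)) = p ∧
      (g y : ℙ ℂ (⋀[ℂ]^(n + 1) V)) ∈ isotropicThrough (n + 1) ω e
  have hP : ∀ (x : isotropicGrassmannian (n + 1) ω), P x → ∀ a t,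
      P ((transvectionFlow (n + 1) hω a).τ t x) := by
    rintro x ⟨y, hy, hgy⟩ a t
    rw [Subtype.ext hy] at hgy
    exact ⟨_, rfl, mem_of_hasSpecialLine hn hV hnm hω he' he
      ((transvectionFlow (n + 1) hω a).hasSpecialLine_conj hg t
        (hasSpecialLine_of_mem hn hV hnm hω he0 he' he hgy))⟩
  have hclosed : IsClosed {y : isotropicGrassmannian (n + 1) ω |
      (g y : ℙ ℂ (⋀[ℂ]^(n + 1) V)) ∈ isotropicThrough (n + 1) ω e} :=
    (isClosed_isotropicThrough e).preimage hg.1.continuous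
  obtain ⟨C, hC, hCP⟩ := isClosed_induced_iff.mp hclosed
  have hCP' : ∀ y : isotropicGrassmannian (n + 1) ω, (y : ℙ ℂ (⋀[ℂ]^(n + 1) V)) ∈ C ↔
      (g y : ℙ ℂ (⋀[ℂ]^(n + 1) V)) ∈ isotropicThrough (n + 1) ω e := fun y =>
    Set.ext_iff.mp hCP y
  have hout : ∀ p ∈ isotropicGrassmannian (n + 1) ω, p ∉ isotropicThrough (n + 1) ω e → p ∈ C := by
    intro p hp hpe
    obtain ⟨y, rfl, hy⟩ := point_of_transvection_invariant hω he hP x.2 hp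
      ⟨fun h => absurd h hx, fun h => absurd h hpe⟩ ⟨x, rfl, h⟩
    exact (hCP' y).mpr hy
  obtain ⟨z, hz, hzC⟩ := exists_mem_isotropicThrough_of_isClosed he' hω hC hout x.2 hx
  have hzX := isotropicThrough_subset e hz
  -- This would put the whole image of g inside Z, against surjectivity of g and x ∉ Z.
  have hall : ∀ y : isotropicGrassmannian (n + 1) ω,
      (g y : ℙ ℂ (⋀[ℂ]^(n + 1) V)) ∈ isotropicThrough (n + 1) ω e := by
    intro y
    by_cases hy : (y : ℙ ℂ (⋀[ℂ]^(n + 1) V)) ∈ isotropicThrough (n + 1) ω e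
    · obtain ⟨y', hy', hgy'⟩ := point_of_transvection_invariant hω he hP hzX y.2
        ⟨fun _ => hy, fun _ => hz⟩ ⟨⟨z, hzX⟩, rfl, (hCP' ⟨z, hzX⟩).mp hzC⟩
      rwa [Subtype.ext hy'] at hgy'
    · exact (hCP' y).mp (hout y y.2 hy)
  have := hall (g.symm x)
  rw [g.apply_symm_apply] at this
  exact hx this

theorem apply_mem_isotropicThrough_iff {m : ℕ} (hn : 1 ≤ n) (hV : Module.finrank ℂ V = 2 * m + 1)
    (hnm : n + 1 ≤ m) (hω : ω.IsAlt) (he0 : e ≠ 0) (he' : ∀ w, ω w e = 0)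
    (he : ∀ v, (∀ w, ω v w = 0) → v ∈ Submodule.span ℂ {e})
    {g : isotropicGrassmannian (n + 1) ω ≃ isotropicGrassmannian (n + 1) ω} (hg : IsBiregular g)
    (x : isotropicGrassmannian (n + 1) ω) :
    (g x : ℙ ℂ (⋀[ℂ]^(n + 1) V)) ∈ isotropicThrough (n + 1) ω e ↔
      (x : ℙ ℂ (⋀[ℂ]^(n + 1) V)) ∈ isotropicThrough (n + 1) ω e := by
  refine ⟨apply_mem_isotropicThrough_imp hn hV hnm hω he0 he' he hg, fun h => ?_⟩
  refine apply_mem_isotropicThrough_imp hn hV hnm hω he0 he' he hg.symm ?_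
  rwa [g.symm_apply_apply]

theorem IsRegularMap.comp {E F G : Type*} [AddCommGroup E] [Module ℂ E] [AddCommGroup F]
    [Module ℂ F] [AddCommGroup G] [Module ℂ G] {A : Set (ℙ ℂ E)} {B : Set (ℙ ℂ F)} {f : A → B}
    {g : B → ℙ ℂ G} (hg : IsRegularMap g) (hf : IsRegularMap (fun a => (f a : ℙ ℂ F))) :
    IsRegularMap (fun a => g (f a)) := by
  intro a
  obtain ⟨U, hU, haU, d, G₁, hG₁, hfU⟩ := hf a
  obtain ⟨U', hU', haU', d', G₂, hG₂, hgU⟩ := hg (f a)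
  obtain ⟨r, P, hP, hPa, hPU⟩ := exists_form_of_isOpen hU' haU'
  obtain ⟨Q, hQ, hQP⟩ := hG₁.exists_comp hP
  have key : ∀ b : A, (b : ℙ ℂ E) ∈ U →
      (VanishesAt Q (b : ℙ ℂ E) ↔ VanishesAt P (f b : ℙ ℂ F)) := fun b hb => by
    obtain ⟨h1, h2⟩ := hfU b hb _ (rep_mem _) (b : ℙ ℂ E).rep_nonzero
    rw [vanishesAt_iff hQ (rep_mem _) (b : ℙ ℂ E).rep_nonzero, vanishesAt_iff hP h2 h1, hQP]
  refine ⟨U ∩ {p | ¬ VanishesAt Q p}, hU.inter (isOpen_not_vanishesAt hQ),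
    ⟨haU, fun h => hPa ((key a haU).mp h)⟩, d * d', fun v => G₂ (G₁ v), fun ψ => ?_,
    fun b hb v hv h0 => ?_⟩
  · obtain ⟨R, hR, hR'⟩ := hG₂ ψ
    obtain ⟨S, hS, hS'⟩ := hG₁.exists_comp hR
    exact ⟨S, hS, fun v => by rw [hR', hS']⟩
  · obtain ⟨h1, h2⟩ := hfU b hb.1 v hv h0
    exact hgU (f b) (hPU _ fun h => hb.2 ((key b hb.1).mpr h)) _ h2 h1

/-- The only possible orbits are Z and X \ Z: automorphisms respect the partition, and compositions
of transvections act transitively on each part. -/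
theorem mem_autOrbit_iff {m : ℕ} (hn : 1 ≤ n) (hV : Module.finrank ℂ V = 2 * m + 1)
    (hnm : n + 1 ≤ m) (hω : ω.IsAlt) (he0 : e ≠ 0) (he' : ∀ w, ω w e = 0)
    (he : ∀ v, (∀ w, ω v w = 0) → v ∈ Submodule.span ℂ {e})
    (x : isotropicGrassmannian (n + 1) ω) {y : ℙ ℂ (⋀[ℂ]^(n + 1) V)} :
    y ∈ autOrbit (isotropicGrassmannian (n + 1) ω) x ↔ y ∈ isotropicGrassmannian (n + 1) ω ∧
      ((x : ℙ ℂ (⋀[ℂ]^(n + 1) V)) ∈ isotropicThrough (n + 1) ω e ↔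
        y ∈ isotropicThrough (n + 1) ω e) := by
  constructor
  · rintro ⟨g, hg, rfl⟩
    exact ⟨(g x).2, (apply_mem_isotropicThrough_iff hn hV hnm hω he0 he' he hg x).symm⟩
  · rintro ⟨hy, hxy⟩
    refine point_of_transvection_invariant hω he
      (P := fun y => y ∈ autOrbit (isotropicGrassmannian (n + 1) ω) x) ?_ x.2 hy hxy
      ⟨Equiv.refl _, ⟨?_, ?_⟩, rfl⟩
    · rintro z ⟨g, hg, hgz⟩ a t
      have hA := (transvectionFlow (n + 1) hω a).isBiregular t
      refine ⟨g.trans ((transvectionFlow (n + 1) hω a).τ t), ⟨hA.1.comp hg.1, hg.2.comp hA.2⟩, ?_⟩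
      rw [Equiv.trans_apply, Subtype.ext hgz]
    · exact IsRegularMap.of_linearMap LinearMap.id fun a v hv h0 => ⟨h0, hv⟩
    · exact IsRegularMap.of_linearMap LinearMap.id fun a v hv h0 => ⟨h0, hv⟩

/-- Needed for Z to be nonempty. Starting from ⟨e⟩, an isotropic U of dimension j + 1 with j < m can
be enlarged because dim U^⊥ = 2m + 1 - j exceeds j + 1. -/
theorem exists_isotropic_of_finrank {m : ℕ} (hV : Module.finrank ℂ V = 2 * m + 1)
    (hω : ω.IsAlt) (he0 : e ≠ 0) (he' : ∀ w, ω w e = 0)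
    (he : ∀ v, (∀ w, ω v w = 0) → v ∈ Submodule.span ℂ {e}) {j : ℕ} (hj : j ≤ m) :
    ∃ U : Submodule ℂ V, Module.finrank ℂ U = j + 1 ∧ (∀ u ∈ U, ∀ v ∈ U, ω u v = 0) ∧ e ∈ U := by
  induction j with
  | zero =>
    refine ⟨Submodule.span ℂ {e}, finrank_span_singleton he0, fun u _ v hv => ?_,
      Submodule.mem_span_singleton_self e⟩
    obtain ⟨r, rfl⟩ := Submodule.mem_span_singleton.mp hv
    rw [map_smul, he', smul_zero]
  | succ j ih =>
    obtain ⟨U, hU, hiso, heU⟩ := ih (by omega)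
    have h1 := finrank_orthogonalSubspace_of_mem hω he0 he' he heU
    obtain ⟨b, hb, hbU⟩ : ∃ b ∈ orthogonalSubspace ω U, b ∉ U := by
      by_contra! h
      have h2 := Submodule.finrank_mono (fun b hb => h b hb : orthogonalSubspace ω U ≤ U)
      omega
    exact ⟨U ⊔ Submodule.span ℂ {b}, by rw [finrank_sup_span_singleton hbU, hU],
      isotropic_sup_span hω hiso hb, Submodule.mem_sup_left heU⟩

theorem isClosedAutOrbit_iff {m : ℕ} (hn : 1 ≤ n) (hV : Module.finrank ℂ V = 2 * m + 1)
    (hnm : n + 1 ≤ m) (hω : ω.IsAlt) (he0 : e ≠ 0) (he' : ∀ w, ω w e = 0)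
    (he : ∀ v, (∀ w, ω v w = 0) → v ∈ Submodule.span ℂ {e}) {Z : Set (ℙ ℂ (⋀[ℂ]^(n + 1) V))} :
    IsClosedAutOrbit (isotropicGrassmannian (n + 1) ω) Z ↔ Z = isotropicThrough (n + 1) ω e := by
  have key : ∀ x : isotropicGrassmannian (n + 1) ω,
      (x : ℙ ℂ (⋀[ℂ]^(n + 1) V)) ∈ isotropicThrough (n + 1) ω e →
      autOrbit (isotropicGrassmannian (n + 1) ω) x = isotropicThrough (n + 1) ω e := by
    intro x hx
    ext y
    rw [mem_autOrbit_iff hn hV hnm hω he0 he' he]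
    exact ⟨fun h => h.2.mp hx, fun h => ⟨isotropicThrough_subset e h, fun _ => h, fun _ => hx⟩⟩
  constructor
  · rintro ⟨hZ, x, rfl⟩
    refine key x (by_contra fun hx => ?_)
    obtain ⟨z, hz, hzC⟩ := exists_mem_isotropicThrough_of_isClosed he' hω hZ (fun p hp hpe =>
      (mem_autOrbit_iff hn hV hnm hω he0 he' he x).mpr
        ⟨hp, fun h => absurd h hx, fun h => absurd h hpe⟩) x.2 hx
    exact hx (((mem_autOrbit_iff hn hV hnm hω he0 he' he x).mp hzC).2.mpr hz)
  · rintro rfl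
    obtain ⟨U, hU, hiso, heU⟩ := exists_isotropic_of_finrank hV hω he0 he' he
      (show n ≤ m by omega)
    have hz : pluckerPoint U hU ∈ isotropicThrough (n + 1) ω e :=
      ⟨U, hU, hiso, submodule_pluckerPoint U hU, heU⟩
    exact ⟨isClosed_isotropicThrough e, ⟨_, isotropicThrough_subset e hz⟩, (key _ hz).symm⟩

theorem exists_span_eq_ker {m : ℕ} (hV : Module.finrank ℂ V = 2 * m + 1) (hω : ω.IsAlt)
    (hrank : Module.finrank ℂ (LinearMap.range ω) = 2 * m) :
    ∃ e : V, e ≠ 0 ∧ (∀ w, ω w e = 0) ∧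
      ∀ v, (∀ w, ω v w = 0) → v ∈ Submodule.span ℂ {e} := by
  have h := LinearMap.finrank_range_add_finrank_ker ω
  have h1 : Module.finrank ℂ (LinearMap.ker ω) = 1 := by omega
  obtain ⟨⟨e, he⟩, he0, hspan⟩ := finrank_eq_one_iff'.mp h1
  refine ⟨e, fun h => he0 (Subtype.ext h), fun w => ?_, fun v hv => ?_⟩
  · rw [← hω.neg_eq, LinearMap.mem_ker.mp he, LinearMap.zero_apply, neg_zero]
  · obtain ⟨c, hc⟩ := hspan ⟨v, LinearMap.mem_ker.mpr (LinearMap.ext hv)⟩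
    exact Submodule.mem_span_singleton.mpr ⟨c, congrArg Subtype.val hc⟩

end Orbits

end ProjVar

/-! ### The theorem -/

open ProjVar in
theorem proposition4p5 {V : Type*} [AddCommGroup V] [Module ℂ V] (m k : ℕ) (hk : 2 ≤ k) (hkm : k ≤ m)
    (hV : Module.finrank ℂ V = 2 * m + 1) (ω : LinearMap.BilinForm ℂ V) (hω : ω.IsAlt)
    (hrank : Module.finrank ℂ (LinearMap.range ω) = 2 * m) :
    (∃! Z, IsClosedAutOrbit (isotropicGrassmannian k ω) Z) ∧
    ∀ Z, IsClosedAutOrbit (isotropicGrassmannian k ω) Z →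
      ∀ x ∈ isotropicGrassmannian k ω,
        ∃ π : vmrt (isotropicGrassmannian k ω) x → PSpace (k - 1),
          IsRegularMap π ∧ Function.Surjective π ∧
          (x ∉ Z → IsProjectiveBundle (2 * m - 2 * k + 1) π) ∧
          (x ∈ Z →
            (∃ H : Set (PSpace (k - 1)), IsHyperplane H ∧
              (∀ v ∈ H, Isomorphic (preim π {v})
                (Set.univ : Set (PSpace (2 * m - 2 * k + 2)))) ∧
              (∀ v ∉ H, Isomorphic (preim π {v})
                (Set.univ : Set (PSpace (2 * m - 2 * k + 1))))) ∧
            ¬ IsSmoothVariety (vmrt (isotropicGrassmannian k ω) x)) := by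
  have : FiniteDimensional ℂ V := Module.finite_of_finrank_pos (by omega)
  obtain ⟨n, rfl⟩ : ∃ n, k = n + 1 := ⟨k - 1, by omega⟩
  have hn : 1 ≤ n := by omega
  obtain ⟨e, he0, he', he⟩ := exists_span_eq_ker hV hω hrank
  have hiff := fun Z => isClosedAutOrbit_iff (Z := Z) hn hV hkm hω he0 he' he
  refine ⟨⟨isotropicThrough (n + 1) ω e, (hiff _).mpr rfl, fun Z hZ => (hiff Z).mp hZ⟩, ?_⟩
  intro Z hZ x hx
  rw [(hiff Z).mp hZ]
  exact vmrt_structure hn hkm hV hω he0 he' he hx
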